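/- **Setting.** $\lambda$ is the security parameter. A PPT algorithm is a probabilistic program (which may flip coins and, more generally, draw uniform elements of $\{0,\dots,n-1\}$) whose number of steps is at most a polynomial in $\lambda$. A function $f$ is negligible if for every $c\in\mathbb N$ one has $f(\lambda)<\lambda^{-c}$ for all large $\lambda$. **BGN.** Let $\mathcal G$ be a bilinear group generator: a PPT algorithm which on input $\lambda$ outputs primes $q_1,q_2$ and a description of cyclic groups $\mathbb G,\mathbb G_1$ of order $n=q_1q_2$ with an admissible bilinear map $e:\mathbb G\times\mathbb G\to\mathbb G_1$ (that is, $e(u^a,v^b)=e(u,v)^{ab}$, and $e(g,g)\ne1$ for generators $g$ of $\mathbb G$), such that the group operations, $e$, and uniform sampling in $\mathbb G$ are computable in polynomial time from the description, which need not reveal $q_1,q_2$. $\mathtt{BGN.Gen}(1^\lambda)$ runs $\mathcal G$, draws $g\in\mathbb G$ and $r\in[n]$ uniformly, puts $h=(g^{r})^{q_2}$, and outputs $pk=(n,\mathbb G,\mathbb G_1,e,g,h)$ and $sk=q_1$. An integer $a\ge 0$ is encrypted in $\mathbb G$ as $g^ah^r$ with $r\in[n]$ uniform. BGN is semantically secure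 if no PPT adversary that is given $pk$, chooses two plaintexts and receives the encryption (in $\mathbb G$) of one of them can tell with non-negligible advantage which one it is. **PRP.** Let $F$ be a family of permutations $F_k$ of the identifier set $[N]$ (identified with $\{0,1\}^{\log N}$), for all $\lambda$, $k\in\{0,1\}^\lambda$ and $N\in\mathbb N$. It is a pseudorandom permutation (PRP) if it is computable in time polynomial in $\lambda$ and $N$, and no PPT distinguisher that names $N$ (in unary) and then adaptively queries a permutation of $[N]$ polynomially often can distinguish $F_k$, for uniform $k\in\{0,1\}^\lambda$, from a uniformly random permutation of $[N]$ with non-negligible advantage. **The scheme.** A graph $G$ has vertices $v_1,\dots,v_N$ and adjacency matrix $(a_{ij})\in\{0,1\}^{N\times N}$. In $\mathtt{SLP}$-$\mathtt{I}$, $\mathtt{KeyGen}(1^\lambda)$ draws $k\in\{0,1\}^\lambda$ uniformly and $(pk,sk)\gets\mathtt{BGN.Gen}(1^\lambda)$; the public key is $pk$, the secret key $(sk,k)$. $\mathtt{EncMatrix}$ encrypts every $a_{ij}$ independently in $\mathbb G$ as $m_{ij}$ and outputs the structure $T$ of size $|T|=N$ with $T[F_k(i)]=(m_{i1},\dots,m_{iN})$,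 together with $pk$. $\mathtt{TrapdoorGen}$ outputs for $v=v_i$ the trapdoor $\tau_v=(F_k(i),s)$ with a fresh uniform $s\in\{0,1\}^\lambda$. (The server algorithms, which compute encrypted scores from $\tau_v$ and $T$, using a keyed permutation family $\pi$ to shuffle them, and find a maximal score, play no role in the security experiments.) **Security.** Let $\mathcal L=(\mathcal L_{bld},\mathcal L_{qry})$ be a stateful leakage algorithm. For a stateful adversary $\mathcal A$ making $q=\mathrm{poly}(\lambda)$ queries, in the real experiment $\mathcal A(1^\lambda)$ chooses a graph $G$, receives $T\gets\mathtt{EncMatrix}(G)$ under fresh keys, then chooses adaptively $q$ query vertices, receiving the trapdoor $\tau_{v}$ of each before choosing the next, and finally outputs a bit. In the ideal experiment $T$ is produced by a stateful simulator $\mathcal S$ from $1^\lambda$ and $\mathcal L_{bld}(G)$, and the answer to the $i$-th query by $\mathcal S$ from $\mathcal L_{qry}(v_1),\dots,\mathcal L_{qry}(v_i)$. A scheme is adaptively semantically $\mathcal L$-secure against chosen-query attacks (CQA2) if for every PPT adversary $\mathcal A$ there is a PPT simulator $\mathcal S$ such that the probabilities that $\mathcal A$ outputs $1$ in the two experiments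 differ by a negligible function of $\lambda$. **Theorem.** If BGN is semantically secure and $F$ is a PRP, then $\mathtt{SLP}$-$\mathtt{I}$ is adaptively semantically $\mathcal L$-secure against chosen-query attacks (CQA2) for the leakage $\mathcal L_{bld}(G)=|T|$ (the number of vertices) and $\mathcal L_{qry}(v)=\tau_v$, in both of the following readings: $\tau_v$ is the trapdoor itself, generated by the leakage algorithm under a secret key drawn at the start of the ideal experiment; and $\tau_v$ serves only as a name of the queried vertex, so that $\mathcal L_{qry}$ reveals, for each query, nothing but the number of the first query of the same vertex. -/

import Mathlib

/-! ## Computation: probabilistic programs with a step count -/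

/-- Data handled by programs: natural numbers (in binary) and pairs. -/
inductive Data : Type
  | num (n : ℕ) : Data
  | pair (a b : Data) : Data

namespace Data

/-- Length of the representation of a datum. -/
def size : Data → ℕ
  | num n => Nat.size n + 1
  | pair a b => size a + size b + 1

def toNat : Data → ℕ
  | num n => n
  | pair _ _ => 0

def fst : Data → Data
  | num _ => num 0
  | pair a _ => a

def snd : Data → Data
  | num _ => num 0
  | pair _ b => b

def isPair : Data → Bool
  | num _ => false
  | pair _ _ => true

/-- A finite sequence is stored as nested pairs ending in a number. -/
def ofList : List Data → Data
  | [] => num 0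
  | a :: l => pair a (ofList l)

/-- Length of a stored sequence. -/
def length : Data → ℕ
  | num _ => 0
  | pair _ b => length b + 1

/-- Entry number `i` (from `0`) of a stored sequence; `num 0` beyond its end. -/
def nth : Data → ℕ → Data
  | num _, _ => num 0
  | pair a _, 0 => a
  | pair _ b, i + 1 => nth b i

end Data

/-- Elementary operations; the binary ones read two numbers from a pair. -/
inductive Op : Type
  | skip | const (n : ℕ) | fst | snd | isPair | add | sub | mul | div | mod | lt

def Op.eval : Op → Data → Data
  | skip, x => x
  | const n, _ => .num n
  | fst, x => x.fst
  | snd, x => x.snd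
  | isPair, x => .num x.isPair.toNat
  | add, x => .num (x.fst.toNat + x.snd.toNat)
  | sub, x => .num (x.fst.toNat - x.snd.toNat)
  | mul, x => .num (x.fst.toNat * x.snd.toNat)
  | div, x => .num (x.fst.toNat / x.snd.toNat)
  | mod, x => .num (x.fst.toNat % x.snd.toNat)
  | lt, x => .num (decide (x.fst.toNat < x.snd.toNat)).toNat

/-- Probabilistic programs: maps from data to data. -/
inductive Prog : Type
  /-- an elementary operation -/
  | op (o : Op) : Prog
  /-- on a number `n`, draw a uniform element of `{0, …, n - 1}` -/
  | rand : Prog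
  /-- `P`, then `Q` on its result -/
  | seq (P Q : Prog) : Prog
  /-- run `P` and `Q` on the input and pair the results -/
  | both (P Q : Prog) : Prog
  /-- if `C` yields a nonzero number then `P` else `Q`, on the same input -/
  | ite (C P Q : Prog) : Prog
  /-- as long as `C` yields a nonzero number, replace the current value by what `P` makes of it -/
  | loop (C P : Prog) : Prog
  /-- subroutine call under a timer: on `(t, y)`, run `P` on `y` for at most `t` steps and
  return `(1, result)`, or `0` if `P` has not halted when the timer expires -/
  | timed (P : Prog) : Prog

/-- Uniform distribution on `{0, …, n - 1}` (and `0` if `n = 0`). -/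
noncomputable def randBelow : ℕ → PMF ℕ
  | 0 => PMF.pure 0
  | n + 1 => (PMF.uniformOfFintype (Fin (n + 1))).map Fin.val

namespace Prog

/-- Outcome of a run with a step budget: the result and the unused budget, or `none` if the
budget did not suffice. -/
abbrev Outcome : Type := Option (Data × ℕ)

/-- Continue with the result and the remaining budget. -/
noncomputable def andThen (μ : PMF Outcome) (f : ℕ → Data → PMF Outcome) : PMF Outcome :=
  μ.bind fun
    | none => PMF.pure none
    | some (y, t) => f t y

/-- Pay `c` steps out of the budget `t`. -/
noncomputable def pay (c t : ℕ) (f : ℕ → PMF Outcome) : PMF Outcome :=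
  if c ≤ t then f (t - c) else PMF.pure none

/-- At most `k` rounds of a while loop with test `c` and body `p`. -/
noncomputable def rounds (c p : ℕ → Data → PMF Outcome) : ℕ → ℕ → Data → PMF Outcome
  | 0, _, _ => PMF.pure none
  | k + 1, t, x =>
      andThen (c t x) fun t₁ v =>
        if v.toNat = 0 then PMF.pure (some (x, t₁))
        else andThen (p t₁ x) fun t₂ y => rounds c p k t₂ y

/-- `P.run t x` runs `P` on `x` with a budget of `t` steps.  An elementary operation costs one
step plus the lengths of what it reads and writes.  Every round of a loop costs at least one step,
so the bound on the number of rounds in the clause for `loop` never takes effect before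
the budget does. -/
noncomputable def run : Prog → ℕ → Data → PMF Outcome
  | op o, t, x => pay (1 + x.size + (o.eval x).size) t fun t' => PMF.pure (some (o.eval x, t'))
  | rand, t, x => pay (1 + 2 * x.size) t fun t' =>
      (randBelow x.toNat).map fun n => some (Data.num n, t')
  | seq P Q, t, x => andThen (run P t x) fun t' y => run Q t' y
  | both P Q, t, x =>
      andThen (run P t x) fun t₁ y => andThen (run Q t₁ x) fun t₂ z =>
        pay 1 t₂ fun t' => PMF.pure (some (Data.pair y z, t'))
  | ite C P Q, t, x =>
      andThen (run C t x) fun t' v => if v.toNat = 0 then run Q t' x else run P t' x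
  | loop C P, t, x => rounds (run C) (run P) t t x
  | timed P, t, x => pay (1 + x.size + x.fst.toNat) t fun t' =>
      (run P x.fst.toNat x.snd).map fun
        | none => some (Data.num 0, t')
        | some (z, _) => some (Data.pair (Data.num 1) z, t')

/-- On input `x`, the program always halts within `t` steps, and its result has law `μ`. -/
def Computes (P : Prog) (t : ℕ) (x : Data) (μ : PMF Data) : Prop :=
  (P.run t x).map (Option.map Prod.fst) = μ.map some

end Prog

/-- A probabilistic polynomial-time machine: a program together with a polynomial bound,
in the security parameter, on the number of steps of a run. -/
structure PPT where
  code : Prog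
  clock : Polynomial ℕ

namespace PPT

/-- The law of the output at security parameter `lam`; a run stopped by the clock outputs `0`. -/
noncomputable def run (M : PPT) (lam : ℕ) (x : Data) : PMF Data :=
  (M.code.run (M.clock.eval lam) x).map fun
    | none => Data.num 0
    | some (y, _) => y

/-- At security parameter `lam` and on input `x`, `M` always halts before its clock stops it,
and its result has law `μ`. -/
def Computes (M : PPT) (lam : ℕ) (x : Data) (μ : PMF Data) : Prop :=
  M.code.Computes (M.clock.eval lam) x μ

end PPT

/-- Negligible functions. -/
def Negligible (f : ℕ → ℝ) : Prop :=
  ∀ c : ℕ, ∃ N : ℕ, ∀ n > N, f n < 1 / (n : ℝ) ^ c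

/-- Distance of the probabilities with which two experiments output `1` (`true`). -/
noncomputable def advantage (μ ν : PMF Bool) : ℝ :=
  |(μ true).toReal - (ν true).toReal|

/-- Independent samples of `n` distributions. -/
noncomputable def indep {α : Type} : (n : ℕ) → (Fin n → PMF α) → PMF (Fin n → α)
  | 0, _ => PMF.pure Fin.elim0
  | n + 1, f => do
      let a ← f 0
      let v ← indep n fun i => f i.succ
      PMF.pure (Fin.cons a v)

/-- Uniform strings of `lam` bits, read as numbers below `2 ^ lam`. -/
noncomputable def randBits (lam : ℕ) : PMF ℕ := randBelow (2 ^ lam)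

/-- Uniform element of `[n] = {1, …, n}`, for `1 ≤ n`. -/
noncomputable def randOne (n : ℕ) : PMF ℕ := (randBelow n).map (· + 1)

/-- Discrete logarithm: the least exponent. -/
noncomputable def dlog {M : Type} [Monoid M] (b x : M) : ℕ := sInf {s : ℕ | b ^ s = x}

/-! ## Bilinear groups -/

/-- Two cyclic groups of order `n` with an admissible bilinear map; group elements have unique
representations as data. -/
structure BilinearGroup where
  n : ℕ
  G : Type
  G₁ : Type
  [commG : CommGroup G]
  [commG₁ : CommGroup G₁]
  [fintypeG : Fintype G]
  [fintypeG₁ : Fintype G₁]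
  [cyclicG : IsCyclic G]
  [cyclicG₁ : IsCyclic G₁]
  card_G : Fintype.card G = n
  card_G₁ : Fintype.card G₁ = n
  e : G → G → G₁
  bilinear : ∀ (u v : G) (a b : ℤ), e (u ^ a) (v ^ b) = e u v ^ (a * b)
  nondegenerate : ∀ g : G, (∀ x : G, x ∈ Subgroup.zpowers g) → e g g ≠ 1
  repr : G ↪ Data
  repr₁ : G₁ ↪ Data

attribute [instance] BilinearGroup.commG BilinearGroup.commG₁ BilinearGroup.fintypeG
  BilinearGroup.fintypeG₁ BilinearGroup.cyclicG BilinearGroup.cyclicG₁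

/-- A generator of bilinear groups: on a security parameter it outputs two primes `q₁`, `q₂` and a
description `d` of a bilinear group `grp d` of order `q₁ * q₂`.  It runs in polynomial time, and so
do the group operations, the bilinear map and the sampling of a uniform element of the first group,
given the description (which need not reveal `q₁` and `q₂`). -/
structure BilinearGenerator where
  gen : ℕ → PMF (ℕ × ℕ × Data)
  grp : Data → BilinearGroup
  prime₁ : ∀ lam, ∀ o ∈ (gen lam).support, o.1.Prime
  prime₂ : ∀ lam, ∀ o ∈ (gen lam).support, o.2.1.Prime
  order : ∀ lam, ∀ o ∈ (gen lam).support, (grp o.2.2).n = o.1 * o.2.1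
  gen_ppt : ∃ M : PPT, ∀ lam, M.Computes lam (.num lam)
    ((gen lam).map fun o => .pair (.num o.1) (.pair (.num o.2.1) o.2.2))
  mul_ppt : ∃ M : PPT, ∀ lam, ∀ o ∈ (gen lam).support, ∀ a b : (grp o.2.2).G,
    M.Computes lam (.pair o.2.2 (.pair ((grp o.2.2).repr a) ((grp o.2.2).repr b)))
      (PMF.pure ((grp o.2.2).repr (a * b)))
  mul₁_ppt : ∃ M : PPT, ∀ lam, ∀ o ∈ (gen lam).support, ∀ a b : (grp o.2.2).G₁,
    M.Computes lam (.pair o.2.2 (.pair ((grp o.2.2).repr₁ a) ((grp o.2.2).repr₁ b)))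
      (PMF.pure ((grp o.2.2).repr₁ (a * b)))
  e_ppt : ∃ M : PPT, ∀ lam, ∀ o ∈ (gen lam).support, ∀ a b : (grp o.2.2).G,
    M.Computes lam (.pair o.2.2 (.pair ((grp o.2.2).repr a) ((grp o.2.2).repr b)))
      (PMF.pure ((grp o.2.2).repr₁ ((grp o.2.2).e a b)))
  sample_ppt : ∃ M : PPT, ∀ lam, ∀ o ∈ (gen lam).support,
    M.Computes lam o.2.2 ((PMF.uniformOfFintype (grp o.2.2).G).map (grp o.2.2).repr)

/-! ## The BGN encryption scheme -/

namespace BGN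

variable (B : BilinearGenerator)

/-- Public keys `(n, 𝔾, 𝔾₁, e, g, h)`, the groups and the map being given by the description `d`;
`lam` records the security parameter. -/
structure PublicKey where
  lam : ℕ
  n : ℕ
  d : Data
  g : (B.grp d).G
  h : (B.grp d).G

variable {B}

/-- The public key as a datum. -/
def PublicKey.data (pk : PublicKey B) : Data :=
  .pair (.num pk.lam) (.pair (.num pk.n) (.pair pk.d
    (.pair ((B.grp pk.d).repr pk.g) ((B.grp pk.d).repr pk.h))))

variable (B) in
/-- Key generation; the secret key is `q₁`. -/
noncomputable def keyGen (lam : ℕ) : PMF (PublicKey B × ℕ) := do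
  let o ← B.gen lam
  let q₁ := o.1
  let q₂ := o.2.1
  let d := o.2.2
  let n := q₁ * q₂
  let g ← PMF.uniformOfFintype (B.grp d).G
  let r ← randOne n
  let u := g ^ r
  let h := u ^ q₂
  PMF.pure (⟨lam, n, d, g, h⟩, q₁)

/-- Encryption in `𝔾`. -/
noncomputable def encrypt (pk : PublicKey B) (a : ℕ) : PMF (B.grp pk.d).G := do
  let r ← randOne pk.n
  PMF.pure (pk.g ^ a * pk.h ^ r)

/-- Decryption in `𝔾`. -/
noncomputable def decrypt (pk : PublicKey B) (q₁ : ℕ) (c : (B.grp pk.d).G) : ℕ :=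
  dlog (pk.g ^ q₁) (c ^ q₁)

/-- Encryption in `𝔾₁`. -/
noncomputable def encrypt₁ (pk : PublicKey B) (a : ℕ) : PMF (B.grp pk.d).G₁ := do
  let r ← randOne pk.n
  PMF.pure ((B.grp pk.d).e pk.g pk.g ^ a * (B.grp pk.d).e pk.g pk.h ^ r)

/-- Decryption in `𝔾₁`. -/
noncomputable def decrypt₁ (pk : PublicKey B) (q₁ : ℕ) (c : (B.grp pk.d).G₁) : ℕ :=
  dlog ((B.grp pk.d).e pk.g pk.g ^ q₁) (c ^ q₁)

/-- A chosen-plaintext adversary: `choose` sees the public key and outputs two plaintexts and a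
state, `guess` sees the state and one challenge ciphertext. -/
structure Adversary where
  choose : PPT
  guess : PPT

variable (B) in
/-- The chosen-plaintext experiment in which plaintext number `b` is encrypted. -/
noncomputable def experiment (A : Adversary) (b : Bool) (lam : ℕ) : PMF Bool := do
  let keys ← keyGen B lam
  let pk := keys.1
  let o ← A.choose.run lam (.pair (.num lam) pk.data)
  let m₀ := o.fst.toNat
  let m₁ := o.snd.fst.toNat
  let st := o.snd.snd
  let c ← encrypt pk (if b then m₁ else m₀)
  let z ← A.guess.run lam (.pair st ((B.grp pk.d).repr c))
  PMF.pure (decide (z.toNat = 1))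

variable (B) in
/-- Semantic security of BGN: indistinguishability of ciphertexts under chosen plaintexts, with
one challenge ciphertext. -/
def SemanticallySecure : Prop :=
  ∀ A : Adversary, Negligible fun lam =>
    advantage (experiment B A false lam) (experiment B A true lam)

end BGN

/-! ## Pseudorandom permutations -/

/-- A keyed family of permutations: for every key length `lam`, key `k` and `N`, a permutation of
the set of `N` identifiers. -/
def PermFamily : Type := ℕ → ℕ → (N : ℕ) → Equiv.Perm (Fin N)

/-- The family is computable in time polynomial in the key length and the domain size. -/
def PermFamily.Efficient (F : PermFamily) : Prop :=
  ∃ (P : Prog) (p : Polynomial ℕ), ∀ lam k N : ℕ, k < 2 ^ lam → ∀ x : Fin N,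
    P.Computes (p.eval (lam + N))
      (.pair (.num lam) (.pair (.num k) (.pair (.num N) (.num x))))
      (PMF.pure (.num (F lam k N x)))

/-- A distinguisher for permutations: `start` names a domain size `N` in unary (as the length of a
sequence), `query` adaptively asks for values, `guess` outputs a bit. -/
structure PermDistinguisher where
  start : PPT
  query : PPT
  guess : PPT
  queries : Polynomial ℕ

namespace PermDistinguisher

/-- Oracle phase with `m` queries left; returns the final state and all answers (the most recent
first).  A query outside the domain is answered by `0`. -/
noncomputable def ask (D : PermDistinguisher) (lam : ℕ) {N : ℕ} (σ : Equiv.Perm (Fin N)) :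
    ℕ → Data → Data → PMF (Data × Data)
  | 0, st, ans => PMF.pure (st, ans)
  | m + 1, st, ans => do
      let o ← D.query.run lam (.pair st ans)
      let y : Data :=
        if hx : o.fst.toNat < N then .num (σ ⟨o.fst.toNat, hx⟩ : ℕ) else .num 0
      ask D lam σ m o.snd (.pair y ans)

/-- The distinguishing experiment, the permutation being drawn from `pick N`. -/
noncomputable def experiment (D : PermDistinguisher) (lam : ℕ)
    (pick : (N : ℕ) → PMF (Equiv.Perm (Fin N))) : PMF Bool := do
  let o ← D.start.run lam (.num lam)
  let σ ← pick o.fst.length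
  let w ← D.ask lam σ (D.queries.eval lam) o.snd (.num 0)
  let z ← D.guess.run lam (.pair w.1 w.2)
  PMF.pure (decide (z.toNat = 1))

end PermDistinguisher

/-- Pseudorandom permutation family: efficient, and under a random key not distinguishable from a
uniformly random permutation. -/
def PermFamily.IsPRP (F : PermFamily) : Prop :=
  F.Efficient ∧
  ∀ D : PermDistinguisher, Negligible fun lam =>
    advantage
      (D.experiment lam fun N => (randBits lam).map fun k => F lam k N)
      (D.experiment lam fun N => PMF.uniformOfFintype (Equiv.Perm (Fin N)))

/-! ## Secure link prediction schemes and adaptive security -/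

/-- A graph with vertex set `{0, …, N - 1}` and an arbitrary set of edges `E ⊆ V × V`. -/
structure VGraph where
  N : ℕ
  edge : Fin N → Fin N → Bool

/-- Entry of the adjacency matrix. -/
def VGraph.entry (Γ : VGraph) (i j : Fin Γ.N) : ℕ := (Γ.edge i j).toNat

/-- The graph given by its adjacency matrix, a sequence of rows. -/
def VGraph.ofData (x : Data) : VGraph where
  N := x.length
  edge i j := decide (((x.nth i).nth j).toNat ≠ 0)

/-- A secure link prediction scheme: its five algorithms, with the representations of
the encrypted structure and of the trapdoors as data.  The secret key consists of the part that the
proxy gets and the part that only the client has. -/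
structure SLPScheme where
  PK : Type
  ProxyKey : Type
  ClientKey : Type
  /-- encrypted structures under a given public key -/
  Tab : PK → Type
  Trap : Type
  /-- lists of encrypted scores under a given public key -/
  Resp : PK → Type
  keyGen : ℕ → PMF (PK × (ProxyKey × ClientKey))
  encMatrix : VGraph → ProxyKey × ClientKey → (pk : PK) → PMF (Tab pk)
  trapdoorGen : {N : ℕ} → Fin N → ProxyKey × ClientKey → PMF Trap
  lpQuery : Trap → {pk : PK} → Tab pk → PMF (Resp pk)
  findMaxVertex : (pk : PK) → ProxyKey → Resp pk → Option ℕ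
  tabData : (pk : PK) → Tab pk → Data
  trapData : Trap → Data

/-- Stateful leakage algorithm, possibly randomized. -/
structure Leakage where
  /-- states, for graphs with `N` vertices -/
  State : ℕ → Type
  bld : ℕ → (Γ : VGraph) → PMF (Data × State Γ.N)
  qry : {N : ℕ} → State N → Fin N → PMF (Data × State N)

/-- A stateful chosen-query adversary, consisting of its first stage, of the stages that choose the
queries, of the last stage, and of the polynomial number of queries.  The number of a query is
visible from the list of the earlier trapdoors. -/
structure CQAdversary where
  start : PPT
  query : PPT
  guess : PPT
  queries : Polynomial ℕ

/-- A stateful simulator. -/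
structure CQSimulator where
  start : PPT
  answer : PPT

namespace SLPScheme

/-- Query phase of the real experiment, with `m` queries left; returns the final state and the
list of trapdoors, the most recent first.  A request that is not a vertex is answered by `0`. -/
noncomputable def realQueries (X : SLPScheme) (A : CQAdversary) (lam : ℕ)
    (sk : X.ProxyKey × X.ClientKey) (N : ℕ) (T : Data) :
    ℕ → Data → Data → PMF (Data × Data)
  | 0, st, τs => PMF.pure (st, τs)
  | m + 1, st, τs => do
      let o ← A.query.run lam (.pair st (.pair T τs))
      let τ ← if hv : o.fst.toNat < N
        then (X.trapdoorGen ⟨o.fst.toNat, hv⟩ sk).map X.trapData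
        else PMF.pure (.num 0)
      realQueries X A lam sk N T m o.snd (.pair τ τs)

/-- The real experiment. -/
noncomputable def real (X : SLPScheme) (A : CQAdversary) (lam : ℕ) : PMF Bool := do
  let keys ← X.keyGen lam
  let pk := keys.1
  let sk := keys.2
  let o ← A.start.run lam (.num lam)
  let Γ := VGraph.ofData o.fst
  let tab ← X.encMatrix Γ sk pk
  let T := X.tabData pk tab
  let w ← X.realQueries A lam sk Γ.N T (A.queries.eval lam) o.snd (.num 0)
  let z ← A.guess.run lam (.pair w.1 (.pair T w.2))
  PMF.pure (decide (z.toNat = 1))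

end SLPScheme

namespace Leakage

/-- Query phase of the ideal experiment, with `m` queries left.  The simulator (state `stS`)
gets the leakages of all queries up to the current one, the most recent first. -/
noncomputable def idealQueries (L : Leakage) (A : CQAdversary) (S : CQSimulator) (lam : ℕ)
    {N : ℕ} (T : Data) :
    ℕ → Data → Data → L.State N → Data → Data → PMF (Data × Data)
  | 0, st, τs, _, _, _ => PMF.pure (st, τs)
  | m + 1, st, τs, ℓ, leaks, stS => do
      let o ← A.query.run lam (.pair st (.pair T τs))
      if hv : o.fst.toNat < N then
        let l ← L.qry ℓ ⟨o.fst.toNat, hv⟩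
        let a ← S.answer.run lam (.pair stS (.pair l.1 leaks))
        idealQueries L A S lam T m o.snd (.pair a.fst τs) l.2 (.pair l.1 leaks) a.snd
      else
        idealQueries L A S lam T m o.snd (.pair (.num 0) τs) ℓ leaks stS

/-- The ideal experiment. -/
noncomputable def ideal (L : Leakage) (A : CQAdversary) (S : CQSimulator) (lam : ℕ) :
    PMF Bool := do
  let o ← A.start.run lam (.num lam)
  let Γ := VGraph.ofData o.fst
  let l ← L.bld lam Γ
  let s ← S.start.run lam (.pair (.num lam) l.1)
  let T := s.fst
  let w ← L.idealQueries A S lam T (A.queries.eval lam) o.snd (.num 0) l.2 (.num 0) s.snd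
  let z ← A.guess.run lam (.pair w.1 (.pair T w.2))
  PMF.pure (decide (z.toNat = 1))

end Leakage

/-- Adaptive semantic `L`-security against chosen-query attacks (CQA2). -/
def SLPScheme.CQA2Secure (X : SLPScheme) (L : Leakage) : Prop :=
  ∀ A : CQAdversary, ∃ S : CQSimulator,
    Negligible fun lam => advantage (X.real A lam) (L.ideal A S lam)

/-- The leakage `(|T|, τ_v)`: the number of vertices, and for every query the trapdoor itself,
generated under a secret key which the leakage algorithm keeps as its state. -/
noncomputable def SLPScheme.trapdoorLeakage (X : SLPScheme) : Leakage where
  State _ := X.ProxyKey × X.ClientKey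
  bld lam Γ := (X.keyGen lam).map fun keys => (.num Γ.N, keys.2)
  qry sk v := (X.trapdoorGen v sk).map fun τ => (X.trapData τ, sk)

/-- The leakage `(|T|, name of v)`: the number of vertices, and for every query only a name of the
queried vertex that tells which queries coincide, namely the number of the first query of it
(counted from `0`).  The state is the list of earlier queries. -/
noncomputable def repetitionLeakage : Leakage where
  State N := List (Fin N)
  bld _ Γ := PMF.pure (.num Γ.N, [])
  qry past v := PMF.pure (.num (past.idxOf v), past ++ [v])

/-! ## The scheme SLP-I -/

namespace SLPI

variable {B : BilinearGenerator}

/-- Encrypted structures: rows of ciphertexts at the positions `0, …, N - 1`. -/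
abbrev Table (pk : BGN.PublicKey B) : Type :=
  (N : ℕ) × (Fin N → Fin N → (B.grp pk.d).G)

/-- Responses `(ĉ, m̂)`. -/
abbrev Response (pk : BGN.PublicKey B) : Type :=
  (N : ℕ) × ((Fin N → (B.grp pk.d).G₁) × (Fin N → (B.grp pk.d).G))

variable (B) in
/-- Key generation: `PK = pk` and `SK = (sk, k)`. -/
noncomputable def keyGen (lam : ℕ) : PMF (BGN.PublicKey B × (ℕ × ℕ × ℕ)) := do
  let k ← randBits lam
  let keys ← BGN.keyGen B lam
  PMF.pure (keys.1, (keys.2, (lam, k)))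

/-- Encryption of the adjacency matrix: the encrypted row of vertex `i` is stored at
position `F_k(i)`. -/
noncomputable def encMatrix (F : PermFamily) (Γ : VGraph) (sk : ℕ × ℕ × ℕ)
    (pk : BGN.PublicKey B) : PMF (Table pk) := do
  let m ← indep Γ.N fun i => indep Γ.N fun j => BGN.encrypt pk (Γ.entry i j)
  PMF.pure ⟨Γ.N, fun ind => m ((F sk.2.1 sk.2.2 Γ.N).symm ind)⟩

/-- Trapdoor `(i', s)` with `i' = F_k(v)` and a fresh seed `s`. -/
noncomputable def trapdoorGen (F : PermFamily) {N : ℕ} (v : Fin N) (sk : ℕ × ℕ × ℕ) :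
    PMF (ℕ × ℕ) := do
  let s ← randBits sk.2.1
  PMF.pure ((F sk.2.1 sk.2.2 N v : ℕ), s)

/-- The cloud server's algorithm: encrypted scores and the masked queried row, both
shuffled by `π_s`. -/
noncomputable def lpQuery (π : PermFamily) (τ : ℕ × ℕ) {pk : BGN.PublicKey B} (T : Table pk) :
    PMF (Response pk) := do
  let N := T.1
  let row : Fin N → (B.grp pk.d).G := fun k =>
    if hi : τ.1 < N then T.2 ⟨τ.1, hi⟩ k else 1
  let e := (B.grp pk.d).e
  let r ← indep N fun _ => randBits pk.lam
  let r' ← indep N fun _ => randBits pk.lam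
  let c : Fin N → (B.grp pk.d).G₁ := fun i =>
    if (i : ℕ) ≠ τ.1 then e pk.g pk.h ^ r i * ∏ k : Fin N, e (row k) (T.2 i k)
    else e pk.g pk.g ^ 0 * e pk.g pk.h ^ r i
  let m : Fin N → (B.grp pk.d).G := fun i => row i * pk.h ^ r' i
  let shuffle := π pk.lam τ.2 N
  PMF.pure ⟨N, (fun i => c (shuffle i), fun i => m (shuffle i))⟩

/-- The proxy server's algorithm: an index of maximal score among the non-neighbours. -/
noncomputable def findMaxVertex (pk : BGN.PublicKey B) (q₁ : ℕ) (x : Response pk) : Option ℕ :=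
  (((List.finRange x.1).filter fun i => BGN.decrypt pk q₁ (x.2.2 i) % 2 = 0).argmax
    fun i => BGN.decrypt₁ pk q₁ (x.2.1 i)).map Fin.val

/-- The structure as a datum: the public key, needed to compute on the structure, and the rows in
the order of their positions. -/
def tabData (pk : BGN.PublicKey B) (T : Table pk) : Data :=
  .pair pk.data (.ofList (List.ofFn fun i =>
    .ofList (List.ofFn fun j => (B.grp pk.d).repr (T.2 i j))))

end SLPI

/-- The scheme SLP-I built from BGN over `B` and the permutation families `F` and `π`. -/
noncomputable def slpI (B : BilinearGenerator) (F π : PermFamily) : SLPScheme where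
  PK := BGN.PublicKey B
  ProxyKey := ℕ
  ClientKey := ℕ × ℕ
  Tab := SLPI.Table
  Trap := ℕ × ℕ
  Resp := SLPI.Response
  keyGen := SLPI.keyGen B
  encMatrix := SLPI.encMatrix F
  trapdoorGen := SLPI.trapdoorGen F
  lpQuery := SLPI.lpQuery π
  findMaxVertex := SLPI.findMaxVertex
  tabData := SLPI.tabData
  trapData τ := .pair (.num τ.1) (.num τ.2)

/-! ## Probability mass functions -/

/-! The proof is a sequence of games. The BGN key serves only to encrypt the matrix, the PRP key `k`
only to place the rows and to answer queries; the two are independent, and the secret BGN key never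
enters the adversary's view. Whoever draws `k` can therefore play the whole game from `pk` and
ciphertexts alone.

In `hybrid` the first `e` cells of the matrix, read row by row, are replaced by encryptions of `0`.
A BGN adversary that guesses `e` uniformly below a polynomial `Q`, at least the number of cells, and
puts its challenge into cell `e`, plays hybrid `e` or hybrid `e + 1` according to the challenge bit
(`exists_reduction`). The differences telescope, so the real game and `zeroGame` differ by `Q` times
a BGN advantage (`negligible_hybrid_zeroGame`).

In `zeroGame` the structure depends on the graph only through `N`. If the trapdoors are leaked, a
simulator that encrypts zeros under a key of its own and passes the trapdoors on produces exactly
this game (`SLPI.exists_simulator`). If only repetitions are leaked, `F_k` is first replaced by a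
uniform permutation: a PRP distinguisher builds the table of zeros itself and asks its oracle for
the identifiers (`exists_distinguisher`). A uniform permutation can be sampled lazily, each new
vertex receiving a uniform free identifier (`extensionLaw_eq_bind`), and this needs no more than the
repetition pattern (`exists_repetition_simulator`). Both simulations are exact.

Adversaries are concrete programs with a step count, so every reduction has to be programmed. This
is done by closure properties of `Samples` and `Finds`, which assert one program and one polynomial
for a whole family of inputs. They rest on the fact that a run depends on its budget only through
exhaustion (`steady_run`), and on `timed`, which lets a reduction run the given adversary under the
adversary's own clock (`Samples.run`). -/

theorem PMF.bind_congr_support {α β : Type} (μ : PMF α) {f g : α → PMF β}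
    (h : ∀ a ∈ μ.support, f a = g a) : μ.bind f = μ.bind g := by
  ext b
  rw [PMF.bind_apply, PMF.bind_apply]
  refine tsum_congr fun a => ?_
  by_cases ha : a ∈ μ.support
  · rw [h a ha]
  · rw [(PMF.apply_eq_zero_iff _ _).2 ha, zero_mul, zero_mul]

theorem PMF.map_congr_support {α β : Type} (μ : PMF α) {f g : α → β}
    (h : ∀ a ∈ μ.support, f a = g a) : μ.map f = μ.map g :=
  μ.bind_congr_support fun a ha => by simp [h a ha]

theorem PMF.map_eq_pure {α β : Type} (μ : PMF α) {f : α → β} {b : β}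
    (h : ∀ a ∈ μ.support, f a = b) : μ.map f = PMF.pure b := by
  rw [μ.map_congr_support h]
  exact PMF.map_const _ _

theorem PMF.mem_support_map {α β : Type} {μ : PMF α} {f : α → β} {a : α} (h : a ∈ μ.support) :
    f a ∈ (μ.map f).support :=
  (PMF.mem_support_map_iff _ _ _).2 ⟨a, h, rfl⟩

/-! ## Running time of programs -/

theorem Data.size_pos (x : Data) : 1 ≤ x.size := by
  cases x <;> simp [Data.size]

theorem Data.fst_pair (a b : Data) : (Data.pair a b).fst = a := rfl

theorem Data.snd_pair (a b : Data) : (Data.pair a b).snd = b := rfl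

theorem Data.size_pair (a b : Data) : (Data.pair a b).size = a.size + b.size + 1 := rfl

theorem Data.size_num (n : ℕ) : (Data.num n).size = n.size + 1 := rfl

theorem Data.toNat_num (n : ℕ) : (Data.num n).toNat = n := rfl

namespace Prog

theorem mem_support_andThen {μ : PMF Outcome} {f : ℕ → Data → PMF Outcome} {y : Data} {r : ℕ} :
    some (y, r) ∈ (andThen μ f).support ↔
      ∃ z t, some (z, t) ∈ μ.support ∧ some (y, r) ∈ (f t z).support := by
  rw [andThen, PMF.mem_support_bind_iff]
  constructor
  · rintro ⟨_ | ⟨z, t⟩, h, h'⟩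
    · simp at h'
    · exact ⟨z, t, h, h'⟩
  · rintro ⟨z, t, h, h'⟩
    exact ⟨_, h, h'⟩

theorem mem_support_pay {c t : ℕ} {f : ℕ → PMF Outcome} {y : Data} {r : ℕ} :
    some (y, r) ∈ (pay c t f).support ↔ c ≤ t ∧ some (y, r) ∈ (f (t - c)).support := by
  unfold pay
  split_ifs with h <;> simp [h]

theorem andThen_congr {μ : PMF Outcome} {f g : ℕ → Data → PMF Outcome}
    (h : ∀ y t, some (y, t) ∈ μ.support → f t y = g t y) : andThen μ f = andThen μ g := by
  refine μ.bind_congr_support ?_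
  rintro (_ | ⟨y, t⟩) ho
  · rfl
  · exact h y t ho

theorem size_randBelow {n m : ℕ} (h : m ∈ (randBelow n).support) : m ≤ n := by
  cases n with
  | zero => simp [randBelow] at h; omega
  | succ n =>
    simp only [randBelow, PMF.mem_support_map_iff] at h
    obtain ⟨a, -, rfl⟩ := h
    omega

theorem lt_of_mem_randBelow {n m : ℕ} (hn : 0 < n) (h : m ∈ (randBelow n).support) : m < n := by
  cases n with
  | zero => omega
  | succ n =>
    simp only [randBelow, PMF.mem_support_map_iff] at h
    obtain ⟨a, -, rfl⟩ := h
    omega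

/-- A run pays for reading its input and for its result. -/
theorem size_run (P : Prog) : ∀ (t : ℕ) (x y : Data) (r : ℕ), some (y, r) ∈ (P.run t x).support →
    x.size + r ≤ t ∧ y.size + r ≤ t := by
  induction P with
  | op o =>
    intro t x y r h
    simp only [run, mem_support_pay, PMF.mem_support_pure_iff, Option.some.injEq,
      Prod.mk.injEq] at h
    obtain ⟨h, rfl, rfl⟩ := h
    omega
  | rand =>
    intro t x y r h
    simp only [run, mem_support_pay, PMF.mem_support_map_iff, Option.some.injEq,
      Prod.mk.injEq] at h
    obtain ⟨h, n, hn, rfl, rfl⟩ := h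
    have h1 := size_randBelow hn
    have h2 : Nat.size n ≤ Nat.size x.toNat := Nat.size_le_size h1
    have h3 : Nat.size x.toNat + 1 ≤ x.size := by
      cases x <;> simp [Data.size, Data.toNat]
    simp only [Data.size]
    omega
  | seq P Q hP hQ =>
    intro t x y r h
    simp only [run, mem_support_andThen] at h
    obtain ⟨z, t', h1, h2⟩ := h
    have := hP _ _ _ _ h1
    have := hQ _ _ _ _ h2
    omega
  | both P Q hP hQ =>
    intro t x y r h
    simp only [run, mem_support_andThen, mem_support_pay, PMF.mem_support_pure_iff,
      Option.some.injEq, Prod.mk.injEq] at h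
    obtain ⟨z, t', h1, z', t'', h2, h3, rfl, rfl⟩ := h
    have := hP _ _ _ _ h1
    have := hQ _ _ _ _ h2
    simp only [Data.size]
    omega
  | ite C P Q hC hP hQ =>
    intro t x y r h
    simp only [run, mem_support_andThen] at h
    obtain ⟨z, t', h1, h2⟩ := h
    have := hC _ _ _ _ h1
    split_ifs at h2
    · have := hQ _ _ _ _ h2
      omega
    · have := hP _ _ _ _ h2
      omega
  | loop C P hC hP =>
    have key : ∀ (k t : ℕ) (x y : Data) (r : ℕ),
        some (y, r) ∈ (rounds C.run P.run k t x).support → x.size + r ≤ t ∧ y.size + r ≤ t := by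
      intro k
      induction k with
      | zero => intro t x y r h; simp [rounds] at h
      | succ k ih =>
        intro t x y r h
        simp only [rounds, mem_support_andThen] at h
        obtain ⟨v, t₁, h1, h2⟩ := h
        have := hC _ _ _ _ h1
        split_ifs at h2
        · simp only [PMF.mem_support_pure_iff, Option.some.injEq, Prod.mk.injEq] at h2
          obtain ⟨rfl, rfl⟩ := h2
          omega
        · simp only [mem_support_andThen] at h2
          obtain ⟨z, t₂, h3, h4⟩ := h2
          have := hP _ _ _ _ h3
          have := ih _ _ _ _ h4
          omega
    intro t x y r h
    exact key _ _ _ _ _ h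
  | timed P hP =>
    intro t x y r h
    simp only [run, mem_support_pay, PMF.mem_support_map_iff] at h
    obtain ⟨h, o, ho, h'⟩ := h
    rcases o with _ | ⟨z, s⟩
    · simp only [Option.some.injEq, Prod.mk.injEq] at h'
      obtain ⟨rfl, rfl⟩ := h'
      simp [Data.size]
      omega
    · simp only [Option.some.injEq, Prod.mk.injEq] at h'
      obtain ⟨rfl, rfl⟩ := h'
      have h1 := hP _ _ _ _ ho
      have h2 := z.size_pos
      -- The result exceeds `z` by three in size: one is covered by the fixed charge, two by the
      -- input. If the input is a number, the timer is `0` and no run has a result.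
      have h3 : 2 ≤ x.size := by
        cases x with
        | num n => simp [Data.fst, Data.toNat] at h1; omega
        | pair a b =>
          have := a.size_pos
          simp [Data.size]
          omega
      simp [Data.size, Nat.size] at *
      omega

/-! ### Insensitivity of runs to surplus budget. -/

/-- Charge `s` more steps to an outcome. -/
def trunc (s : ℕ) : Outcome → Outcome
  | none => none
  | some (y, r) => if s ≤ r then some (y, r - s) else none

/-- A computation whose outcome depends on the budget only through its exhaustion. -/
structure Steady (f : ℕ → PMF Outcome) : Prop where
  le : ∀ t y r, some (y, r) ∈ (f t).support → r ≤ t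
  eq : ∀ t s, f t = (f (t + s)).map (trunc s)

theorem Steady.sample {α : Type} (ν : PMF α) (g : α → Data) :
    Steady fun t => ν.map fun a => some (g a, t) where
  le t y r h := by
    simp only [PMF.mem_support_map_iff, Option.some.injEq, Prod.mk.injEq] at h
    obtain ⟨a, -, -, rfl⟩ := h
    exact le_rfl
  eq t s := by
    rw [PMF.map_comp]
    congr 1
    funext a
    simp [trunc]

theorem Steady.pure (y : Data) : Steady fun t => PMF.pure (some (y, t)) := by
  have := Steady.sample (PMF.pure ()) fun _ => y
  simpa [PMF.pure_map] using this

theorem Steady.none : Steady fun _ => PMF.pure none where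
  le t y r h := by simp at h
  eq t s := by simp [PMF.pure_map, trunc]

theorem Steady.map_trunc {f : ℕ → PMF Outcome} (hf : Steady f) {r s : ℕ} (h : r < s) :
    (f r).map (trunc s) = PMF.pure Option.none := by
  refine PMF.map_eq_pure _ ?_
  rintro (_ | ⟨y, r'⟩) ho
  · rfl
  · have := hf.le _ _ _ ho
    simp [trunc]
    omega

theorem Steady.andThen {μ : ℕ → PMF Outcome} {f : ℕ → Data → PMF Outcome} (hμ : Steady μ)
    (hf : ∀ y, Steady fun t => f t y) : Steady fun t => andThen (μ t) f where
  le t y r h := by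
    obtain ⟨z, t', h1, h2⟩ := mem_support_andThen.1 h
    exact ((hf z).le _ _ _ h2).trans (hμ.le _ _ _ h1)
  eq t s := by
    simp only [Prog.andThen]
    rw [hμ.eq t s, PMF.bind_map, PMF.map_bind]
    congr 1
    funext o
    rcases o with _ | ⟨y, r⟩
    · simp [trunc, PMF.pure_map]
    · simp only [trunc, Function.comp]
      split_ifs with h
      · simpa [Nat.sub_add_cancel h] using (hf y).eq (r - s) s
      -- Here the first computation leaves fewer than `s` steps, so the extra charge ruins whatever
      -- follows.
      · exact ((hf y).map_trunc (not_le.1 h)).symm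

theorem Steady.pay {c : ℕ} {f : ℕ → PMF Outcome} (hf : Steady f) :
    Steady fun t => pay c t f where
  le t y r h := by
    have := hf.le _ _ _ (mem_support_pay.1 h).2
    omega
  eq t s := by
    simp only [Prog.pay]
    split_ifs with h h' h'
    · rw [hf.eq (t - c) s]
      congr 2
      omega
    · omega
    · exact (hf.map_trunc (by omega)).symm
    · simp [PMF.pure_map, trunc]

theorem Steady.rounds {c p : ℕ → Data → PMF Outcome} (hc : ∀ x, Steady fun t => c t x)
    (hp : ∀ x, Steady fun t => p t x) (k : ℕ) : ∀ x, Steady fun t => rounds c p k t x := by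
  induction k with
  | zero => exact fun x => Steady.none
  | succ k ih =>
    intro x
    refine (hc x).andThen fun v => ?_
    split_ifs
    · exact Steady.pure x
    · exact (hp x).andThen ih

/-- Each round strictly lowers the budget, since its test costs at least one step. With at most `k`
steps the budget is therefore exhausted before the bound on the rounds is felt. -/
theorem rounds_succ {c p : ℕ → Data → PMF Outcome}
    (hc : ∀ t x y r, some (y, r) ∈ (c t x).support → r < t)
    (hp : ∀ t x y r, some (y, r) ∈ (p t x).support → r ≤ t) (k : ℕ) :
    ∀ t x, t ≤ k → rounds c p k t x = rounds c p (k + 1) t x := by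
  induction k with
  | zero =>
    intro t x ht
    obtain rfl : t = 0 := by omega
    symm
    refine (PMF.bind_congr_support _ (g := fun _ => PMF.pure none) ?_).trans (PMF.bind_const _ _)
    rintro (_ | ⟨y, r⟩) ho
    · rfl
    · exact absurd (hc _ _ _ _ ho) (by omega)
  | succ k ih =>
    intro t x ht
    rw [rounds, rounds]
    refine andThen_congr fun v t₁ h₁ => ?_
    split_ifs
    · rfl
    · refine andThen_congr fun y t₂ h₂ => ih _ _ ?_
      have := hc _ _ _ _ h₁
      have := hp _ _ _ _ h₂
      omega

theorem rounds_of_le {c p : ℕ → Data → PMF Outcome}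
    (hc : ∀ t x y r, some (y, r) ∈ (c t x).support → r < t)
    (hp : ∀ t x y r, some (y, r) ∈ (p t x).support → r ≤ t) {t k : ℕ} (h : t ≤ k) (x : Data) :
    rounds c p t t x = rounds c p k t x := by
  induction k, h using Nat.le_induction with
  | base => rfl
  | succ k hk ih => rw [ih, rounds_succ hc hp k t x hk]

theorem run_lt {P : Prog} {t : ℕ} {x y : Data} {r : ℕ} (h : some (y, r) ∈ (P.run t x).support) :
    r < t := by
  have := size_run P _ _ _ _ h
  have := x.size_pos
  omega

/-- What a caller sees of a timed run. -/
def timedResult : Outcome → Data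
  | none => .num 0
  | some (z, _) => .pair (.num 1) z

theorem run_timed (P : Prog) (t : ℕ) (x : Data) :
    (timed P).run t x = pay (1 + x.size + x.fst.toNat) t fun t' =>
      (P.run x.fst.toNat x.snd).map fun o => some (timedResult o, t') := by
  rw [run]
  congr 1
  funext t'
  congr 1
  funext o
  rcases o with _ | ⟨z, s⟩ <;> rfl

/-- By induction on the program. Only two constructs are delicate: a loop, whose bound on the rounds
changes with the budget, and `timed`, whose inner run sees the timer in the input instead of the
outer budget. -/
theorem steady_run (P : Prog) : ∀ x, Steady fun t => P.run t x := by
  induction P with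
  | op o => exact fun x => (Steady.pure _).pay
  | rand => exact fun x => (Steady.sample _ _).pay
  | seq P Q hP hQ => exact fun x => (hP x).andThen hQ
  | both P Q hP hQ =>
    exact fun x => (hP x).andThen fun y => (hQ x).andThen fun z => (Steady.pure _).pay
  | ite C P Q hC hP hQ =>
    intro x
    refine (hC x).andThen fun v => ?_
    split_ifs
    · exact hQ x
    · exact hP x
  | loop C P hC hP =>
    refine fun x => ⟨fun t y r h => ?_, fun t s => ?_⟩
    · exact (Steady.rounds hC hP t x).le _ _ _ h
    -- The two loops have round bounds `t` and `t + s`; the larger one may be used for both.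
    · have h := (Steady.rounds hC hP (t + s) x).eq t s
      rw [← rounds_of_le (fun _ _ _ _ h => run_lt h) (fun _ _ _ _ h => (run_lt h).le)
        (Nat.le_add_right t s)] at h
      exact h
  | timed P hP =>
    intro x
    simp only [run_timed]
    exact (Steady.sample _ _).pay

/-! ### Composition rules for halting programs. -/

/-- Outcome of a computation that started with budget `t`, spends at most `c` steps, and has a
result of law `μ`. -/
structure Yields (ρ : PMF Outcome) (t c : ℕ) (μ : PMF Data) : Prop where
  law : ρ.map (Option.map Prod.fst) = μ.map some
  left : ∀ y r, some (y, r) ∈ ρ.support → t ≤ r + c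

/-- On input `x` the program halts within `c` steps, with a result of law `μ`. -/
def Halts (P : Prog) (x : Data) (c : ℕ) (μ : PMF Data) : Prop :=
  ∀ t, c ≤ t → Yields (P.run t x) t c μ

theorem Yields.mem_support {ρ : PMF Outcome} {t c : ℕ} {μ : PMF Data} (h : Yields ρ t c μ)
    {o : Outcome} (ho : o ∈ ρ.support) : ∃ y r, o = some (y, r) ∧ y ∈ μ.support := by
  have h1 := PMF.mem_support_map (f := Option.map Prod.fst) ho
  rw [h.law, PMF.mem_support_map_iff] at h1
  obtain ⟨y, hy, h2⟩ := h1
  rcases o with _ | ⟨z, r⟩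
  · simp at h2
  · simp only [Option.map_some, Option.some.injEq] at h2
    exact ⟨z, r, rfl, h2 ▸ hy⟩

theorem Yields.exists_mem_support {ρ : PMF Outcome} {t c : ℕ} {μ : PMF Data} (h : Yields ρ t c μ)
    {y : Data} (hy : y ∈ μ.support) : ∃ r, some (y, r) ∈ ρ.support := by
  have h1 := PMF.mem_support_map (f := some) hy
  rw [← h.law, PMF.mem_support_map_iff] at h1
  obtain ⟨_ | ⟨z, r⟩, ho, h2⟩ := h1
  · simp at h2
  · simp only [Option.map_some, Option.some.injEq] at h2
    exact ⟨r, h2 ▸ ho⟩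

theorem Yields.mono {ρ : PMF Outcome} {t c c' : ℕ} {μ : PMF Data} (h : Yields ρ t c μ)
    (hc : c ≤ c') : Yields ρ t c' μ :=
  ⟨h.law, fun y r hr => (h.left y r hr).trans (by omega)⟩

theorem Yields.andThen {ρ : PMF Outcome} {t c c' : ℕ} {μ : PMF Data} {f : ℕ → Data → PMF Outcome}
    {κ : Data → PMF Data} (h : Yields ρ t c μ)
    (hf : ∀ y ∈ μ.support, ∀ r, t ≤ r + c → Yields (f r y) r c' (κ y)) :
    Yields (andThen ρ f) t (c + c') (μ.bind κ) where
  law := by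
    let G : Option Data → PMF (Option Data) := fun o => match o with
      | none => PMF.pure none
      | some y => (κ y).map some
    have h1 : (Prog.andThen ρ f).map (Option.map Prod.fst) =
        ρ.bind fun o => G (Option.map Prod.fst o) := by
      rw [Prog.andThen, PMF.map_bind]
      refine PMF.bind_congr_support _ fun o ho => ?_
      obtain ⟨y, r, rfl, hy⟩ := h.mem_support ho
      exact (hf y hy r (h.left _ _ ho)).law
    have h2 : (ρ.bind fun o => G (Option.map Prod.fst o)) =
        (ρ.map (Option.map Prod.fst)).bind G := by
      rw [PMF.bind_map]; rfl
    rw [h1, h2, h.law, PMF.bind_map, PMF.map_bind]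
    rfl
  left y r hr := by
    obtain ⟨z, t', h1, h2⟩ := mem_support_andThen.1 hr
    obtain ⟨z', r', h3, hz⟩ := h.mem_support h1
    simp only [Option.some.injEq, Prod.mk.injEq] at h3
    obtain ⟨rfl, rfl⟩ := h3
    have := h.left _ _ h1
    have := (hf z hz t' this).left _ _ h2
    omega

theorem Yields.unique {ρ : PMF Outcome} {t c c' : ℕ} {μ μ' : PMF Data} (h : Yields ρ t c μ)
    (h' : Yields ρ t c' μ') : μ = μ' := by
  have := congrArg (PMF.map (fun o : Option Data => o.getD (.num 0))) (h.law.symm.trans h'.law)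
  rw [PMF.map_comp, PMF.map_comp] at this
  simpa only [Function.comp_def, Option.getD_some, ← Function.id_def, PMF.map_id] using this

/-- The law of the continuation may depend on a hidden sample `ω`, such as a key pair of which only
the public part is output. Samples with the same encoding start the same computation, so by
`Yields.unique` they have the same `κ`, and any choice among them will do. -/
theorem Yields.andThen_map {Ω : Type} {ρ : PMF Outcome} {t c c' : ℕ} {ν : PMF Ω} {out : Ω → Data}
    {f : ℕ → Data → PMF Outcome} {κ : Ω → PMF Data} (h : Yields ρ t c (ν.map out))
    (hf : ∀ ω ∈ ν.support, ∀ r, t ≤ r + c → Yields (f r (out ω)) r c' (κ ω)) :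
    Yields (Prog.andThen ρ f) t (c + c') (ν.bind κ) := by
  classical
  let κ' : Data → PMF Data := fun d =>
    if h : ∃ ω ∈ ν.support, out ω = d then κ h.choose else PMF.pure d
  have hκ : ∀ ω ∈ ν.support, κ' (out ω) = κ ω := by
    intro ω hω
    have hex : ∃ ω' ∈ ν.support, out ω' = out ω := ⟨ω, hω, rfl⟩
    have h1 := hf hex.choose hex.choose_spec.1 t (by omega)
    rw [hex.choose_spec.2] at h1
    exact (dif_pos hex).trans (h1.unique (hf ω hω t (by omega)))
  have h1 := h.andThen (κ := κ') (c' := c') (f := f) (by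
    intro y hy r hr
    obtain ⟨ω, hω, rfl⟩ := (PMF.mem_support_map_iff _ _ _).1 hy
    rw [hκ ω hω]
    exact hf ω hω r hr)
  rw [PMF.bind_map] at h1
  rwa [ν.bind_congr_support (f := κ' ∘ out) (g := κ) hκ] at h1

theorem Yields.pay {f : ℕ → PMF Outcome} {t c c' : ℕ} {μ : PMF Data} (hc : c + c' ≤ t)
    (h : Yields (f (t - c)) (t - c) c' μ) : Yields (pay c t f) t (c + c') μ where
  law := by rw [Prog.pay, if_pos (by omega)]; exact h.law
  left y r hr := by
    have := h.left y r (mem_support_pay.1 hr).2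
    omega

theorem Yields.sample {α : Type} (ν : PMF α) (g : α → Data) (t : ℕ) :
    Yields (ν.map fun a => some (g a, t)) t 0 (ν.map g) where
  law := by rw [PMF.map_comp, PMF.map_comp]; rfl
  left y r hr := by
    simp only [PMF.mem_support_map_iff, Option.some.injEq, Prod.mk.injEq] at hr
    obtain ⟨a, -, -, rfl⟩ := hr
    exact le_rfl

theorem Yields.pure (y : Data) (t : ℕ) : Yields (PMF.pure (some (y, t))) t 0 (PMF.pure y) := by
  simpa [PMF.pure_map] using Yields.sample (PMF.pure ()) (fun _ => y) t

theorem Halts.mono {P : Prog} {x : Data} {c c' : ℕ} {μ : PMF Data} (h : P.Halts x c μ)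
    (hc : c ≤ c') : P.Halts x c' μ :=
  fun t ht => (h t (hc.trans ht)).mono hc

theorem Halts.size_le {P : Prog} {x : Data} {c : ℕ} {μ : PMF Data} (h : P.Halts x c μ) :
    x.size ≤ c := by
  obtain ⟨y, hy⟩ := μ.support_nonempty
  obtain ⟨r, hr⟩ := (h c le_rfl).exists_mem_support hy
  have := size_run P _ _ _ _ hr
  omega

theorem Halts.size_result_le {P : Prog} {x : Data} {c : ℕ} {μ : PMF Data} (h : P.Halts x c μ)
    {y : Data} (hy : y ∈ μ.support) : y.size ≤ c := by
  obtain ⟨r, hr⟩ := (h c le_rfl).exists_mem_support hy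
  have := size_run P _ _ _ _ hr
  omega

theorem Halts.computes {P : Prog} {x : Data} {c : ℕ} {μ : PMF Data} (h : P.Halts x c μ) :
    P.Computes c x μ :=
  (h c le_rfl).law

/-- `Computes` speaks of the budget `c` only. By `steady_run` the run with budget `c` is the run
with budget `c + s` charged `s` more; as the former never fails, every outcome of the latter leaves
at least `s` steps. -/
theorem Computes.halts {P : Prog} {x : Data} {c : ℕ} {μ : PMF Data} (h : P.Computes c x μ) :
    P.Halts x c μ := by
  intro t ht
  obtain ⟨s, rfl⟩ := Nat.exists_eq_add_of_le ht
  have key : ∀ o ∈ (P.run (c + s) x).support, ∃ y r, o = some (y, r) ∧ s ≤ r := by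
    intro o ho
    have h1 := PMF.mem_support_map (f := Option.map Prod.fst)
      (PMF.mem_support_map (f := trunc s) ho)
    rw [← (steady_run P x).eq c s, show _ = _ from h, PMF.mem_support_map_iff] at h1
    obtain ⟨y, -, h2⟩ := h1
    rcases o with _ | ⟨z, r⟩
    · simp [trunc] at h2
    · refine ⟨z, r, rfl, ?_⟩
      by_contra hs
      simp [trunc, hs] at h2
  refine ⟨?_, fun y r hr => ?_⟩
  · rw [← show _ = _ from h, (steady_run P x).eq c s, PMF.map_comp]
    refine PMF.map_congr_support _ fun o ho => ?_
    obtain ⟨y, r, rfl, hs⟩ := key o ho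
    simp [trunc, hs]
  · obtain ⟨y', r', h1, h2⟩ := key _ hr
    simp only [Option.some.injEq, Prod.mk.injEq] at h1
    omega

theorem Halts.op (o : Op) (x : Data) :
    (Prog.op o).Halts x (1 + x.size + (o.eval x).size) (PMF.pure (o.eval x)) :=
  fun _ ht => Yields.pay (c' := 0) ht (Yields.pure _ _)

theorem Halts.rand (x : Data) :
    Prog.rand.Halts x (1 + 2 * x.size) ((randBelow x.toNat).map Data.num) :=
  fun _ ht => Yields.pay (c' := 0) ht (Yields.sample _ _ _)

theorem Halts.seq_map {Ω : Type} {P Q : Prog} {x : Data} {c c' : ℕ} {ν : PMF Ω} {out : Ω → Data}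
    {κ : Ω → PMF Data} (hP : P.Halts x c (ν.map out))
    (hQ : ∀ ω ∈ ν.support, Q.Halts (out ω) c' (κ ω)) :
    (Prog.seq P Q).Halts x (c + c') (ν.bind κ) :=
  fun t ht => (hP t (by omega)).andThen_map fun ω hω r hr => hQ ω hω r (by omega)

theorem Halts.both {P Q : Prog} {x : Data} {c c' : ℕ} {μ ν : PMF Data}
    (hP : P.Halts x c μ) (hQ : Q.Halts x c' ν) :
    (Prog.both P Q).Halts x (c + (c' + 1)) (μ.bind fun y => ν.map (Data.pair y)) := by
  intro t ht
  refine (hP t (by omega)).andThen fun y hy r hr => ?_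
  exact (hQ r (by omega)).andThen fun z hz r' hr' =>
    Yields.pay (c := 1) (c' := 0) (by omega) (Yields.pure _ _)

theorem Halts.ite {C P Q : Prog} {x : Data} {c c' : ℕ} {v : Data} {μ : PMF Data}
    (hC : C.Halts x c (PMF.pure v)) (hP : v.toNat ≠ 0 → P.Halts x c' μ)
    (hQ : v.toNat = 0 → Q.Halts x c' μ) :
    (Prog.ite C P Q).Halts x (c + c') μ := by
  intro t ht
  have := (hC t (by omega)).andThen (c' := c') (κ := fun _ => μ)
    (f := fun t' v => if v.toNat = 0 then Q.run t' x else P.run t' x) (by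
      intro y hy r hr
      simp only [PMF.mem_support_pure_iff] at hy
      subst hy
      split_ifs with h
      · exact hQ h r (by omega)
      · exact hP h r (by omega))
  rwa [PMF.pure_bind] at this

theorem Halts.timed (P : Prog) (s : ℕ) (x : Data) :
    (Prog.timed P).Halts (.pair (.num s) x) (1 + (Data.pair (.num s) x).size + s)
      ((P.run s x).map timedResult) := by
  intro t ht
  rw [run_timed]
  exact Yields.pay (c' := 0) ht (Yields.sample _ _ _)

end Prog

/-- Law of `n` rounds of a process, the rounds being counted down. -/
noncomputable def countdown {Ω : Type} (κ : ℕ → Ω → PMF Ω) : ℕ → Ω → PMF Ω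
  | 0, ω => PMF.pure ω
  | k + 1, ω => (κ k ω).bind (countdown κ k)

namespace Prog

/-- The test returns the counter held in the state, so the loop stops exactly when the counter is
`0`. There are `k` full rounds; the additional `a + b` covers the last test. -/
theorem yields_rounds {C P : Prog} {Ω : Type} {κ : ℕ → Ω → PMF Ω} {enc : ℕ → Ω → Data}
    {Inv : ℕ → Ω → Prop} {a b n : ℕ}
    (hC : ∀ k ω, k ≤ n → Inv k ω → C.Halts (enc k ω) a (PMF.pure (.num k)))
    (hP : ∀ k ω, k < n → Inv (k + 1) ω → P.Halts (enc (k + 1) ω) b ((κ k ω).map (enc k)))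
    (hI : ∀ k ω, k < n → Inv (k + 1) ω → ∀ ω' ∈ (κ k ω).support, Inv k ω') (k : ℕ) :
    ∀ (K t : ℕ) (ω : Ω), k ≤ n → Inv k ω → k < K → (k + 1) * (a + b) ≤ t →
      Yields (rounds C.run P.run K t (enc k ω)) t ((k + 1) * (a + b))
        ((countdown κ k ω).map (enc 0)) := by
  induction k with
  | zero =>
    intro K t ω hk hω hK ht
    obtain ⟨K, rfl⟩ : ∃ K', K = K' + 1 := ⟨K - 1, by omega⟩
    have := (hC 0 ω hk hω t (by omega)).andThen (c' := 0) (κ := fun _ => PMF.pure (enc 0 ω))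
      (f := fun t₁ v => if v.toNat = 0 then PMF.pure (some (enc 0 ω, t₁))
        else Prog.andThen (P.run t₁ (enc 0 ω)) fun t₂ y => rounds C.run P.run K t₂ y) (by
        intro y hy r hr
        simp only [PMF.mem_support_pure_iff] at hy
        subst hy
        exact Yields.pure _ _)
    rw [PMF.pure_bind] at this
    rw [countdown, PMF.pure_map]
    exact this.mono (by omega)
  | succ k ih =>
    intro K t ω hk hω hK ht
    obtain ⟨K, rfl⟩ : ∃ K', K = K' + 1 := ⟨K - 1, by omega⟩
    have hmul : (k + 1 + 1) * (a + b) = (k + 1) * (a + b) + (a + b) := by ring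
    have := (hC (k + 1) ω hk hω t (by omega)).andThen (c' := b + (k + 1) * (a + b))
      (κ := fun _ => (countdown κ (k + 1) ω).map (enc 0))
      (f := fun t₁ v => if v.toNat = 0 then PMF.pure (some (enc (k + 1) ω, t₁))
        else Prog.andThen (P.run t₁ (enc (k + 1) ω)) fun t₂ y => rounds C.run P.run K t₂ y) (by
        intro y hy r hr
        simp only [PMF.mem_support_pure_iff] at hy
        subst hy
        simp only [Data.toNat, Nat.add_eq_zero_iff, one_ne_zero, and_false, if_false]
        have hp := hP k ω (by omega) hω r (by omega)
        have h3 := hp.andThen_map (κ := fun ω' => (countdown κ k ω').map (enc 0))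
          (c' := (k + 1) * (a + b)) (f := fun t₂ y => rounds C.run P.run K t₂ y)
          fun ω' hω' r' hr' =>
            ih K r' ω' (by omega) (hI k ω (by omega) hω ω' hω') (by omega) (by omega)
        rwa [← PMF.map_bind] at h3)
    rw [PMF.pure_bind] at this
    exact this.mono (by rw [hmul]; omega)

end Prog

theorem Polynomial.eval_mono_nat (p : Polynomial ℕ) {a b : ℕ} (h : a ≤ b) :
    p.eval a ≤ p.eval b := by
  rw [Polynomial.eval_eq_sum, Polynomial.eval_eq_sum]
  exact Finset.sum_le_sum fun i _ => Nat.mul_le_mul_left _ (Nat.pow_le_pow_left h i)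

/-! ## Polynomial bounds and families of tasks -/

/-- A family of numbers is bounded by a polynomial in the security parameter. -/
def PolyBounded {I : Type} (lam f : I → ℕ) : Prop :=
  ∃ p : Polynomial ℕ, ∀ i, f i ≤ p.eval (lam i)

namespace PolyBounded

variable {I J : Type} {lam f g : I → ℕ}

theorem mono (hg : PolyBounded lam g) (h : ∀ i, f i ≤ g i) : PolyBounded lam f :=
  let ⟨p, hp⟩ := hg
  ⟨p, fun i => (h i).trans (hp i)⟩

theorem const (c : ℕ) : PolyBounded lam fun _ => c :=
  ⟨.C c, fun i => by simp⟩

theorem self : PolyBounded lam lam :=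
  ⟨.X, fun i => by simp⟩

theorem eval (p : Polynomial ℕ) : PolyBounded lam fun i => p.eval (lam i) :=
  ⟨p, fun _ => le_rfl⟩

theorem add (hf : PolyBounded lam f) (hg : PolyBounded lam g) :
    PolyBounded lam fun i => f i + g i :=
  let ⟨p, hp⟩ := hf
  let ⟨q, hq⟩ := hg
  ⟨p + q, fun i => by simpa using Nat.add_le_add (hp i) (hq i)⟩

theorem comp (hf : PolyBounded lam f) (i : J → I) :
    PolyBounded (fun j => lam (i j)) fun j => f (i j) :=
  let ⟨p, hp⟩ := hf
  ⟨p, fun j => hp (i j)⟩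

end PolyBounded

/-- The laws `μ i` can be sampled by one program on the inputs `inp i`, in time polynomial in
`lam i`. -/
def Samples {I : Type} (lam : I → ℕ) (inp : I → Data) (μ : I → PMF Data) : Prop :=
  ∃ (P : Prog) (p : Polynomial ℕ), ∀ i, P.Halts (inp i) (p.eval (lam i)) (μ i)

/-- The values `f i` can be computed by one program from the inputs `inp i`, in time polynomial in
`lam i`. -/
abbrev Finds {I : Type} (lam : I → ℕ) (inp : I → Data) (f : I → Data) : Prop :=
  Samples lam inp fun i => PMF.pure (f i)

/-- `inp'`, as an input for the reindexed family, is as good as `inp`. -/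
def Refines {I J : Type} (lam : I → ℕ) (inp : I → Data) (i : J → I) (inp' : J → Data) : Prop :=
  ∀ μ : I → PMF Data, Samples lam inp μ → Samples (fun j => lam (i j)) inp' fun j => μ (i j)

section

variable {I J : Type} {lam : I → ℕ} {inp : I → Data}

theorem Samples.comp {μ : I → PMF Data} (h : Samples lam inp μ) (i : J → I) :
    Samples (fun j => lam (i j)) (fun j => inp (i j)) fun j => μ (i j) :=
  let ⟨P, p, hP⟩ := h
  ⟨P, p, fun j => hP (i j)⟩

theorem Refines.comp (i : J → I) : Refines lam inp i fun j => inp (i j) :=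
  fun _ h => h.comp i

theorem Refines.finds {i : J → I} {inp' : J → Data} (h : Refines lam inp i inp') {f : I → Data}
    (hf : Finds lam inp f) : Finds (fun j => lam (i j)) inp' fun j => f (i j) :=
  h _ hf

theorem Samples.congr {μ ν : I → PMF Data} (h : Samples lam inp μ) (e : ∀ i, ν i = μ i) :
    Samples lam inp ν := by
  obtain rfl : ν = μ := funext e
  exact h

theorem Finds.congr {f g : I → Data} (h : Finds lam inp f) (e : ∀ i, g i = f i) :
    Finds lam inp g :=
  Samples.congr h fun i => by rw [e]

theorem Samples.polyBounded_input {μ : I → PMF Data} (h : Samples lam inp μ) :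
    PolyBounded lam fun i => (inp i).size :=
  let ⟨_, p, hP⟩ := h
  ⟨p, fun i => (hP i).size_le⟩

theorem Samples.exists_size_le {μ : I → PMF Data} (h : Samples lam inp μ) :
    ∃ p : Polynomial ℕ, ∀ i, ∀ y ∈ (μ i).support, y.size ≤ p.eval (lam i) :=
  let ⟨_, p, hP⟩ := h
  ⟨p, fun i _ hy => (hP i).size_result_le hy⟩

theorem Finds.polyBounded {f : I → Data} (h : Finds lam inp f) :
    PolyBounded lam fun i => (f i).size :=
  let ⟨p, hp⟩ := Samples.exists_size_le h
  ⟨p, fun i => hp i _ (by simp)⟩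

/-- The second program must be chosen once for all inputs and all intermediate samples. Quantifying
over reindexed families achieves this: the hypothesis is used for the family of all pairs of an
index and a sample in its support. -/
theorem Samples.seq {Ω : I → Type} {ν : ∀ i, PMF (Ω i)} {out : ∀ i, Ω i → Data}
    {κ : ∀ i, Ω i → PMF Data} (h : Samples lam inp fun i => (ν i).map (out i))
    (hκ : ∀ (J : Type) (i : J → I) (ω : ∀ j, Ω (i j)), (∀ j, ω j ∈ (ν (i j)).support) →
      Samples (fun j => lam (i j)) (fun j => out (i j) (ω j)) fun j => κ (i j) (ω j)) :
    Samples lam inp fun i => (ν i).bind (κ i) := by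
  obtain ⟨P, p, hP⟩ := h
  obtain ⟨Q, q, hQ⟩ := hκ {j : Sigma Ω // j.2 ∈ (ν j.1).support} (fun j => j.1.1)
    (fun j => j.1.2) fun j => j.2
  refine ⟨.seq P Q, p + q, fun i => ?_⟩
  rw [Polynomial.eval_add]
  exact (hP i).seq_map fun ω hω => hQ ⟨⟨i, ω⟩, hω⟩

theorem Finds.seq {f : I → Data} {μ : I → PMF Data} (h : Finds lam inp f)
    (hμ : Samples lam f μ) : Samples lam inp μ := by
  have := Samples.seq (Ω := fun _ => Unit) (ν := fun _ => PMF.pure ()) (out := fun i _ => f i)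
    (κ := fun i _ => μ i) (lam := lam) (inp := inp) (by simpa only [PMF.pure_map] using h)
    fun J i _ _ => hμ.comp i
  simpa only [PMF.pure_bind] using this

theorem Finds.op {f : I → Data} (h : Finds lam inp f) (o : Op) (c : ℕ)
    (hc : ∀ i, (o.eval (f i)).size ≤ 2 * (f i).size + c) :
    Finds lam inp fun i => o.eval (f i) := by
  refine h.seq ?_
  obtain ⟨p, hp⟩ := h.polyBounded
  refine ⟨.op o, .C (1 + c) + .C 3 * p, fun i => (Prog.Halts.op o (f i)).mono ?_⟩
  have h1 : (f i).size ≤ _ := hp i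
  have := hc i
  simp
  omega

theorem Finds.id (h : PolyBounded lam fun i => (inp i).size) : Finds lam inp inp := by
  obtain ⟨p, hp⟩ := h
  refine ⟨.op .skip, .C 1 + .C 2 * p, fun i => (Prog.Halts.op .skip (inp i)).mono ?_⟩
  have h1 : (inp i).size ≤ _ := hp i
  simp [Op.eval]
  omega

theorem Samples.input {μ : I → PMF Data} (h : Samples lam inp μ) : Finds lam inp inp :=
  Finds.id h.polyBounded_input

theorem Samples.pair {ν : I → PMF Data} {f : I → Data} (hf : Finds lam inp f)
    (h : Samples lam inp ν) : Samples lam inp fun i => (ν i).map (Data.pair (f i)) := by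
  obtain ⟨P, p, hP⟩ := hf
  obtain ⟨Q, q, hQ⟩ := h
  refine ⟨.both P Q, p + (q + .C 1), fun i => ?_⟩
  simpa using (hP i).both (hQ i)

theorem Finds.pair {f g : I → Data} (hf : Finds lam inp f) (hg : Finds lam inp g) :
    Finds lam inp fun i => .pair (f i) (g i) := by
  simpa only [PMF.pure_map] using Samples.pair hf hg

theorem Data.size_fst_le (x : Data) : x.fst.size ≤ x.size := by
  cases x <;> simp [Data.fst, Data.size]; omega

theorem Data.size_snd_le (x : Data) : x.snd.size ≤ x.size := by
  cases x <;> simp [Data.snd, Data.size]; omega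

theorem Finds.fst {f : I → Data} (h : Finds lam inp f) : Finds lam inp fun i => (f i).fst :=
  h.op .fst 0 fun i => by have := (f i).size_fst_le; simp only [Op.eval]; omega

theorem Finds.snd {f : I → Data} (h : Finds lam inp f) : Finds lam inp fun i => (f i).snd :=
  h.op .snd 0 fun i => by have := (f i).size_snd_le; simp only [Op.eval]; omega

theorem Samples.const {μ : I → PMF Data} (h : Samples lam inp μ) (n : ℕ) :
    Finds lam inp fun _ => .num n :=
  h.input.op (.const n) (n.size + 1) fun i => by simp [Op.eval, Data.size]

theorem Nat.size_add_le (a b : ℕ) : (a + b).size ≤ a.size + b.size + 1 := by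
  rw [Nat.size_le]
  have ha := a.lt_size_self
  have hb := b.lt_size_self
  have h1 : 2 ^ a.size ≤ 2 ^ (a.size + b.size) := Nat.pow_le_pow_right (by norm_num) (by omega)
  have h2 : 2 ^ b.size ≤ 2 ^ (a.size + b.size) := Nat.pow_le_pow_right (by norm_num) (by omega)
  rw [pow_succ]
  omega

theorem Nat.size_mul_le (a b : ℕ) : (a * b).size ≤ a.size + b.size := by
  rw [Nat.size_le, pow_add]
  exact Nat.mul_lt_mul'' a.lt_size_self b.lt_size_self

theorem Finds.add {a b : I → ℕ} (ha : Finds lam inp fun i => .num (a i))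
    (hb : Finds lam inp fun i => .num (b i)) : Finds lam inp fun i => .num (a i + b i) :=
  (ha.pair hb).op .add 0 fun i => by
    have := Nat.size_add_le (a i) (b i)
    simp only [Op.eval, Data.fst, Data.snd, Data.toNat, Data.size]
    omega

theorem Finds.mul {a b : I → ℕ} (ha : Finds lam inp fun i => .num (a i))
    (hb : Finds lam inp fun i => .num (b i)) : Finds lam inp fun i => .num (a i * b i) :=
  (ha.pair hb).op .mul 0 fun i => by
    have := Nat.size_mul_le (a i) (b i)
    simp only [Op.eval, Data.fst, Data.snd, Data.toNat, Data.size]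
    omega

theorem Finds.sub {a b : I → ℕ} (ha : Finds lam inp fun i => .num (a i))
    (hb : Finds lam inp fun i => .num (b i)) : Finds lam inp fun i => .num (a i - b i) :=
  (ha.pair hb).op .sub 0 fun i => by
    have := Nat.size_le_size (Nat.sub_le (a i) (b i))
    simp only [Op.eval, Data.fst, Data.snd, Data.toNat, Data.size]
    omega

theorem Finds.div {a b : I → ℕ} (ha : Finds lam inp fun i => .num (a i))
    (hb : Finds lam inp fun i => .num (b i)) : Finds lam inp fun i => .num (a i / b i) :=
  (ha.pair hb).op .div 0 fun i => by
    have := Nat.size_le_size (Nat.div_le_self (a i) (b i))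
    simp only [Op.eval, Data.fst, Data.snd, Data.toNat, Data.size]
    omega

theorem Finds.mod {a b : I → ℕ} (ha : Finds lam inp fun i => .num (a i))
    (hb : Finds lam inp fun i => .num (b i)) : Finds lam inp fun i => .num (a i % b i) :=
  (ha.pair hb).op .mod 0 fun i => by
    have := Nat.size_le_size (Nat.mod_le (a i) (b i))
    simp only [Op.eval, Data.fst, Data.snd, Data.toNat, Data.size]
    omega

theorem Data.size_num_toNat (b : Bool) : (Data.num b.toNat).size ≤ 2 := by
  cases b <;> simp [Data.size]

theorem Finds.lt {a b : I → ℕ} (ha : Finds lam inp fun i => .num (a i))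
    (hb : Finds lam inp fun i => .num (b i)) :
    Finds lam inp fun i => .num (decide (a i < b i)).toNat :=
  (ha.pair hb).op .lt 2 fun i => by
    have := Data.size_num_toNat (decide (a i < b i))
    change (Data.num (decide (a i < b i)).toNat).size ≤ _
    omega

theorem Finds.eq {a b : I → ℕ} (ha : Finds lam inp fun i => .num (a i))
    (hb : Finds lam inp fun i => .num (b i)) :
    Finds lam inp fun i => .num (decide (a i = b i)).toNat :=
  -- Equality is expressed as `1 - [a < b] - [b < a]`.
  (((ha.const 1).sub (ha.lt hb)).sub (hb.lt ha)).congr fun i => by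
    rcases lt_trichotomy (a i) (b i) with h | h | h
    · simp [h, h.ne]
    · simp [h]
    · simp [h, h.ne', h.not_gt]

theorem Finds.isPair {f : I → Data} (h : Finds lam inp f) :
    Finds lam inp fun i => .num (f i).isPair.toNat :=
  h.op .isPair 2 fun i => by
    have := Data.size_num_toNat (f i).isPair
    simp only [Op.eval]
    omega

/-- The number read from a datum. -/
theorem Finds.toNat {f : I → Data} (h : Finds lam inp f) :
    Finds lam inp fun i => .num (f i).toNat :=
  -- Addition reads a pair as `0`, so adding `0` performs the conversion to a number.
  ((h.pair (h.const 0)).op .add 0 fun i => by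
    have h1 : (f i).toNat.size ≤ (f i).size := by
      cases f i <;> simp [Data.toNat, Data.size]
    have := (f i).size_pos
    change (f i).toNat.size + 1 ≤ 2 * ((f i).size + (0 : ℕ).size + 1 + 1) + 0
    omega)

theorem Samples.rand {n : I → ℕ} (h : Finds lam inp fun i => .num (n i)) :
    Samples lam inp fun i => (randBelow (n i)).map Data.num := by
  refine h.seq ?_
  obtain ⟨p, hp⟩ := h.polyBounded
  refine ⟨.rand, .C 1 + .C 2 * p, fun i => (Prog.Halts.rand (.num (n i))).mono ?_⟩
  have := hp i
  simp
  omega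

theorem Refines.of_finds {i : J → I} {inp' : J → Data}
    (h : Finds (fun j => lam (i j)) inp' fun j => inp (i j)) : Refines lam inp i inp' :=
  fun _ hμ => h.seq (hμ.comp i)

/-- The program keeps its input next to the sample. `Refines` expresses that everything computable
before remains computable in the continuation, so nested draws can refer to all earlier values. -/
theorem Samples.bind {Ω : I → Type} {ν : ∀ i, PMF (Ω i)} {out : ∀ i, Ω i → Data}
    {κ : ∀ i, Ω i → PMF Data} (h : Samples lam inp fun i => (ν i).map (out i))
    (hκ : ∀ (J : Type) (i : J → I) (ω : ∀ j, Ω (i j)) (inp' : J → Data),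
      (∀ j, ω j ∈ (ν (i j)).support) → Refines lam inp i inp' →
      Finds (fun j => lam (i j)) inp' (fun j => out (i j) (ω j)) →
      Samples (fun j => lam (i j)) inp' fun j => κ (i j) (ω j)) :
    Samples lam inp fun i => (ν i).bind (κ i) := by
  have h1 := Samples.pair h.input h
  simp only [PMF.map_comp] at h1
  refine Samples.seq h1 fun J i ω hω => ?_
  obtain ⟨p, hp⟩ := h.exists_size_le
  have h2 := (Finds.id (lam := fun j => lam (i j))
    (inp := fun j => Data.pair (inp (i j)) (out (i j) (ω j))) (by
      refine ((h.polyBounded_input.comp i).add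
        ((PolyBounded.mono (PolyBounded.eval p) ?_).add (PolyBounded.const 1))).mono
        (fun j => (Nat.add_assoc _ _ _).le)
      exact fun j => hp (i j) _ (PMF.mem_support_map (hω j))))
  exact hκ J i ω _ hω (Refines.of_finds h2.fst) h2.snd

/-- Apply a deterministic computation to a sample. -/
theorem Samples.map {Ω : I → Type} {ν : ∀ i, PMF (Ω i)} {out g : ∀ i, Ω i → Data}
    (h : Samples lam inp fun i => (ν i).map (out i))
    (hg : ∀ (J : Type) (i : J → I) (ω : ∀ j, Ω (i j)) (inp' : J → Data),
      (∀ j, ω j ∈ (ν (i j)).support) → Refines lam inp i inp' →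
      Finds (fun j => lam (i j)) inp' (fun j => out (i j) (ω j)) →
      Finds (fun j => lam (i j)) inp' fun j => g (i j) (ω j)) :
    Samples lam inp fun i => (ν i).map (g i) :=
  Samples.bind h hg

/-- Each branch is required only on the subfamily that enters it, so its condition may be used
there, for instance to form elements of `Fin`. -/
theorem Samples.ite {c : I → ℕ} {μ : I → PMF Data} (hc : Finds lam inp fun i => .num (c i))
    (h₁ : ∀ (J : Type) (i : J → I), (∀ j, c (i j) ≠ 0) →
      Refines lam inp i (fun j => inp (i j)) →
      Samples (fun j => lam (i j)) (fun j => inp (i j)) fun j => μ (i j))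
    (h₂ : ∀ (J : Type) (i : J → I), (∀ j, c (i j) = 0) →
      Refines lam inp i (fun j => inp (i j)) →
      Samples (fun j => lam (i j)) (fun j => inp (i j)) fun j => μ (i j)) :
    Samples lam inp μ := by
  obtain ⟨C, p, hC⟩ := hc
  obtain ⟨P, q, hP⟩ := h₁ {i // c i ≠ 0} (fun j => j.1) (fun j => j.2) (Refines.comp _)
  obtain ⟨Q, r, hQ⟩ := h₂ {i // c i = 0} (fun j => j.1) (fun j => j.2) (Refines.comp _)
  refine ⟨.ite C P Q, p + (q + r), fun i => ?_⟩
  rw [Polynomial.eval_add]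
  exact (hC i).ite (fun h => (hP ⟨i, h⟩).mono (by simp)) fun h => (hQ ⟨i, h⟩).mono (by simp)

theorem Finds.ite {c : I → ℕ} {p : I → Prop} [DecidablePred p] {f g : I → Data}
    (hc : Finds lam inp fun i => .num (c i)) (hp : ∀ i, c i ≠ 0 ↔ p i) (hf : Finds lam inp f)
    (hg : Finds lam inp g) : Finds lam inp fun i => if p i then f i else g i := by
  refine Samples.ite hc (fun J i h _ => ?_) fun J i h _ => ?_
  · exact Finds.congr (hf.comp i) fun j => if_pos ((hp _).1 (h j))
  · exact Finds.congr (hg.comp i) fun j => if_neg fun h' => (hp _).2 h' (h j)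

/-- Polynomially many rounds alone do not give polynomial time, since a state might double in every
round. The invariant supplies the bound on the size of the state that holds throughout the loop. -/
theorem Samples.iter {Ω : I → Type} {n : I → ℕ} {κ : ∀ i, ℕ → Ω i → PMF (Ω i)}
    {enc : ∀ i, Ω i → Data} (Inv : ∀ i, ℕ → Ω i → Prop) {init : ∀ i, Ω i}
    (hn : Finds lam inp fun i => .num (n i)) (hb : PolyBounded lam n)
    (hinit : Finds lam inp fun i => enc i (init i)) (hInv : ∀ i, Inv i (n i) (init i))
    (hstep : ∀ i k ω, k < n i → Inv i (k + 1) ω → ∀ ω' ∈ (κ i k ω).support, Inv i k ω')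
    (hsize : ∃ p : Polynomial ℕ, ∀ i k ω, k ≤ n i → Inv i k ω → (enc i ω).size ≤ p.eval (lam i))
    (hbody : ∀ (J : Type) (i : J → I) (k : J → ℕ) (ω : ∀ j, Ω (i j)) (inp' : J → Data),
      (∀ j, k j < n (i j)) → (∀ j, Inv (i j) (k j + 1) (ω j)) → Refines lam inp i inp' →
      Finds (fun j => lam (i j)) inp' (fun j => .num (k j)) →
      Finds (fun j => lam (i j)) inp' (fun j => enc (i j) (ω j)) →
      Samples (fun j => lam (i j)) inp'
        fun j => (κ (i j) (k j) (ω j)).map (enc (i j))) :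
    Samples lam inp fun i => (countdown (κ i) (n i) (init i)).map (enc i) := by
  -- The state carries the original input along, so that the body can still read it.
  let st : ∀ i, ℕ → Ω i → Data := fun i k ω => .pair (.num k) (.pair (inp i) (enc i ω))
  have hst : ∀ (J : Type) (i : J → I) (k : J → ℕ) (ω : ∀ j, Ω (i j)), (∀ j, k j ≤ n (i j)) →
      (∀ j, Inv (i j) (k j) (ω j)) →
      Finds (fun j => lam (i j)) (fun j => st (i j) (k j) (ω j))
        fun j => st (i j) (k j) (ω j) := by
    intro J i k ω hk hω
    obtain ⟨p, hp⟩ := hsize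
    refine Finds.id (((((hb.comp i).add (.const 1)).add ((hinit.polyBounded_input.comp i).add
      (.eval p))).add (.const 2)).mono fun j => ?_)
    have h1 := hp (i j) _ _ (hk j) (hω j)
    have h2 : (k j).size ≤ k j := Nat.size_le.2 Nat.lt_two_pow_self
    have h3 := hk j
    simp only [st, Data.size]
    omega
  have htest := (hst {x : Σ i, ℕ × Ω i // x.2.1 ≤ n x.1 ∧ Inv x.1 x.2.1 x.2.2} (fun j => j.1.1)
    (fun j => j.1.2.1) (fun j => j.1.2.2) (fun j => j.2.1) fun j => j.2.2).fst
  obtain ⟨C, a, hC⟩ := htest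
  have hround : Samples (I := {x : Σ i, ℕ × Ω i // x.2.1 < n x.1 ∧ Inv x.1 (x.2.1 + 1) x.2.2})
      (fun j => lam j.1.1) (fun j => st j.1.1 (j.1.2.1 + 1) j.1.2.2)
      fun j => (κ j.1.1 j.1.2.1 j.1.2.2).map (st j.1.1 j.1.2.1) := by
    have h0 := hst {x : Σ i, ℕ × Ω i // x.2.1 < n x.1 ∧ Inv x.1 (x.2.1 + 1) x.2.2} (fun j => j.1.1)
      (fun j => j.1.2.1 + 1) (fun j => j.1.2.2) (fun j => j.2.1) fun j => j.2.2
    have hk := h0.fst.sub (h0.const 1)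
    have henc := h0.snd.snd
    have hinp := h0.snd.fst
    have hb := hbody {x : Σ i, ℕ × Ω i // x.2.1 < n x.1 ∧ Inv x.1 (x.2.1 + 1) x.2.2}
      (fun j => j.1.1) (fun j => j.1.2.1) (fun j => j.1.2.2) _ (fun j => j.2.1) (fun j => j.2.2)
      (Refines.of_finds hinp) hk henc
    refine (Samples.pair hk (Samples.pair hinp hb)).congr fun j => ?_
    rw [PMF.map_comp, PMF.map_comp]
    rfl
  obtain ⟨P, b, hP⟩ := hround
  obtain ⟨q, hq⟩ := hb
  have hloop : Samples lam (fun i => st i (n i) (init i)) fun i =>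
      (countdown (κ i) (n i) (init i)).map (st i 0) := by
    refine ⟨.loop C P, (q + .C 1) * (a + b), fun i t ht => ?_⟩
    have key := Prog.yields_rounds (C := C) (P := P) (κ := κ i) (enc := st i) (Inv := Inv i)
      (a := a.eval (lam i)) (b := b.eval (lam i)) (n := n i)
      (fun k ω hk hω => hC ⟨⟨i, k, ω⟩, hk, hω⟩)
      (fun k ω hk hω => hP ⟨⟨i, k, ω⟩, hk, hω⟩)
      (hstep i) (n i) t t (init i) le_rfl (hInv i)
    -- Every test costs at least one step, hence the budget exceeds the number of rounds and the
    -- built-in bound of `loop` is large enough.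
    have ha : 1 ≤ a.eval (lam i) :=
      (Data.size_pos _).trans (hC ⟨⟨i, n i, init i⟩, le_rfl, hInv i⟩).size_le
    have h1 : (n i + 1) * (a.eval (lam i) + b.eval (lam i)) ≤
        (q.eval (lam i) + 1) * (a.eval (lam i) + b.eval (lam i)) :=
      Nat.mul_le_mul_right _ (by have := hq i; omega)
    simp only [Polynomial.eval_mul, Polynomial.eval_add, Polynomial.eval_C] at ht ⊢
    refine (key ?_ (h1.trans ht)).mono h1
    have h2 : n i + 1 ≤ (n i + 1) * (a.eval (lam i) + b.eval (lam i)) :=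
      Nat.le_mul_of_pos_right _ (by omega)
    omega
  refine Samples.map (Finds.seq (hn.pair (Finds.pair hn.input hinit)) hloop)
    fun J i ω inp' hω hR hout => hout.snd.snd

end

/-! ## A library of polynomial-time computations -/

/-- Value of `n` rounds of a process, the rounds being counted down. -/
def descend {Ω : Type} (g : ℕ → Ω → Ω) : ℕ → Ω → Ω
  | 0, ω => ω
  | k + 1, ω => descend g k (g k ω)

theorem countdown_pure {Ω : Type} (g : ℕ → Ω → Ω) (n : ℕ) (ω : Ω) :
    countdown (fun k ω => PMF.pure (g k ω)) n ω = PMF.pure (descend g n ω) := by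
  induction n generalizing ω with
  | zero => rfl
  | succ n ih => rw [countdown, PMF.pure_bind, ih, descend]

theorem descend_induction {Ω : Type} {g : ℕ → Ω → Ω} {Inv : ℕ → Ω → Prop} {n : ℕ} {ω : Ω}
    (h : Inv n ω) (hg : ∀ k ω, k < n → Inv (k + 1) ω → Inv k (g k ω)) :
    Inv 0 (descend g n ω) := by
  induction n generalizing ω with
  | zero => exact h
  | succ n ih =>
    exact ih (hg n ω n.lt_succ_self h) fun k ω hk => hg k ω (hk.trans n.lt_succ_self)

section

variable {I : Type} {lam : I → ℕ} {inp : I → Data}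

theorem Finds.iter {Ω : I → Type} {n : I → ℕ} {g : ∀ i, ℕ → Ω i → Ω i}
    {enc : ∀ i, Ω i → Data} (Inv : ∀ i, ℕ → Ω i → Prop) {init : ∀ i, Ω i}
    (hn : Finds lam inp fun i => .num (n i)) (hb : PolyBounded lam n)
    (hinit : Finds lam inp fun i => enc i (init i)) (hInv : ∀ i, Inv i (n i) (init i))
    (hstep : ∀ i k ω, k < n i → Inv i (k + 1) ω → Inv i k (g i k ω))
    (hsize : ∃ p : Polynomial ℕ, ∀ i k ω, k ≤ n i → Inv i k ω → (enc i ω).size ≤ p.eval (lam i))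
    (hbody : ∀ (J : Type) (i : J → I) (k : J → ℕ) (ω : ∀ j, Ω (i j)) (inp' : J → Data),
      (∀ j, k j < n (i j)) → (∀ j, Inv (i j) (k j + 1) (ω j)) → Refines lam inp i inp' →
      Finds (fun j => lam (i j)) inp' (fun j => .num (k j)) →
      Finds (fun j => lam (i j)) inp' (fun j => enc (i j) (ω j)) →
      Finds (fun j => lam (i j)) inp' fun j => enc (i j) (g (i j) (k j) (ω j))) :
    Finds lam inp fun i => enc i (descend (g i) (n i) (init i)) := by
  have := Samples.iter (κ := fun i k ω => PMF.pure (g i k ω)) Inv hn hb hinit hInv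
    (by
      intro i k ω hk hω ω' h
      obtain rfl := (PMF.mem_support_pure_iff _ _).1 h
      exact hstep i k ω hk hω) hsize
    (by
      intro J i k ω inp' h1 h2 h3 h4 h5
      simp only [PMF.pure_map]
      exact hbody J i k ω inp' h1 h2 h3 h4 h5)
  simpa only [countdown_pure, PMF.pure_map] using this

theorem Finds.polyEval {f : I → ℕ} (h : Finds lam inp fun i => .num (f i)) (p : Polynomial ℕ) :
    Finds lam inp fun i => .num (p.eval (f i)) := by
  induction p using Polynomial.induction_on' with
  | add p q hp hq => simpa only [Polynomial.eval_add] using hp.add hq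
  | monomial n a =>
    simp only [Polynomial.eval_monomial]
    refine (h.const a).mul ?_
    induction n with
    | zero => simpa only [pow_zero] using h.const 1
    | succ n ih => simpa only [pow_succ] using ih.mul h

/-- No elementary operation measures a size. Loops over the parts of a datum therefore run for a
number of rounds that bounds the size and is computed from `lam`. -/
theorem Finds.numSize {f : I → Data} (h : PolyBounded lam fun i => (f i).size)
    (h0 : Finds lam inp fun i => .num (lam i)) :
    ∃ q : Polynomial ℕ, (∀ i, (f i).size ≤ q.eval (lam i)) ∧
      Finds lam inp fun i => .num (q.eval (lam i)) :=
  let ⟨q, hq⟩ := h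
  ⟨q, hq, h0.polyEval q⟩

theorem Finds.twoPow (h0 : Finds lam inp fun i => .num (lam i)) :
    Finds lam inp fun i => .num (2 ^ lam i) := by
  have h := Finds.iter (g := fun _ _ ω => 2 * ω) (enc := fun _ ω => .num ω)
    (Inv := fun i k ω => k ≤ lam i ∧ ω = 2 ^ (lam i - k)) (init := fun _ => 1) h0 .self (h0.const 1)
    (fun i => by simp)
    (by
      rintro i k ω hk ⟨h1, rfl⟩
      refine ⟨by omega, ?_⟩
      rw [← pow_succ']
      congr 1
      omega)
    (by
      refine ⟨.X + .C 2, ?_⟩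
      rintro i k ω hk ⟨-, rfl⟩
      simp only [Data.size, Nat.size_pow, Polynomial.eval_add, Polynomial.eval_X,
        Polynomial.eval_C]
      omega)
    (fun J i k ω inp' _ _ _ _ h => (h.const 2).mul h)
  refine h.congr fun i => ?_
  have := descend_induction (g := fun _ ω => 2 * ω) (n := lam i) (ω := 1)
    (Inv := fun k ω => k ≤ lam i ∧ ω = 2 ^ (lam i - k)) (by simp) (by
      rintro k ω hk ⟨h1, rfl⟩
      refine ⟨by omega, ?_⟩
      rw [← pow_succ']
      congr 1
      omega)
  rw [this.2, Nat.sub_zero]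

theorem descend_const {Ω : Type} (g : Ω → Ω) (n : ℕ) (ω : Ω) :
    descend (fun _ => g) n ω = g^[n] ω := by
  induction n generalizing ω with
  | zero => rfl
  | succ n ih => rw [descend, ih, Function.iterate_succ_apply]

theorem Data.nth_eq (x : Data) (i : ℕ) : x.nth i = (Data.snd^[i] x).fst := by
  induction i generalizing x with
  | zero => cases x <;> rfl
  | succ i ih =>
    rw [Function.iterate_succ_apply, ← ih]
    cases x with
    | num n => cases i <;> rfl
    | pair a b => rfl

theorem Finds.drop {f : I → Data} {n : I → ℕ} (hf : Finds lam inp f)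
    (hn : Finds lam inp fun i => .num (n i)) (hb : PolyBounded lam n) :
    Finds lam inp fun i => Data.snd^[n i] (f i) := by
  have h := Finds.iter (g := fun _ _ ω => ω.snd) (enc := fun _ ω => ω)
    (Inv := fun i _ ω => ω.size ≤ (f i).size) hn hb hf (fun i => le_rfl)
    (fun i k ω _ h => ω.size_snd_le.trans h)
    (by
      obtain ⟨p, hp⟩ := hf.polyBounded
      exact ⟨p, fun i k ω _ h => h.trans (hp i)⟩)
    (fun J i k ω inp' _ _ _ _ h => h.snd)
  simpa only [descend_const] using h

theorem Finds.nth {f : I → Data} {n : I → ℕ} (hf : Finds lam inp f)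
    (hn : Finds lam inp fun i => .num (n i)) (hb : PolyBounded lam n) :
    Finds lam inp fun i => (f i).nth (n i) := by
  simpa only [Data.nth_eq] using (hf.drop hn hb).fst

theorem Data.length_le_size (x : Data) : x.length ≤ x.size := by
  induction x with
  | num n => simp [Data.length]
  | pair a b _ ih =>
    simp only [Data.length, Data.size]
    omega

theorem Nat.size_le_self (n : ℕ) : n.size ≤ n := Nat.size_le.2 Nat.lt_two_pow_self

theorem Finds.length {f : I → Data} (hf : Finds lam inp f)
    (h0 : Finds lam inp fun i => .num (lam i)) :
    Finds lam inp fun i => .num (f i).length := by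
  obtain ⟨q, hq, hfq⟩ := Finds.numSize hf.polyBounded h0
  let g : ℕ → ℕ × Data → ℕ × Data := fun _ s => if s.2.isPair then (s.1 + 1, s.2.snd) else s
  -- The loop idles once the sequence is used up. The rest is never longer than the number of rounds
  -- left, so it is empty at the end and the counter equals the length.
  let Inv : I → ℕ → ℕ × Data → Prop := fun i k s =>
    s.1 + s.2.length = (f i).length ∧ s.2.size ≤ (f i).size ∧ s.2.length ≤ k
  have hstart : ∀ i, Inv i (q.eval (lam i)) (0, f i) := fun i =>
    ⟨by simp, le_rfl, (f i).length_le_size.trans (hq i)⟩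
  have hstep : ∀ i k s, k < q.eval (lam i) → Inv i (k + 1) s → Inv i k (g k s) := by
    rintro i k ⟨a, x⟩ hk ⟨h1, h2, h3⟩
    cases x with
    | num n => exact ⟨h1, h2, by simp [g, Data.isPair, Data.length]⟩
    | pair x y =>
      simp only [Data.length, Data.size] at h1 h2 h3
      simp only [g, Data.isPair, Inv, Data.snd, if_true]
      omega
  have h := Finds.iter (g := fun _ => g) (enc := fun _ s => .pair (.num s.1) s.2)
    (Inv := Inv) (init := fun i => (0, f i)) hfq (.eval q)
    ((hf.const 0).pair hf) hstart hstep
    (by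
      refine ⟨.C 2 + .C 2 * q, ?_⟩
      rintro i k ⟨a, x⟩ hk ⟨h1, h2, h3⟩
      have := (f i).length_le_size
      have := hq i
      have := Nat.size_le_self a
      simp [Data.size] at *
      omega)
    (by
      intro J i k ω inp' _ _ _ _ h
      refine (Finds.ite (p := fun j => (ω j).2.isPair = true) h.snd.isPair (fun j => ?_)
        ((h.fst.add (h.const 1)).pair h.snd.snd) h).congr fun j => ?_
      · simp only [Data.snd]
        cases (ω j).2.isPair <;> simp
      · simp only [g]
        split_ifs <;> rfl)
  refine h.fst.congr fun i => ?_
  obtain ⟨h1, h2, h3⟩ := descend_induction (hstart i) (hstep i)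
  simp only [Data.fst]
  congr 1
  omega

/-- An arbitrary machine becomes a subroutine: it is run under a timer set to its own clock. On
expiry `timed` returns `0`, whose second component is again `0`, which is the output `PPT.run`
prescribes for a stopped run. -/
theorem Samples.run (M : PPT) {f : I → Data} (hf : Finds lam inp f)
    (h0 : Finds lam inp fun i => .num (lam i)) :
    Samples lam inp fun i => M.run (lam i) (f i) := by
  have h1 : Samples lam (fun i => .pair (.num (M.clock.eval (lam i))) (f i)) fun i =>
      (M.code.run (M.clock.eval (lam i)) (f i)).map Prog.timedResult := by
    obtain ⟨p, hp⟩ := ((h0.polyEval M.clock).pair hf).polyBounded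
    refine ⟨.timed M.code, .C 1 + p + M.clock, fun i => (Prog.Halts.timed _ _ _).mono ?_⟩
    have h2 : (Data.pair (.num (M.clock.eval (lam i))) (f i)).size ≤ _ := hp i
    simp only [Polynomial.eval_add, Polynomial.eval_C]
    omega
  refine (Samples.map (g := fun _ ω => (Prog.timedResult ω).snd)
      (((h0.polyEval M.clock).pair hf).seq h1)
    fun J i ω inp' _ _ h => h.snd).congr fun i => ?_
  rw [PPT.run]
  congr 1
  funext o
  rcases o with _ | ⟨y, r⟩ <;> rfl

/-- The way back from families to machines: on inputs of the family the clock never interferes.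
Nothing is claimed about other inputs. -/
theorem PPT.exists_run_eq {μ : I → PMF Data} (h : Samples lam inp μ) :
    ∃ M : PPT, ∀ i, M.run (lam i) (inp i) = μ i := by
  obtain ⟨P, p, hP⟩ := h
  refine ⟨⟨P, p⟩, fun i => ?_⟩
  have h1 := congrArg (PMF.map (fun o : Option Data => o.getD (.num 0))) (hP i).computes
  rw [PMF.map_comp, PMF.map_comp] at h1
  simp only [Function.comp_def, Option.getD_some, ← Function.id_def, PMF.map_id] at h1
  rw [← h1, PPT.run]
  congr 1
  funext o
  rcases o with _ | ⟨y, r⟩ <;> rfl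

theorem PPT.size_run_le (M : PPT) {n : ℕ} {x y : Data} (h : y ∈ (M.run n x).support) :
    y.size ≤ M.clock.eval n + 1 := by
  obtain ⟨o, ho, rfl⟩ := (PMF.mem_support_map_iff _ _ _).1 h
  rcases o with _ | ⟨z, r⟩
  · simp [Data.size]
  · have := Prog.size_run _ _ _ _ _ ho
    simp only
    omega

theorem Samples.of_computes (M : PPT) {f : I → Data} {μ : I → PMF Data} (hf : Finds lam inp f)
    (h : ∀ i, M.Computes (lam i) (f i) (μ i)) : Samples lam inp μ :=
  hf.seq ⟨M.code, M.clock, fun i => (h i).halts⟩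

theorem Samples.randBits (h0 : Finds lam inp fun i => .num (lam i)) :
    Samples lam inp fun i => (_root_.randBits (lam i)).map Data.num :=
  Samples.rand h0.twoPow

theorem lt_of_mem_randBits {n k : ℕ} (h : k ∈ (randBits n).support) : k < 2 ^ n :=
  Prog.lt_of_mem_randBelow (Nat.two_pow_pos n) h

section perm

variable {F : PermFamily} {k N : I → ℕ}

theorem Finds.perm (hF : F.Efficient) {x : ∀ i, Fin (N i)}
    (h0 : Finds lam inp fun i => .num (lam i)) (hk : Finds lam inp fun i => .num (k i))
    (hN : Finds lam inp fun i => .num (N i)) (hx : Finds lam inp fun i => .num (x i))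
    (hlt : ∀ i, k i < 2 ^ lam i) (hb : PolyBounded lam N) :
    Finds lam inp fun i => .num (F (lam i) (k i) (N i) (x i)) := by
  obtain ⟨P, p, hP⟩ := hF
  obtain ⟨q, hq⟩ := hb
  refine (h0.pair (hk.pair (hN.pair hx))).seq ⟨P, p.comp (.X + q), fun i => ?_⟩
  refine (hP (lam i) (k i) (N i) (hlt i) (x i)).halts.mono ?_
  simp only [Polynomial.eval_comp, Polynomial.eval_add, Polynomial.eval_X]
  exact p.eval_mono_nat (Nat.add_le_add_left (hq i) _)

/-- The inverse is found by exhaustive search, which is affordable because `N` is polynomially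
bounded. Candidates are tried in descending order, and the accumulator is correct as soon as the
preimage has been passed. -/
theorem Finds.perm_symm (hF : F.Efficient) {x : ∀ i, Fin (N i)}
    (h0 : Finds lam inp fun i => .num (lam i)) (hk : Finds lam inp fun i => .num (k i))
    (hN : Finds lam inp fun i => .num (N i)) (hx : Finds lam inp fun i => .num (x i))
    (hlt : ∀ i, k i < 2 ^ lam i) (hb : PolyBounded lam N) :
    Finds lam inp fun i => .num ((F (lam i) (k i) (N i)).symm (x i)) := by
  let g : ∀ i, ℕ → ℕ → ℕ := fun i m acc =>
    if h : m < N i then if F (lam i) (k i) (N i) ⟨m, h⟩ = x i then m else acc else acc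
  let Inv : I → ℕ → ℕ → Prop := fun i m acc => acc ≤ N i ∧
    (m ≤ ((F (lam i) (k i) (N i)).symm (x i) : ℕ) → acc = (F (lam i) (k i) (N i)).symm (x i))
  have hstart : ∀ i, Inv i (N i) 0 := fun i => ⟨by omega, fun h => by
    have := ((F (lam i) (k i) (N i)).symm (x i)).2
    omega⟩
  have hstep : ∀ i m acc, m < N i → Inv i (m + 1) acc → Inv i m (g i m acc) := by
    rintro i m acc hm ⟨h1, h2⟩
    simp only [g, dif_pos hm, Inv]
    split_ifs with h
    · have h' : (F (lam i) (k i) (N i)).symm (x i) = ⟨m, hm⟩ := by rw [← h, Equiv.symm_apply_apply]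
      rw [h']
      exact ⟨hm.le, fun _ => rfl⟩
    · refine ⟨h1, fun h3 => h2 ?_⟩
      refine Nat.succ_le_of_lt (lt_of_le_of_ne h3 fun h4 => h ?_)
      rw [← Equiv.eq_symm_apply]
      exact Fin.ext h4
  have h := Finds.iter (Ω := fun _ => ℕ) (g := g) (enc := fun _ m => .num m) (Inv := Inv)
    (init := fun _ => 0) hN hb (h0.const 0) hstart hstep
    (by
      obtain ⟨q, hq⟩ := hb
      refine ⟨q + .C 1, ?_⟩
      rintro i m acc hm ⟨h1, -⟩
      have := hq i
      have := Nat.size_le_self acc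
      simp only [Data.size, Polynomial.eval_add, Polynomial.eval_C]
      omega)
    (by
      intro J i m acc inp' hm _ hR hm' hacc
      have h0 := hR.finds h0
      have hx := hR.finds hx
      have hy := Finds.perm hF (x := fun j => (⟨m j, hm j⟩ : Fin (N (i j)))) h0 (hR.finds hk)
        (hR.finds hN) hm' (fun j => hlt (i j)) (hb.comp i)
      refine (Finds.ite (p := fun j => F (lam (i j)) (k (i j)) (N (i j)) ⟨m j, hm j⟩ = x (i j))
        (hy.eq hx) (fun j => ?_) hm' hacc).congr fun j => ?_
      · rw [Fin.ext_iff]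
        simp
      · simp only [g, dif_pos (hm j)]
        split_ifs <;> rfl)
  refine h.congr fun i => ?_
  rw [(descend_induction (hstart i) (hstep i)).2 (Nat.zero_le _)]

end perm

end

/-! ## Independent samples -/

theorem indep_succ {α : Type} (n : ℕ) (f : Fin (n + 1) → PMF α) :
    indep (n + 1) f = (f 0).bind fun a => (indep n fun i => f i.succ).map (Fin.cons a) :=
  rfl

/-- `indep` splits off the first entry; a loop that counts down and prepends draws the last entry
first. Independence makes the order irrelevant. -/
theorem indep_succ' {α : Type} (n : ℕ) (f : Fin (n + 1) → PMF α) :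
    indep (n + 1) f =
      (f (Fin.last n)).bind fun a => (indep n fun i => f i.castSucc).map fun v => Fin.snoc v a := by
  induction n with
  | zero =>
    rw [indep_succ]
    simp only [indep, PMF.pure_map]
    congr 1
    funext a
    congr 1
    funext i
    fin_cases i
    rfl
  | succ n ih =>
    rw [indep_succ, ih]
    simp only [PMF.map_bind, PMF.map_comp]
    rw [PMF.bind_comm]
    congr 1
    funext a
    rw [indep_succ, PMF.map_bind]
    congr 1
    funext b
    rw [PMF.map_comp]
    congr 1
    funext v
    exact Fin.cons_snoc_eq_snoc_cons b v a

theorem indep_map {α β : Type} (n : ℕ) (f : Fin n → PMF α) (g : α → β) :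
    (indep n f).map (fun v i => g (v i)) = indep n fun i => (f i).map g := by
  induction n with
  | zero =>
    simp only [indep, PMF.pure_map]
    congr 1
    funext i
    exact i.elim0
  | succ n ih =>
    rw [indep_succ, indep_succ, PMF.map_bind, PMF.bind_map]
    congr 1
    funext a
    simp only [Function.comp]
    rw [← ih, PMF.map_comp, PMF.map_comp]
    congr 1
    funext v i
    refine Fin.cases ?_ (fun i => ?_) i <;> rfl

theorem countdown_pair (κ : ℕ → PMF Data) (n : ℕ) (l : Data) :
    countdown (fun k l => (κ k).map fun y => Data.pair y l) n l =
      (indep n fun i => κ i).map fun v => (List.ofFn v).foldr Data.pair l := by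
  induction n generalizing l with
  | zero => simp [countdown, indep, PMF.pure_map]
  | succ n ih =>
    rw [countdown, PMF.bind_map, indep_succ', PMF.map_bind]
    congr 1
    funext y
    simp only [Function.comp, ih, PMF.map_comp]
    congr 1
    funext v
    rw [Function.comp_apply, List.ofFn_succ', List.concat_eq_append, List.foldr_append]
    simp only [Fin.snoc_castSucc, Fin.snoc_last, List.foldr_cons, List.foldr_nil]

theorem Data.ofList_eq (l : List Data) : Data.ofList l = l.foldr Data.pair (.num 0) := by
  induction l with
  | nil => rfl
  | cons a l ih => rw [Data.ofList, ih]; rfl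

theorem Samples.tabulate {I : Type} {lam : I → ℕ} {inp : I → Data} {n : I → ℕ}
    {κ : I → ℕ → PMF Data} (hn : Finds lam inp fun i => .num (n i)) (hb : PolyBounded lam n)
    (hbody : ∀ (J : Type) (i : J → I) (k : J → ℕ) (inp' : J → Data), (∀ j, k j < n (i j)) →
      Refines lam inp i inp' → Finds (fun j => lam (i j)) inp' (fun j => .num (k j)) →
      Samples (fun j => lam (i j)) inp' fun j => κ (i j) (k j)) :
    Samples lam inp fun i =>
      (indep (n i) fun a => κ i a).map fun v => Data.ofList (List.ofFn v) := by
  have hid : Finds (I := {x : I × ℕ // x.2 < n x.1}) (fun j => lam j.1.1)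
      (fun j => .pair (inp j.1.1) (.num j.1.2)) fun j => .pair (inp j.1.1) (.num j.1.2) := by
    refine Finds.id ((((hn.polyBounded_input.comp _).add (hb.comp _)).add (.const 2)).mono
      fun j => ?_)
    have h1 := j.2
    have h2 := Nat.size_le_self j.1.2
    simp only [Data.size]
    omega
  -- Treating index and position together as one index yields a single bound for all entries; the
  -- loop invariant then bounds the stored sequence.
  obtain ⟨B, hB⟩ := (hbody {x : I × ℕ // x.2 < n x.1} (fun j => j.1.1) (fun j => j.1.2) _
    (fun j => j.2)
    (Refines.of_finds hid.fst) hid.snd).exists_size_le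
  replace hB : ∀ i k, k < n i → ∀ y ∈ (κ i k).support, y.size ≤ B.eval (lam i) :=
    fun i k h => hB ⟨(i, k), h⟩
  have h := Samples.iter (κ := fun i k l => (κ i k).map fun y => Data.pair y l)
    (enc := fun _ l => l) (init := fun _ => .num 0)
    (Inv := fun i k l => k ≤ n i ∧ l.size ≤ (n i - k) * (B.eval (lam i) + 1) + 1)
    hn hb (hn.const 0) (fun i => by simp [Data.size])
    (by
      rintro i k l hk ⟨h1, h2⟩ l' hl'
      obtain ⟨y, hy, rfl⟩ := (PMF.mem_support_map_iff _ _ _).1 hl'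
      have h3 := hB i k hk y hy
      refine ⟨hk.le, ?_⟩
      have h4 : n i - k = n i - (k + 1) + 1 := by omega
      rw [h4, Nat.add_mul]
      simp only [Data.size]
      omega)
    (by
      obtain ⟨q, hq⟩ := hb
      refine ⟨q * (B + .C 1) + .C 1, ?_⟩
      rintro i k l hk ⟨-, h⟩
      simp only [Polynomial.eval_add, Polynomial.eval_mul, Polynomial.eval_C]
      refine h.trans (Nat.add_le_add_right (Nat.mul_le_mul_right _ ?_) _)
      have := hq i
      omega)
    (by
      intro J i k l inp' hk _ hR hk' hl
      have h1 := hbody J i k inp' hk hR hk'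
      refine Samples.map (ν := fun j => κ (i j) (k j)) (out := fun _ y => y)
        (g := fun j y => Data.pair y (l j)) ?_ ?_ |>.congr fun j => ?_
      · exact h1.congr fun j => PMF.map_id _
      · exact fun J' i' y inp'' _ hR' hy => hy.pair (hR'.finds hl)
      · exact PMF.map_id _)
  refine h.congr fun i => ?_
  rw [countdown_pair]
  simp only [Data.ofList_eq]
  exact (PMF.map_id _).symm

/-! ## Computing with the BGN scheme -/

namespace BilinearGenerator

variable (B : BilinearGenerator)

/-- Descriptions of groups that the generator outputs. -/
def Describes (lam : ℕ) (d : Data) : Prop :=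
  ∃ o ∈ (B.gen lam).support, o.2.2 = d

/-- Multiplication by `1` outputs the representation of `a` in polynomial time, and a result is
never longer than the running time. -/
theorem exists_size_repr_le : ∃ p : Polynomial ℕ, ∀ lam d, B.Describes lam d →
    ∀ a : (B.grp d).G, ((B.grp d).repr a).size ≤ p.eval lam := by
  obtain ⟨M, hM⟩ := B.mul_ppt
  refine ⟨M.clock, ?_⟩
  rintro lam _ ⟨o, ho, rfl⟩ a
  have := (hM lam o ho a 1).halts.size_result_le (PMF.mem_support_pure_iff _ _ |>.2 rfl)
  rwa [mul_one] at this

end BilinearGenerator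

section

variable {B : BilinearGenerator} {I : Type} {lam : I → ℕ} {inp : I → Data} {d : I → Data}

theorem Finds.groupMul {a b : ∀ i, (B.grp (d i)).G} (hd : ∀ i, B.Describes (lam i) (d i))
    (hD : Finds lam inp d) (ha : Finds lam inp fun i => (B.grp (d i)).repr (a i))
    (hb : Finds lam inp fun i => (B.grp (d i)).repr (b i)) :
    Finds lam inp fun i => (B.grp (d i)).repr (a i * b i) := by
  obtain ⟨M, hM⟩ := B.mul_ppt
  replace hM : ∀ lam d, B.Describes lam d → ∀ a b : (B.grp d).G,
      M.Computes lam (.pair d (.pair ((B.grp d).repr a) ((B.grp d).repr b)))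
        (PMF.pure ((B.grp d).repr (a * b))) := by
    rintro lam _ ⟨o, ho, rfl⟩ a b
    exact hM lam o ho a b
  exact Samples.of_computes M (hD.pair (ha.pair hb)) fun i => hM _ _ (hd i) _ _

theorem Samples.groupElement (hd : ∀ i, B.Describes (lam i) (d i)) (hD : Finds lam inp d) :
    Samples lam inp fun i =>
      (PMF.uniformOfFintype (B.grp (d i)).G).map (B.grp (d i)).repr := by
  obtain ⟨M, hM⟩ := B.sample_ppt
  replace hM : ∀ lam d, B.Describes lam d →
      M.Computes lam d ((PMF.uniformOfFintype (B.grp d).G).map (B.grp d).repr) := by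
    rintro lam _ ⟨o, ho, rfl⟩
    exact hM lam o ho
  exact Samples.of_computes M hD fun i => hM _ _ (hd i)

/-- Exponentiation by repeated squaring. -/
theorem Finds.groupPow {x : ∀ i, (B.grp (d i)).G} {m : I → ℕ}
    (hd : ∀ i, B.Describes (lam i) (d i)) (h0 : Finds lam inp fun i => .num (lam i))
    (hD : Finds lam inp d) (hx : Finds lam inp fun i => (B.grp (d i)).repr (x i))
    (hm : Finds lam inp fun i => .num (m i)) :
    Finds lam inp fun i => (B.grp (d i)).repr (x i ^ (m i + 1)) := by
  obtain ⟨q, hq, hfq⟩ := Finds.numSize hm.polyBounded h0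
  let Ω : I → Type := fun i => (B.grp (d i)).G × (B.grp (d i)).G × ℕ
  let g : ∀ i, ℕ → Ω i → Ω i := fun i _ s =>
    (if s.2.2 % 2 ≠ 0 then s.1 * s.2.1 else s.1, s.2.1 * s.2.1, s.2.2 / 2)
  -- The accumulator starts at `x`, whence the exponent `m + 1`: no program producing the identity
  -- is assumed. The remaining exponent is below `2 ^ k` with `k` rounds left, so it ends at `0`.
  let Inv : ∀ i, ℕ → Ω i → Prop := fun i k s =>
    s.1 * s.2.1 ^ s.2.2 = x i ^ (m i + 1) ∧ s.2.2 < 2 ^ k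
  have hstart : ∀ i, Inv i (q.eval (lam i)) (x i, x i, m i) := by
    refine fun i => ⟨(pow_succ' _ _).symm, ?_⟩
    have h1 : (m i).size + 1 ≤ q.eval (lam i) := hq i
    exact Nat.size_le.1 (show (m i).size ≤ _ by omega)
  have hstep : ∀ i k s, k < q.eval (lam i) → Inv i (k + 1) s → Inv i k (g i k s) := by
    rintro i k ⟨a, b, n⟩ _ ⟨h1, h2⟩
    simp only at h1 h2
    refine ⟨?_, ?_⟩
    · rw [← h1]
      simp only [g]
      rw [← pow_two, ← pow_mul]
      split_ifs with h
      · rw [mul_assoc, ← pow_succ']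
        congr 2
        omega
      · congr 2
        omega
    · simp only [g]
      rw [pow_succ] at h2
      omega
  have h := Finds.iter (g := g) (Inv := Inv) (init := fun i => (x i, x i, m i))
    (enc := fun i s => .pair ((B.grp (d i)).repr s.1)
      (.pair ((B.grp (d i)).repr s.2.1) (.num s.2.2)))
    hfq (.eval q) (hx.pair (hx.pair hm)) hstart hstep
    (by
      obtain ⟨p, hp⟩ := B.exists_size_repr_le
      refine ⟨.C 2 * p + q + .C 4, ?_⟩
      rintro i k ⟨a, b, n⟩ hk ⟨h1, h2⟩
      have ha := hp _ _ (hd i) a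
      have hb := hp _ _ (hd i) b
      have hn := Nat.size_le.2 h2
      simp only [Data.size, Polynomial.eval_add, Polynomial.eval_mul, Polynomial.eval_C]
      simp only at hn
      omega)
    (by
      intro J i k s inp' _ _ hR _ hs
      have ha := hs.fst
      have hb := hs.snd.fst
      have hn := hs.snd.snd
      have hD' := hR.finds hD
      have hd' : ∀ j, B.Describes (lam (i j)) (d (i j)) := fun j => hd (i j)
      have hab := Finds.groupMul (B := B) (d := fun j => d (i j)) hd' hD' ha hb
      have hbb := Finds.groupMul (B := B) (d := fun j => d (i j)) hd' hD' hb hb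
      have hite := Finds.ite (p := fun j => (s j).2.2 % 2 ≠ 0) (hn.mod (hn.const 2))
        (fun j => Iff.rfl) hab ha
      refine (hite.pair (hbb.pair (hn.div (hn.const 2)))).congr fun j => ?_
      simp only [g]
      split_ifs <;> rfl)
  refine h.fst.congr fun i => ?_
  obtain ⟨h1, h2⟩ := descend_induction (hstart i) (hstep i)
  simp only [pow_zero, Nat.lt_one_iff] at h2
  rw [h2, pow_zero, mul_one] at h1
  simp only [Data.fst]
  rw [h1]

end

namespace BGN

variable {B : BilinearGenerator}

/-- Public keys that key generation outputs at a security parameter. -/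
def PublicKey.Valid (lam : ℕ) (pk : PublicKey B) : Prop :=
  pk.lam = lam ∧ B.Describes lam pk.d

/-- The shift in `randOne` turns into the exponent `r + 1`, which is the form of exponent that
`Finds.groupPow` handles. -/
theorem keyGen_eq (lam : ℕ) : keyGen B lam = (B.gen lam).bind fun o =>
    (PMF.uniformOfFintype (B.grp o.2.2).G).bind fun g => (randBelow (o.1 * o.2.1)).map fun r =>
      (⟨lam, o.1 * o.2.1, o.2.2, g, (g ^ (r + 1)) ^ o.2.1⟩, o.1) := by
  change (B.gen lam).bind _ = _
  congr 1
  funext o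
  change (PMF.uniformOfFintype (B.grp o.2.2).G).bind _ = _
  congr 1
  funext g
  change (randOne _).bind _ = _
  rw [randOne, PMF.bind_map]
  rfl

theorem encrypt_eq (pk : PublicKey B) (a : ℕ) :
    encrypt pk a = (randBelow pk.n).map fun r => pk.g ^ a * pk.h ^ (r + 1) := by
  change (randOne _).bind _ = _
  rw [randOne, PMF.bind_map]
  rfl

theorem valid_of_mem_keyGen {lam : ℕ} {keys : PublicKey B × ℕ}
    (h : keys ∈ (keyGen B lam).support) : keys.1.Valid lam := by
  simp only [keyGen_eq, PMF.mem_support_bind_iff, PMF.mem_support_map_iff] at h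
  obtain ⟨o, ho, g, -, r, -, rfl⟩ := h
  exact ⟨rfl, o, ho, rfl⟩

/-- Ciphertexts as data. -/
noncomputable def cipher (pk : PublicKey B) (a : ℕ) : PMF Data :=
  (encrypt pk a).map (B.grp pk.d).repr

end BGN

section

variable {B : BilinearGenerator} {I : Type} {lam : I → ℕ} {inp : I → Data}

theorem Samples.cipher {pk : I → BGN.PublicKey B} {a : I → ℕ}
    (hpk : ∀ i, (pk i).Valid (lam i)) (h : Finds lam inp fun i => (pk i).data)
    (ha : Finds lam inp fun i => .num (a i)) (ha1 : ∀ i, a i ≤ 1) :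
    Samples lam inp fun i => BGN.cipher (pk i) (a i) := by
  have h1 : Samples lam inp fun i => (randBelow (pk i).n).map fun r =>
      (B.grp (pk i).d).repr ((pk i).g ^ a i * (pk i).h ^ (r + 1)) := by
    refine Samples.map (Samples.rand h.snd.fst) fun J i r inp' _ hR hr => ?_
    have hpk' : ∀ j, (pk (i j)).Valid (lam (i j)) := fun j => hpk (i j)
    replace h := hR.finds h
    replace ha := hR.finds ha
    have h0 : Finds (fun j => lam (i j)) inp' fun j => .num (lam (i j)) :=
      h.fst.congr fun j => by rw [← (hpk' j).1]; rfl
    have hp := Finds.groupPow (B := B) (fun j => (hpk' j).2) h0 h.snd.snd.fst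
      (h.snd.snd.snd.snd) hr
    have hg := Finds.groupMul (B := B) (fun j => (hpk' j).2) h.snd.snd.fst h.snd.snd.snd.fst hp
    -- Plaintexts are bits, so the factor `g ^ a` is present or absent; the identity element is
    -- never needed.
    refine (Finds.ite (p := fun j => a (i j) ≠ 0) ha (fun _ => Iff.rfl) hg hp).congr fun j => ?_
    have := ha1 (i j)
    split_ifs with h
    · rw [show a (i j) = 1 by omega, pow_one]
    · rw [show a (i j) = 0 by omega, pow_zero, one_mul]
  refine h1.congr fun i => ?_
  rw [BGN.cipher, BGN.encrypt_eq, PMF.map_comp]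
  rfl

theorem Samples.publicKey (h0 : Finds lam inp fun i => .num (lam i)) :
    Samples lam inp fun i => (BGN.keyGen B (lam i)).map fun keys => keys.1.data := by
  simp only [BGN.keyGen_eq, PMF.map_bind, PMF.map_comp]
  obtain ⟨M, hM⟩ := B.gen_ppt
  refine Samples.bind (Samples.of_computes M h0 fun i => hM (lam i))
    fun J i o inp₁ ho hR₁ ho' => ?_
  have hd : ∀ j, B.Describes (lam (i j)) (o j).2.2 := fun j => ⟨o j, ho j, rfl⟩
  refine Samples.bind (Samples.groupElement hd ho'.snd.snd) fun J' i' g inp₂ _ hR₂ hg => ?_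
  replace h0 := hR₂.finds (hR₁.finds h0)
  replace ho' := hR₂.finds ho'
  have hn := ho'.fst.mul ho'.snd.fst
  refine Samples.map (out := fun _ => Data.num) (Samples.rand hn)
    fun J'' i'' r inp₃ _ hR₃ hr => ?_
  have hd' : ∀ j, B.Describes (lam (i (i' (i'' j)))) (o (i' (i'' j))).2.2 := fun j => hd _
  replace h0 := hR₃.finds h0
  replace ho' := hR₃.finds ho'
  replace hg := hR₃.finds hg
  have hu := Finds.groupPow (B := B) hd' h0 ho'.snd.snd hg hr
  -- The exponent `q₂` is fed in as `(q₂ - 1) + 1`, which is correct because a prime is positive.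
  have hh := Finds.groupPow (B := B) hd' h0 ho'.snd.snd hu (ho'.snd.fst.sub (h0.const 1))
  refine (h0.pair ((ho'.fst.mul ho'.snd.fst).pair (ho'.snd.snd.pair (hg.pair hh)))).congr
    fun j => ?_
  have hq : (o (i' (i'' j))).2.1 - 1 + 1 = (o (i' (i'' j))).2.1 :=
    Nat.sub_add_cancel (B.prime₂ _ _ (ho _)).one_lt.le
  simp only [hq]
  rfl

end

/-- Law of a square array of independent entries, stored as a sequence of rows. -/
noncomputable def squareLaw (N : ℕ) (κ : ℕ → ℕ → PMF Data) : PMF Data :=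
  (indep N fun p => (indep N fun j => κ p j).map fun v => Data.ofList (List.ofFn v)).map
    fun v => Data.ofList (List.ofFn v)

theorem Samples.square {I : Type} {lam : I → ℕ} {inp : I → Data} {N : I → ℕ}
    {κ : I → ℕ → ℕ → PMF Data} (hN : Finds lam inp fun i => .num (N i)) (hb : PolyBounded lam N)
    (hbody : ∀ (J : Type) (i : J → I) (p k : J → ℕ) (inp' : J → Data), (∀ j, p j < N (i j)) →
      (∀ j, k j < N (i j)) → Refines lam inp i inp' →
      Finds (fun j => lam (i j)) inp' (fun j => .num (p j)) →
      Finds (fun j => lam (i j)) inp' (fun j => .num (k j)) →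
      Samples (fun j => lam (i j)) inp' fun j => κ (i j) (p j) (k j)) :
    Samples lam inp fun i => squareLaw (N i) (κ i) := by
  refine Samples.tabulate (κ := fun i p => (indep (N i) fun j => κ i p j).map
    fun v => Data.ofList (List.ofFn v)) hN hb fun J i p inp₁ hp hR₁ hp' => ?_
  refine Samples.tabulate (κ := fun j k => κ (i j) (p j) k) (hR₁.finds hN) (hb.comp i)
    fun J' i' k inp₂ hk hR₂ hk' => ?_
  exact hbody J' (fun j => i (i' j)) (fun j => p (i' j)) k inp₂ (fun j => hp _) hk
    (fun μ hμ => hR₂ _ (hR₁ μ hμ)) (hR₂.finds hp') hk'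

/-! ## Arrays of independent samples -/

/-- A value drawn in advance and used in one coordinate only may as well be drawn when that
coordinate is sampled; the other coordinates commute with the draw. -/
theorem indep_bind_ite {α β : Type} {n : ℕ} (i₀ : Fin n) (μ : PMF β) (η : β → PMF α)
    (f : Fin n → PMF α) :
    (μ.bind fun c => indep n fun i => if i = i₀ then η c else f i) =
      indep n fun i => if i = i₀ then μ.bind η else f i := by
  induction n with
  | zero => exact i₀.elim0
  | succ n ih =>
    simp only [indep_succ]
    refine Fin.cases ?_ (fun i₀ => ?_) i₀
    · simp only [if_true, Fin.succ_ne_zero, if_false, PMF.bind_bind]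
    · simp only [(Fin.succ_ne_zero i₀).symm, if_false, Fin.succ_inj]
      rw [PMF.bind_comm]
      congr 1
      funext a
      rw [← ih, PMF.map_bind]

theorem indep_apply {α : Type} {n : ℕ} (f : Fin n → PMF α) (v : Fin n → α) :
    indep n f v = ∏ i, f i (v i) := by
  classical
  induction n with
  | zero =>
    rw [indep, Fin.prod_univ_zero, PMF.pure_apply, if_pos (Subsingleton.elim _ _)]
  | succ n ih =>
    rw [indep_succ, PMF.bind_apply, Fin.prod_univ_succ, tsum_eq_single (v 0)]
    · rw [PMF.map_apply, tsum_eq_single (fun i => v i.succ)]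
      · rw [if_pos, ih]
        exact (Fin.cons_self_tail v).symm
      · intro w hw
        rw [if_neg]
        intro h
        exact hw (funext fun i => by rw [h, Fin.cons_succ])
    · intro a ha
      rw [PMF.map_apply, ENNReal.tsum_eq_zero.2, mul_zero]
      intro w
      rw [if_neg]
      intro h
      exact ha (by rw [h, Fin.cons_zero])

/-- Both sides assign to a vector the same product of probabilities, with the factors reordered. -/
theorem indep_perm {α : Type} {n : ℕ} (f : Fin n → PMF α) (σ : Equiv.Perm (Fin n)) :
    (indep n f).map (fun v i => v (σ i)) = indep n fun i => f (σ i) := by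
  classical
  ext w
  rw [PMF.map_apply, tsum_eq_single fun i => w (σ.symm i)]
  · rw [if_pos (by simp), indep_apply, indep_apply, ← Equiv.prod_comp σ]
    simp
  · intro v hv
    rw [if_neg]
    rintro rfl
    exact hv (by simp)

theorem squareLaw_congr {N : ℕ} {κ κ' : ℕ → ℕ → PMF Data}
    (h : ∀ p < N, ∀ j < N, κ p j = κ' p j) : squareLaw N κ = squareLaw N κ' := by
  unfold squareLaw
  congr 2
  funext p
  congr 2
  funext j
  exact h p p.2 j j.2

/-- Position `e` of the flattened square is the cell in row `e / N` and column `e % N`. Applying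
`indep_bind_ite` to the rows and then within that row moves the draw of `c` into the cell. -/
theorem squareLaw_bind_ite {N e : ℕ} (μ : PMF Data) (κ : ℕ → ℕ → PMF Data) :
    (μ.bind fun c => squareLaw N fun p j => if p * N + j = e then PMF.pure c else κ p j) =
      squareLaw N fun p j => if p * N + j = e then μ else κ p j := by
  rcases N.eq_zero_or_pos with rfl | hN
  · simp only [squareLaw, indep, PMF.bind_const]
  by_cases he : e / N < N
  · have key : ∀ p j : Fin N, (p : ℕ) * N + j = e ↔ p = ⟨e / N, he⟩ ∧ j = ⟨e % N, e.mod_lt hN⟩ := by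
      intro p j
      simp only [Fin.ext_iff]
      constructor
      · rintro rfl
        rw [Nat.add_comm, Nat.add_mul_div_right _ _ hN, Nat.div_eq_of_lt j.2,
          Nat.add_mul_mod_self_right, Nat.mod_eq_of_lt j.2, Nat.zero_add]
        exact ⟨rfl, rfl⟩
      · rintro ⟨h1, h2⟩
        rw [h1, h2]
        exact Nat.div_add_mod' e N
    have row : ∀ (ν : PMF Data) (p : Fin N), ((indep N fun j => if (p : ℕ) * N + j = e then ν
        else κ p j).map fun v => Data.ofList (List.ofFn v)) = if p = ⟨e / N, he⟩ then
          (indep N fun j => if j = ⟨e % N, e.mod_lt hN⟩ then ν else κ p j).map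
            (fun v => Data.ofList (List.ofFn v)) else
          (indep N fun j => κ p j).map fun v => Data.ofList (List.ofFn v) := by
      intro ν p
      simp only [key]
      split_ifs with hp
      · simp only [hp, true_and]
      · simp only [hp, false_and, if_false]
    have row' : ∀ (ν : PMF Data), (indep N fun p : Fin N => (indep N fun j =>
        if (p : ℕ) * N + j = e then ν else κ p j).map fun v => Data.ofList (List.ofFn v)) =
        indep N fun p => if p = ⟨e / N, he⟩ then
          (indep N fun j => if j = ⟨e % N, e.mod_lt hN⟩ then ν else κ (e / N) j).map
            (fun v => Data.ofList (List.ofFn v)) else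
          (indep N fun j => κ p j).map fun v => Data.ofList (List.ofFn v) := by
      intro ν
      congr 1
      funext p
      rw [row]
      split_ifs with hp
      · rw [hp]
      · rfl
    simp only [squareLaw, row']
    rw [← PMF.map_bind, indep_bind_ite, ← PMF.map_bind, indep_bind_ite, PMF.bind_pure]
  -- A position beyond the square belongs to no cell, and the drawn value is discarded.
  · have key : ∀ p j : Fin N, (p : ℕ) * N + j ≠ e := by
      intro p j h
      apply he
      rw [Nat.div_lt_iff_lt_mul hN, ← h]
      have h1 : ((p : ℕ) + 1) * N ≤ N * N := Nat.mul_le_mul_right _ p.2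
      have := j.2
      rw [Nat.add_mul] at h1
      omega
    simp only [squareLaw, key, if_false, PMF.bind_const]

/-! ## The games -/

/-- Answer to a request: the trapdoor for a vertex, `0` for anything else. -/
noncomputable def trapdoorLaw (lam : ℕ) {N : ℕ} (σ : Equiv.Perm (Fin N)) (v : ℕ) : PMF Data :=
  if h : v < N then (randBits lam).map fun s => .pair (.num (σ ⟨v, h⟩)) (.num s)
  else PMF.pure (.num 0)

namespace CQAdversary

variable (A : CQAdversary)

/-- One query, answered by `τ`. -/
noncomputable def queryStep (lam : ℕ) (T : Data) (τ : ℕ → PMF Data) (s : Data × Data) :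
    PMF (Data × Data) :=
  (A.query.run lam (.pair s.1 (.pair T s.2))).bind fun o =>
    (τ o.fst.toNat).map fun y => (o.snd, .pair y s.2)

/-- Query phase and final output of the adversary that has received the structure `T`. -/
noncomputable def finish (lam : ℕ) (T : Data) (τ : ℕ → PMF Data) (st : Data) : PMF Data :=
  (countdown (fun _ => A.queryStep lam T τ) (A.queries.eval lam) (st, .num 0)).bind fun w =>
    A.guess.run lam (.pair w.1 (.pair T w.2))

end CQAdversary

/-- Interpretation of the output of an adversary as a bit. -/
def Data.toBit (z : Data) : Bool := decide (z.toNat = 1)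

/-- Entry of an adjacency matrix whose rows are permuted; `0` outside of the matrix. -/
def VGraph.permEntry (Γ : VGraph) (σ : Equiv.Perm (Fin Γ.N)) (p j : ℕ) : ℕ :=
  if h : p < Γ.N ∧ j < Γ.N then Γ.entry (σ.symm ⟨p, h.1⟩) ⟨j, h.2⟩ else 0

theorem VGraph.permEntry_of_lt (Γ : VGraph) (σ : Equiv.Perm (Fin Γ.N)) {p j : ℕ} (hp : p < Γ.N)
    (hj : j < Γ.N) : Γ.permEntry σ p j = Γ.entry (σ.symm ⟨p, hp⟩) ⟨j, hj⟩ :=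
  dif_pos ⟨hp, hj⟩

theorem VGraph.permEntry_of_not_lt (Γ : VGraph) (σ : Equiv.Perm (Fin Γ.N)) {p j : ℕ}
    (h : ¬ (p < Γ.N ∧ j < Γ.N)) : Γ.permEntry σ p j = 0 :=
  dif_neg h

theorem VGraph.permEntry_le_one (Γ : VGraph) (σ : Equiv.Perm (Fin Γ.N)) (p j : ℕ) :
    Γ.permEntry σ p j ≤ 1 := by
  unfold permEntry VGraph.entry
  split_ifs
  · exact Bool.toNat_le _
  · exact zero_le_one

/-- The game with the permutations `G k` in which the first `e` ciphertexts encrypt `0`. -/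
noncomputable def hybrid (B : BilinearGenerator) (A : CQAdversary) (lam : ℕ)
    (G : ℕ → (N : ℕ) → Equiv.Perm (Fin N)) (e : ℕ) :
    PMF Data :=
  (BGN.keyGen B lam).bind fun keys => (A.start.run lam (.num lam)).bind fun o =>
    (randBits lam).bind fun k =>
      (squareLaw o.fst.length fun p j => BGN.cipher keys.1 (if p * o.fst.length + j < e then 0
        else (VGraph.ofData o.fst).permEntry (G k o.fst.length) p j)).bind fun rows =>
        A.finish lam (.pair keys.1.data rows) (trapdoorLaw lam (G k o.fst.length)) o.snd

/-- Structure all of whose ciphertexts encrypt `0`, under a fresh key. -/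
noncomputable def zeroTable (B : BilinearGenerator) (lam N : ℕ) : PMF Data :=
  (BGN.keyGen B lam).bind fun keys =>
    (squareLaw N fun _ _ => BGN.cipher keys.1 0).map (Data.pair keys.1.data)

/-- The game in which all ciphertexts encrypt `0` and the permutation is drawn from `pick`. -/
noncomputable def zeroGame (B : BilinearGenerator) (A : CQAdversary) (lam : ℕ)
    (pick : (N : ℕ) → PMF (Equiv.Perm (Fin N))) : PMF Data :=
  (A.start.run lam (.num lam)).bind fun o => (zeroTable B lam o.fst.length).bind fun T =>
    (pick o.fst.length).bind fun σ => A.finish lam T (trapdoorLaw lam σ) o.snd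

/-- Once `e` reaches the number of cells, the table no longer involves the permutation, so `k` may
be drawn after it. -/
theorem hybrid_eq_zeroGame (B : BilinearGenerator) (A : CQAdversary) {lam : ℕ}
    (G : ℕ → (N : ℕ) → Equiv.Perm (Fin N)) {e : ℕ}
    (h : ∀ o ∈ (A.start.run lam (.num lam)).support, o.fst.length * o.fst.length ≤ e) :
    hybrid B A lam G e = zeroGame B A lam fun N => (randBits lam).map fun k => G k N := by
  rw [hybrid, zeroGame, PMF.bind_comm]
  refine PMF.bind_congr_support _ fun o ho => ?_
  rw [zeroTable, PMF.bind_bind]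
  congr 1
  funext keys
  rw [PMF.bind_map]
  simp only [PMF.bind_map, Function.comp_def]
  rw [PMF.bind_comm _ (randBits lam)]
  congr 1
  funext k
  congr 1
  refine squareLaw_congr fun p hp j hj => ?_
  rw [if_pos]
  have h1 : (p + 1) * o.fst.length ≤ o.fst.length * o.fst.length := Nat.mul_le_mul_right _ hp
  have h2 := h o ho
  rw [Nat.add_mul] at h1
  omega

namespace SLPI

variable {B : BilinearGenerator} {F π : PermFamily}

theorem map_tabData_encMatrix (Γ : VGraph) (q₁ lam k : ℕ) (pk : BGN.PublicKey B) :
    (encMatrix F Γ (q₁, lam, k) pk).map (tabData pk) =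
      (squareLaw Γ.N fun p j => BGN.cipher pk (Γ.permEntry (F lam k Γ.N) p j)).map
        (Data.pair pk.data) := by
  set σ : Equiv.Perm (Fin Γ.N) := F lam k Γ.N with hσ
  have h1 : encMatrix F Γ (q₁, lam, k) pk =
      (indep Γ.N fun i => indep Γ.N fun j => BGN.encrypt pk (Γ.entry (σ.symm i) j)).map
        fun m => ⟨Γ.N, m⟩ := by
    -- Position `p` holds the row of vertex `σ⁻¹ p`. Permuting independently encrypted rows is the
    -- same as encrypting the permuted rows independently.
    rw [← indep_perm (fun i => indep Γ.N fun j => BGN.encrypt pk (Γ.entry i j)) σ.symm,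
      PMF.map_comp]
    rfl
  have h2 : ∀ p : Fin Γ.N, (indep Γ.N fun j : Fin Γ.N => BGN.cipher pk (Γ.permEntry σ p j)) =
      (indep Γ.N fun j => BGN.encrypt pk (Γ.entry (σ.symm p) j)).map
        fun v j => (B.grp pk.d).repr (v j) := by
    intro p
    rw [indep_map]
    congr 1
    funext j
    rw [BGN.cipher, VGraph.permEntry_of_lt _ _ p.2 j.2]
  simp only [h1, squareLaw, h2, PMF.map_comp]
  rw [← indep_map, PMF.map_comp]
  rfl

theorem map_trapData_trapdoorGen {N : ℕ} (v : Fin N) (q₁ lam k : ℕ) :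
    (trapdoorGen F v (q₁, lam, k)).map (slpI B F π).trapData =
      trapdoorLaw lam (F lam k N) v := by
  rw [trapdoorLaw, dif_pos v.2]
  change ((randBits lam).bind fun s => PMF.pure ((F lam k N v : ℕ), s)).map
    (fun τ : ℕ × ℕ => Data.pair (.num τ.1) (.num τ.2)) = _
  simp only [PMF.map_bind, PMF.pure_map]
  rfl

theorem bind_keyGen {α : Type} (lam : ℕ) (g : BGN.PublicKey B × (ℕ × ℕ × ℕ) → PMF α) :
    (keyGen B lam).bind g = (randBits lam).bind fun k => (BGN.keyGen B lam).bind fun keys =>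
      g (keys.1, (keys.2, (lam, k))) := by
  change ((randBits lam).bind fun k => (BGN.keyGen B lam).bind fun keys =>
    PMF.pure (keys.1, (keys.2, (lam, k)))).bind g = _
  simp only [PMF.bind_bind, PMF.pure_bind]

theorem realQueries_eq (A : CQAdversary) (q₁ lam k N : ℕ) (T : Data) (m : ℕ) (st τs : Data) :
    (slpI B F π).realQueries A lam (q₁, (lam, k)) N T m st τs =
      countdown (fun _ => A.queryStep lam T (trapdoorLaw lam (F lam k N))) m (st, τs) := by
  induction m generalizing st τs with
  | zero => rfl
  | succ m ih =>
    rw [countdown, CQAdversary.queryStep, PMF.bind_bind]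
    change (A.query.run lam (.pair st (.pair T τs))).bind _ = _
    congr 1
    funext o
    rw [PMF.bind_map]
    by_cases h : o.fst.toNat < N
    · rw [← map_trapData_trapdoorGen (B := B) (π := π) ⟨_, h⟩ q₁]
      rw [dif_pos h]
      exact congrArg (PMF.bind _) (funext fun y => ih _ _)
    · rw [trapdoorLaw, dif_neg h, dif_neg h]
      exact congrArg (PMF.bind _) (funext fun y => ih _ _)

/-- The first stage of the adversary sees only the security parameter, so it commutes with the draws
of both keys. -/
theorem real_eq (A : CQAdversary) (lam : ℕ) :
    (slpI B F π).real A lam = (hybrid B A lam (F lam) 0).map Data.toBit := by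
  simp only [hybrid, PMF.map_bind]
  have h1 : (slpI B F π).real A lam = (randBits lam).bind fun k => (BGN.keyGen B lam).bind
      fun keys => (A.start.run lam (.num lam)).bind fun o =>
        ((encMatrix F (VGraph.ofData o.fst) (keys.2, lam, k) keys.1).map (tabData keys.1)).bind
          fun T => (A.finish lam T (trapdoorLaw lam (F lam k o.fst.length)) o.snd).map
            Data.toBit := by
    refine (bind_keyGen lam _).trans ?_
    congr 1
    funext k
    congr 1
    funext keys
    refine congrArg (PMF.bind _) (funext fun o => ?_)
    rw [PMF.bind_map]
    refine congrArg (PMF.bind _) (funext fun tab => ?_)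
    simp only [Function.comp, CQAdversary.finish, PMF.map_bind]
    refine (congrArg (fun μ => PMF.bind μ _) (realQueries_eq A keys.2 lam k _ _ _ _ _)).trans ?_
    rfl
  rw [h1, PMF.bind_comm]
  congr 1
  funext keys
  rw [PMF.bind_comm]
  congr 1
  funext o
  congr 1
  funext k
  rw [map_tabData_encMatrix, PMF.bind_map]
  simp only [Nat.not_lt_zero, if_false]
  rfl

end SLPI

/-! ## Simulating the game -/

section

variable {I : Type} {lam : I → ℕ} {inp : I → Data}

theorem Samples.finish (A : CQAdversary) {T st : I → Data} {τ : I → ℕ → PMF Data}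
    (h0 : Finds lam inp fun i => .num (lam i)) (hT : Finds lam inp T) (hst : Finds lam inp st)
    (hτ : ∀ (J : Type) (i : J → I) (v : J → ℕ) (inp' : J → Data), Refines lam inp i inp' →
      Finds (fun j => lam (i j)) inp' (fun j => .num (v j)) →
      Samples (fun j => lam (i j)) inp' fun j => τ (i j) (v j))
    (hτs : ∃ p : Polynomial ℕ, ∀ i v, ∀ y ∈ (τ i v).support, y.size ≤ p.eval (lam i)) :
    Samples lam inp fun i => A.finish (lam i) (T i) (τ i) (st i) := by
  have hloop : Samples lam inp fun i => (countdown (fun _ => A.queryStep (lam i) (T i) (τ i))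
      (A.queries.eval (lam i)) (st i, .num 0)).map fun w => .pair w.1 w.2 := by
    obtain ⟨b, hb⟩ := hτs
    obtain ⟨S, hS⟩ := hst.polyBounded
    refine Samples.iter (κ := fun i _ => A.queryStep (lam i) (T i) (τ i))
      (enc := fun _ w => Data.pair w.1 w.2) (init := fun i => (st i, .num 0))
      (n := fun i => A.queries.eval (lam i))
      -- The adversary's state does not accumulate: each stage's output is bounded by its clock,
      -- whatever the input. Only the list of answers grows, by at most `b + 1` per query.
      (Inv := fun i k w => k ≤ A.queries.eval (lam i) ∧
        w.1.size ≤ S.eval (lam i) + (A.query.clock.eval (lam i) + 1) ∧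
        w.2.size ≤ (A.queries.eval (lam i) - k) * (b.eval (lam i) + 1) + 1)
      (h0.polyEval _) (.eval _) (hst.pair (h0.const 0)) (fun i => ?_) ?_ ?_ ?_
    · have h1 : (st i).size ≤ _ := hS i
      exact ⟨le_rfl, by simp only; omega, by simp [Data.size]⟩
    · rintro i k ⟨s, l⟩ hk ⟨-, h1, h2⟩ w hw
      simp only [CQAdversary.queryStep, PMF.mem_support_bind_iff, PMF.mem_support_map_iff] at hw
      obtain ⟨o, ho, y, hy, rfl⟩ := hw
      have h3 := PPT.size_run_le _ ho
      have h4 := o.size_snd_le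
      have h5 := hb i _ y hy
      refine ⟨hk.le, by simp only; omega, ?_⟩
      have h6 : A.queries.eval (lam i) - k = A.queries.eval (lam i) - (k + 1) + 1 := by omega
      rw [h6, Nat.add_mul]
      simp only [Data.size] at h2 ⊢
      omega
    · refine ⟨S + (A.query.clock + .C 1) + (A.queries * (b + .C 1) + .C 1) + .C 1, ?_⟩
      rintro i k ⟨s, l⟩ hk ⟨-, h1, h2⟩
      have h3 : (A.queries.eval (lam i) - k) * (b.eval (lam i) + 1) ≤
          A.queries.eval (lam i) * (b.eval (lam i) + 1) :=
        Nat.mul_le_mul_right _ (Nat.sub_le _ _)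
      simp only [Polynomial.eval_add, Polynomial.eval_mul, Polynomial.eval_C, Data.size] at h1 h2 ⊢
      omega
    · intro J i k w inp' _ _ hR _ hw
      simp only [CQAdversary.queryStep, PMF.map_bind, PMF.map_comp]
      have hrun := Samples.run A.query (hw.fst.pair ((hR.finds hT).pair hw.snd)) (hR.finds h0)
      refine Samples.bind (out := fun _ o => o) (hrun.congr fun j => PMF.map_id _)
        fun J' i' o inp'' _ hR' ho => ?_
      have hτ' := hτ J' (fun j => i (i' j)) (fun j => (o j).fst.toNat) inp''
        (fun μ hμ => hR' _ (hR _ hμ)) ho.fst.toNat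
      refine Samples.map (out := fun _ y => y) (hτ'.congr fun j => PMF.map_id _)
        fun J'' i'' y inp''' _ hR'' hy => ?_
      exact (hR''.finds ho.snd).pair (hy.pair (hR''.finds (hR'.finds hw.snd)))
  refine Samples.bind hloop fun J i w inp' _ hR hw => ?_
  exact Samples.run A.guess (hw.fst.pair ((hR.finds hT).pair hw.snd)) (hR.finds h0)

theorem size_trapdoorLaw_le {n N : ℕ} {σ : Equiv.Perm (Fin N)} {v : ℕ} {y : Data}
    (h : y ∈ (trapdoorLaw n σ v).support) : y.size ≤ N + n + 3 := by
  unfold trapdoorLaw at h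
  split_ifs at h with hv
  · obtain ⟨s, hs, rfl⟩ := (PMF.mem_support_map_iff _ _ _).1 h
    have h1 := Nat.size_le.2 (lt_of_mem_randBits hs)
    have h2 := Nat.size_le_self (σ ⟨v, hv⟩)
    have h3 := (σ ⟨v, hv⟩).2
    simp only [Data.size]
    omega
  · rw [(PMF.mem_support_pure_iff _ _).1 h]
    simp [Data.size]

variable {F : PermFamily} {k : I → ℕ}

theorem Samples.trapdoor (hF : F.Efficient) {N v : I → ℕ}
    (h0 : Finds lam inp fun i => .num (lam i)) (hk : Finds lam inp fun i => .num (k i))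
    (hN : Finds lam inp fun i => .num (N i)) (hv : Finds lam inp fun i => .num (v i))
    (hlt : ∀ i, k i < 2 ^ lam i) (hb : PolyBounded lam N) :
    Samples lam inp fun i => trapdoorLaw (lam i) (F (lam i) (k i) (N i)) (v i) := by
  refine Samples.ite (hv.lt hN) (fun J i h hR => ?_) fun J i h hR => ?_
  · have h' : ∀ j, v (i j) < N (i j) := fun j => by simpa using h j
    have h1 := Finds.perm hF (x := fun j => (⟨v (i j), h' j⟩ : Fin (N (i j)))) (hR.finds h0)
      (hR.finds hk) (hR.finds hN) (hR.finds hv) (fun j => hlt (i j)) (hb.comp i)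
    refine (Samples.map (Samples.randBits (hR.finds h0)) (g := fun j s => Data.pair
      (.num (F (lam (i j)) (k (i j)) (N (i j)) ⟨v (i j), h' j⟩)) (.num s))
      fun J' i' s inp' _ hR' hs => (hR'.finds h1).pair hs).congr fun j => ?_
    rw [trapdoorLaw, dif_pos (h' j)]
  · refine Samples.congr ((hR.finds h0).const 0) fun j => ?_
    rw [trapdoorLaw, dif_neg]
    simpa using h j

theorem Finds.permEntry (hF : F.Efficient) {x : I → Data} {p q : I → ℕ}
    (h0 : Finds lam inp fun i => .num (lam i)) (hk : Finds lam inp fun i => .num (k i))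
    (hx : Finds lam inp x) (hp : Finds lam inp fun i => .num (p i))
    (hq : Finds lam inp fun i => .num (q i)) (hlt : ∀ i, k i < 2 ^ lam i) :
    Finds lam inp fun i => .num ((VGraph.ofData (x i)).permEntry
      (F (lam i) (k i) (x i).length) (p i) (q i)) := by
  have hN := hx.length h0
  have hb : PolyBounded lam fun i => (x i).length :=
    hx.polyBounded.mono fun i => (x i).length_le_size
  -- The product of two indicators serves as conjunction.
  refine Samples.ite ((hp.lt hN).mul (hq.lt hN)) (fun J i h hR => ?_) fun J i h hR => ?_
  · have hpN : ∀ j, p (i j) < (x (i j)).length := fun j => by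
      have := left_ne_zero_of_mul (h j)
      simpa using this
    have hqN : ∀ j, q (i j) < (x (i j)).length := fun j => by
      have := right_ne_zero_of_mul (h j)
      simpa using this
    have hsymm := Finds.perm_symm hF (x := fun j => (⟨p (i j), hpN j⟩ : Fin (x (i j)).length))
      (hR.finds h0) (hR.finds hk) (hR.finds hN) (hR.finds hp) (fun j => hlt (i j)) (hb.comp i)
    have hrow := (hR.finds hx).nth hsymm ((hb.comp i).mono fun j => Fin.is_le')
    have hent := (hrow.nth (hR.finds hq) ((hb.comp i).mono fun j => (hqN j).le)).toNat
    -- Any nonzero number stands for an edge; `1 - [m = 0]` is the corresponding bit.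
    refine (((hent.const 1).sub (hent.eq (hent.const 0)))).congr fun j => ?_
    refine congrArg Data.num ((VGraph.permEntry_of_lt _ _ (hpN j) (hqN j)).trans ?_)
    simp only [VGraph.entry, VGraph.ofData]
    generalize Data.toNat _ = m
    by_cases hm : m = 0 <;> simp [hm]
  · refine ((hR.finds h0).const 0).congr fun j => ?_
    refine congrArg Data.num (VGraph.permEntry_of_not_lt _ _ ?_)
    rintro ⟨h1, h2⟩
    have h1' : p (i j) < (x (i j)).length := h1
    have h2' : q (i j) < (x (i j)).length := h2
    have := h j
    simp [h1', h2'] at this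

end

/-! ## Replacing the ciphertexts -/

section

variable (B : BilinearGenerator) (F : PermFamily) (A : CQAdversary) (Q : Polynomial ℕ)

/-- What the reduction submits as challenge, and keeps as state. -/
noncomputable def challengeLaw (lam : ℕ) (pk : BGN.PublicKey B) : PMF Data :=
  (A.start.run lam (.num lam)).bind fun o => (randBelow (Q.eval lam)).bind fun e =>
    (randBits lam).map fun k =>
      .pair (.num ((VGraph.ofData o.fst).permEntry (F lam k o.fst.length) (e / o.fst.length)
        (e % o.fst.length)))
        (.pair (.num 0) (.pair pk.data (.pair o (.pair (.num e) (.num k)))))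

/-- The game with the challenge `c` as ciphertext number `e`. -/
noncomputable def embedLaw (lam : ℕ) (pk : BGN.PublicKey B) (o : Data) (e k : ℕ) (c : Data) :
    PMF Data :=
  (squareLaw o.fst.length fun p j => if p * o.fst.length + j = e then PMF.pure c else
    BGN.cipher pk (if p * o.fst.length + j < e then 0
      else (VGraph.ofData o.fst).permEntry (F lam k o.fst.length) p j)).bind fun rows =>
    A.finish lam (.pair pk.data rows) (trapdoorLaw lam (F lam k o.fst.length)) o.snd

theorem polyBounded_start {I : Type} {lam : I → ℕ} {o : I → Data}
    (ho : ∀ i, o i ∈ (A.start.run (lam i) (.num (lam i))).support) :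
    PolyBounded lam fun i => (o i).size :=
  ((PolyBounded.eval A.start.clock).add (.const 1)).mono fun i => PPT.size_run_le _ (ho i)

theorem polyBounded_publicKey {I : Type} {lam : I → ℕ} {keys : I → BGN.PublicKey B × ℕ}
    (h : ∀ i, keys i ∈ (BGN.keyGen B (lam i)).support) :
    PolyBounded lam fun i => (keys i).1.data.size := by
  have hid : Finds (I := ℕ) (fun n => n) (fun n => .num n) fun n => .num n := by
    refine Finds.id ((PolyBounded.self.add (.const 1)).mono fun n => ?_)
    have := Nat.size_le_self n
    simp only [Data.size]
    omega
  obtain ⟨p, hp⟩ := (Samples.publicKey (B := B) hid).exists_size_le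
  exact ⟨p, fun i => hp (lam i) _ (PMF.mem_support_map (f := fun keys => keys.1.data) (h i))⟩

theorem polyBounded_size_num {I : Type} {lam f : I → ℕ} (h : PolyBounded lam f) :
    PolyBounded lam fun i => (Data.num (f i)).size :=
  (h.add (.const 1)).mono fun i => by
    have := Nat.size_le_self (f i)
    simp only [Data.size]
    omega

theorem polyBounded_size_pair {I : Type} {lam : I → ℕ} {f g : I → Data}
    (hf : PolyBounded lam fun i => (f i).size) (hg : PolyBounded lam fun i => (g i).size) :
    PolyBounded lam fun i => (Data.pair (f i) (g i)).size :=
  ((hf.add hg).add (.const 1)).mono fun _ => le_rfl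

theorem polyBounded_randBits {I : Type} {lam k : I → ℕ}
    (h : ∀ i, k i ∈ (randBits (lam i)).support) :
    PolyBounded lam fun i => (Data.num (k i)).size :=
  (PolyBounded.self.add (.const 1)).mono fun i => by
    have := Nat.size_le.2 (lt_of_mem_randBits (h i))
    simp only [Data.size]
    omega

variable {B F}

/-- The machine is specified only on public keys that can occur, because only for these is the input
known to be polynomially long. -/
theorem exists_challenger (hF : F.Efficient) :
    ∃ M : PPT, ∀ lam, ∀ keys ∈ (BGN.keyGen B lam).support,
      M.run lam (.pair (.num lam) keys.1.data) = challengeLaw B F A Q lam keys.1 := by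
  let I := {x : ℕ × BGN.PublicKey B × ℕ // x.2 ∈ (BGN.keyGen B x.1).support}
  let lam : I → ℕ := fun i => i.1.1
  have hin : Finds lam (fun i => .pair (.num (lam i)) i.1.2.1.data)
      fun i => .pair (.num (lam i)) i.1.2.1.data :=
    Finds.id (polyBounded_size_pair (polyBounded_size_num .self)
      (polyBounded_publicKey B fun i => i.2))
  have h0 := hin.fst
  have hpk := hin.snd
  have key : Samples lam (fun i => .pair (.num (lam i)) i.1.2.1.data) fun i =>
      challengeLaw B F A Q (lam i) i.1.2.1 := by
    refine Samples.bind (out := fun _ o => o) ((Samples.run A.start h0 h0).congr fun j =>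
      PMF.map_id _) fun J i o inp₁ _ hR₁ ho => ?_
    refine Samples.bind (Samples.rand (hR₁.finds (h0.polyEval Q))) fun J' i' e inp₂ _ hR₂ he => ?_
    refine Samples.map (Samples.randBits (hR₂.finds (hR₁.finds h0)))
      fun J'' i'' k inp₃ hk' hR₃ hk => ?_
    have h0' := hR₃.finds (hR₂.finds (hR₁.finds h0))
    have hpk' := hR₃.finds (hR₂.finds (hR₁.finds hpk))
    have ho' := hR₃.finds (hR₂.finds ho)
    have he' := hR₃.finds he
    have hN := ho'.fst.length h0'
    have hent := Finds.permEntry hF h0' hk ho'.fst (he'.div hN) (he'.mod hN)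
      fun j => lt_of_mem_randBits (hk' j)
    exact hent.pair ((h0'.const 0).pair (hpk'.pair (ho'.pair (he'.pair hk))))
  obtain ⟨M, hM⟩ := PPT.exists_run_eq key
  exact ⟨M, fun lam keys h => hM ⟨(lam, keys), h⟩⟩

theorem exists_embedder (hF : F.Efficient) :
    ∃ M : PPT, ∀ lam, ∀ keys ∈ (BGN.keyGen B lam).support,
      ∀ o ∈ (A.start.run lam (.num lam)).support, ∀ e ∈ (randBelow (Q.eval lam)).support,
      ∀ k ∈ (randBits lam).support, ∀ c : (B.grp keys.1.d).G,
      M.run lam (.pair (.pair keys.1.data (.pair o (.pair (.num e) (.num k))))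
        ((B.grp keys.1.d).repr c)) =
      embedLaw B F A lam keys.1 o e k ((B.grp keys.1.d).repr c) := by
  obtain ⟨P, hP⟩ := B.exists_size_repr_le
  -- The index set consists of all states that the first stage can leave, together with challenges
  -- no longer than a group element. These conditions bound the input and make the key valid.
  let I := {x : ℕ × (BGN.PublicKey B × ℕ) × Data × ℕ × ℕ × Data //
    x.2.1 ∈ (BGN.keyGen B x.1).support ∧
    x.2.2.1 ∈ (A.start.run x.1 (.num x.1)).support ∧
    x.2.2.2.1 ∈ (randBelow (Q.eval x.1)).support ∧ x.2.2.2.2.1 ∈ (randBits x.1).support ∧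
    x.2.2.2.2.2.size ≤ P.eval x.1}
  let lam : I → ℕ := fun i => i.1.1
  let pk : I → BGN.PublicKey B := fun i => i.1.2.1.1
  let o : I → Data := fun i => i.1.2.2.1
  let e : I → ℕ := fun i => i.1.2.2.2.1
  let k : I → ℕ := fun i => i.1.2.2.2.2.1
  let c : I → Data := fun i => i.1.2.2.2.2.2
  let inp : I → Data := fun i =>
    .pair (.pair (pk i).data (.pair (o i) (.pair (.num (e i)) (.num (k i))))) (c i)
  have hin : Finds lam inp inp := by
    refine Finds.id (polyBounded_size_pair (polyBounded_size_pair
      (polyBounded_publicKey B fun i => i.2.1) (polyBounded_size_pair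
        (polyBounded_start A fun i => i.2.2.1) (polyBounded_size_pair
          (polyBounded_size_num ?_) (polyBounded_randBits fun i => i.2.2.2.2.1))))
      ⟨P, fun i => i.2.2.2.2.2⟩)
    exact (PolyBounded.eval Q).mono fun i => Prog.size_randBelow i.2.2.2.1
  have hvalid : ∀ i, (pk i).Valid (lam i) := fun i => BGN.valid_of_mem_keyGen i.2.1
  have hklt : ∀ i, k i < 2 ^ lam i := fun i => lt_of_mem_randBits i.2.2.2.2.1
  have hpk : Finds lam inp fun i => (pk i).data := hin.fst.fst
  have h0 : Finds lam inp fun i => .num (lam i) :=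
    hpk.fst.congr fun i => by rw [← (hvalid i).1]; rfl
  have ho : Finds lam inp o := hin.fst.snd.fst
  have he : Finds lam inp fun i => .num (e i) := hin.fst.snd.snd.fst
  have hk : Finds lam inp fun i => .num (k i) := hin.fst.snd.snd.snd
  have hc : Finds lam inp c := hin.snd
  have hN : Finds lam inp fun i => .num (o i).fst.length := ho.fst.length h0
  have hb : PolyBounded lam fun i => (o i).fst.length :=
    ho.fst.polyBounded.mono fun i => Data.length_le_size _
  have key : Samples lam inp fun i =>
      embedLaw B F A (lam i) (pk i) (o i) (e i) (k i) (c i) := by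
    refine Samples.bind (out := fun _ r => r) ((Samples.square hN hb ?_).congr fun i =>
      PMF.map_id _) ?_
    · intro J i p q inp' hp hq hR hp' hq'
      have hpos := (hp'.mul (hR.finds hN)).add hq'
      refine Samples.ite (hpos.eq (hR.finds he)) (fun J' i' h hR' => ?_) fun J' i' h hR' => ?_
      · refine Samples.congr (hR'.finds (hR.finds hc)) fun j => ?_
        rw [if_pos (by simpa using h j)]
      · have hent := Finds.permEntry hF (hR.finds h0) (hR.finds hk) (hR.finds ho.fst) hp' hq'
          fun j => hklt (i j)
        have ha := Finds.ite (p := fun j => p j * (o (i j)).fst.length + q j < e (i j))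
          (hpos.lt (hR.finds he)) (fun j => by simp) (hpos.const 0) hent
        refine (Samples.cipher (B := B) (pk := fun j => pk (i (i' j)))
          (a := fun j => if p (i' j) * (o (i (i' j))).fst.length + q (i' j) < e (i (i' j)) then 0
            else (VGraph.ofData (o (i (i' j))).fst).permEntry
              (F (lam (i (i' j))) (k (i (i' j))) (o (i (i' j))).fst.length) (p (i' j)) (q (i' j)))
          (fun j => hvalid _) (hR'.finds (hR.finds hpk))
          ((hR'.finds ha).congr fun j => ?_) fun j => ?_).congr fun j => ?_
        · split_ifs <;> rfl
        · split_ifs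
          · exact zero_le_one
          · exact VGraph.permEntry_le_one _ _ _ _
        · rw [if_neg (by simpa using h j)]
    · intro J i rows inp' _ hR hrows
      refine Samples.finish A (hR.finds h0) ((hR.finds hpk).pair hrows) (hR.finds ho.snd) ?_ ?_
      · intro J' i' v inp'' hR' hv
        exact Samples.trapdoor hF (hR'.finds (hR.finds h0)) (hR'.finds (hR.finds hk))
          (hR'.finds (hR.finds hN)) hv (fun j => hklt _) (hb.comp _)
      · obtain ⟨q, hq⟩ := hb
        refine ⟨q + .X + .C 3, fun j v y hy => (size_trapdoorLaw_le hy).trans ?_⟩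
        have : (o (i j)).fst.length ≤ _ := hq (i j)
        simp only [Polynomial.eval_add, Polynomial.eval_X, Polynomial.eval_C]
        omega
  obtain ⟨M, hM⟩ := PPT.exists_run_eq key
  exact ⟨M, fun lam keys hkeys o ho e he k hk c => hM ⟨(lam, keys, o, e, k,
    (B.grp keys.1.d).repr c), hkeys, ho, he, hk, hP _ _ (BGN.valid_of_mem_keyGen hkeys).2 _⟩⟩

/-- The reduction draws `e` and `k` itself and submits the entry of cell `e` and `0`. With the first
plaintext in cell `e` the table is that of hybrid `e`, with the second that of hybrid `e + 1`. If
`e` lies beyond the matrix, `permEntry` is `0`, the two plaintexts agree, and so do the two hybrids.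
-/
theorem exists_reduction (hF : F.Efficient) : ∃ D : BGN.Adversary, ∀ b lam,
    BGN.experiment B D b lam = (randBelow (Q.eval lam)).bind fun e =>
      (hybrid B A lam (F lam) (e + b.toNat)).map Data.toBit := by
  obtain ⟨M₁, h₁⟩ := exists_challenger (B := B) A Q hF
  obtain ⟨M₂, h₂⟩ := exists_embedder (B := B) A Q hF
  refine ⟨⟨M₁, M₂⟩, fun b lam => ?_⟩
  have hexp : BGN.experiment B ⟨M₁, M₂⟩ b lam = (BGN.keyGen B lam).bind fun keys =>
      (M₁.run lam (.pair (.num lam) keys.1.data)).bind fun o =>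
        (BGN.encrypt keys.1 (if b then o.snd.fst.toNat else o.fst.toNat)).bind fun c =>
          (M₂.run lam (.pair o.snd.snd ((B.grp keys.1.d).repr c))).map Data.toBit := rfl
  simp only [hexp, hybrid, PMF.map_bind]
  rw [PMF.bind_comm]
  refine PMF.bind_congr_support _ fun keys hkeys => ?_
  rw [PMF.bind_comm, h₁ lam keys hkeys, challengeLaw, PMF.bind_bind]
  refine PMF.bind_congr_support _ fun o ho => ?_
  rw [PMF.bind_bind]
  refine PMF.bind_congr_support _ fun e he => ?_
  rw [PMF.bind_map]
  refine PMF.bind_congr_support _ fun k hk => ?_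
  simp only [Function.comp, Data.fst_pair, Data.snd_pair, Data.toNat_num,
    h₂ lam keys hkeys o ho e he k hk]
  set N := o.fst.length with hN
  set m := (VGraph.ofData o.fst).permEntry (F lam k N) with hm
  have hc : ((BGN.encrypt keys.1 (if b then 0 else m (e / N) (e % N))).bind fun c =>
      (embedLaw B F A lam keys.1 o e k ((B.grp keys.1.d).repr c)).map Data.toBit) =
      ((BGN.cipher keys.1 (if b then 0 else m (e / N) (e % N))).bind
        (embedLaw B F A lam keys.1 o e k)).map Data.toBit := by
    rw [BGN.cipher, PMF.bind_map, PMF.map_bind]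
    rfl
  refine hc.trans ?_
  rw [← PMF.map_bind]
  congr 1
  unfold embedLaw
  -- The challenge, encrypted before the table is built, becomes a cell encrypted along with the
  -- others.
  rw [← PMF.bind_bind, squareLaw_bind_ite]
  congr 1
  refine squareLaw_congr fun p hp j hj => ?_
  by_cases h1 : p * o.fst.length + j = e
  · have hp' : e / N = p := by
      rw [← h1, Nat.add_comm, Nat.add_mul_div_right _ _ (by omega), Nat.div_eq_of_lt hj,
        Nat.zero_add]
    have hj' : e % N = j := by
      rw [← h1, Nat.add_comm, Nat.add_mul_mod_self_right, Nat.mod_eq_of_lt hj]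
    rw [if_pos h1, hp', hj', h1]
    cases b <;> simp [hm]
  · have h2 : p * o.fst.length + j < e ↔ p * o.fst.length + j < e + b.toNat := by
      cases b <;> simp
      omega
    rw [if_neg h1]
    simp only [h2]
    rfl

end

/-! ## Negligible functions and advantages -/

theorem Negligible.mono {f g : ℕ → ℝ} (hg : Negligible g) (h : ∀ n, f n ≤ g n) :
    Negligible f := fun c =>
  let ⟨N, hN⟩ := hg c
  ⟨N, fun n hn => (h n).trans_lt (hN n hn)⟩

theorem Negligible.add {f g : ℕ → ℝ} (hf : Negligible f) (hg : Negligible g) :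
    Negligible fun n => f n + g n := by
  intro c
  obtain ⟨N₁, h₁⟩ := hf (c + 1)
  obtain ⟨N₂, h₂⟩ := hg (c + 1)
  -- From `2` on, one additional power of `n` absorbs the factor `2` of the sum.
  refine ⟨max 2 (max N₁ N₂), fun n hn => ?_⟩
  simp only [gt_iff_lt, max_lt_iff] at hn
  obtain ⟨hn, hn₁, hn₂⟩ := hn
  have hn' : (2 : ℝ) ≤ n := by exact_mod_cast hn.le
  have hpos : (0 : ℝ) < (n : ℝ) ^ c := by positivity
  have h : 1 / (n : ℝ) ^ (c + 1) ≤ 1 / (n : ℝ) ^ c / 2 := by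
    rw [div_div]
    refine one_div_le_one_div_of_le (by positivity) ?_
    rw [pow_succ]
    exact mul_le_mul_of_nonneg_left hn' hpos.le
  have := h₁ n hn₁
  have := h₂ n hn₂
  linarith

theorem Polynomial.eval_le_pow (q : Polynomial ℕ) {n : ℕ} (hn : 1 ≤ n) :
    q.eval n ≤ q.eval 1 * n ^ q.natDegree := by
  rw [Polynomial.eval_eq_sum_range, Polynomial.eval_eq_sum_range, Finset.sum_mul]
  refine Finset.sum_le_sum fun i hi => ?_
  rw [one_pow, mul_one]
  exact Nat.mul_le_mul_left _ (Nat.pow_le_pow_right hn (by simpa [Nat.lt_succ_iff] using hi))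

theorem Negligible.poly_mul {f : ℕ → ℝ} (hf : Negligible f) (h0 : ∀ n, 0 ≤ f n)
    (q : Polynomial ℕ) : Negligible fun n => ((q.eval n : ℕ) : ℝ) * f n := by
  intro c
  obtain ⟨N, hN⟩ := hf (c + (q.natDegree + 1))
  -- Beyond `q.eval 1`, the sum of the coefficients, one additional power of `n` absorbs the
  -- constant, so `q` is at most `n ^ (q.natDegree + 1)`.
  refine ⟨max (q.eval 1) N, fun n hn => ?_⟩
  simp only [gt_iff_lt, max_lt_iff] at hn
  obtain ⟨hn₁, hn₂⟩ := hn
  have hpos : 1 ≤ n := by omega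
  have hn0 : (0 : ℝ) < n := by exact_mod_cast hpos
  have h1 : q.eval n ≤ n ^ (q.natDegree + 1) := by
    refine (q.eval_le_pow hpos).trans ?_
    rw [pow_succ, Nat.mul_comm]
    exact Nat.mul_le_mul_left _ hn₁.le
  have h2 : ((q.eval n : ℕ) : ℝ) ≤ (n : ℝ) ^ (q.natDegree + 1) := by exact_mod_cast h1
  calc ((q.eval n : ℕ) : ℝ) * f n ≤ (n : ℝ) ^ (q.natDegree + 1) * f n :=
        mul_le_mul_of_nonneg_right h2 (h0 n)
    _ < (n : ℝ) ^ (q.natDegree + 1) * (1 / (n : ℝ) ^ (c + (q.natDegree + 1))) :=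
        mul_lt_mul_of_pos_left (hN n hn₂) (by positivity)
    _ = 1 / (n : ℝ) ^ c := by
        field_simp
        ring

theorem advantage_nonneg (μ ν : PMF Bool) : 0 ≤ advantage μ ν :=
  abs_nonneg _

theorem advantage_triangle (μ ν ρ : PMF Bool) :
    advantage μ ρ ≤ advantage μ ν + advantage ν ρ :=
  abs_sub_le _ _ _

theorem toReal_randBelow_bind {α : Type} {n : ℕ} (hn : 0 < n) (f : ℕ → PMF α) (a : α) :
    ((randBelow n).bind f a).toReal = (∑ e ∈ Finset.range n, (f e a).toReal) / n := by
  obtain ⟨n, rfl⟩ : ∃ m, n = m + 1 := ⟨n - 1, by omega⟩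
  rw [randBelow, PMF.bind_map, PMF.bind_apply, tsum_fintype, ENNReal.toReal_sum]
  · rw [Finset.sum_range, Finset.sum_div]
    refine Finset.sum_congr rfl fun i _ => ?_
    rw [ENNReal.toReal_mul, PMF.uniformOfFintype_apply, ENNReal.toReal_inv]
    simp only [Fintype.card_fin, ENNReal.toReal_natCast, Function.comp]
    rw [mul_comm, div_eq_mul_inv]
  · intro i _
    exact ENNReal.mul_ne_top (PMF.apply_ne_top _ _) (PMF.apply_ne_top _ _)

/-- The advantage in guessing a uniformly chosen hybrid. -/
theorem advantage_hybrids {n : ℕ} (hn : 0 < n) (f : ℕ → PMF Bool) :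
    advantage (f 0) (f n) = n * advantage ((randBelow n).bind fun e => f e)
      ((randBelow n).bind fun e => f (e + 1)) := by
  have hn' : (0 : ℝ) < n := by exact_mod_cast hn
  unfold advantage
  -- The two averages are subtracted before the absolute value is taken, so the sum telescopes and
  -- the relation is an equality.
  rw [toReal_randBelow_bind hn, toReal_randBelow_bind hn, ← sub_div, ← Finset.sum_sub_distrib,
    Finset.sum_range_sub' (fun e => (f e true).toReal), abs_div, Nat.abs_cast,
    mul_div_cancel₀ _ hn'.ne']

theorem length_start_le (A : CQAdversary) {n : ℕ} {o : Data}
    (ho : o ∈ (A.start.run n (.num n)).support) : o.fst.length ≤ A.start.clock.eval n + 1 :=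
  o.fst.length_le_size.trans (o.size_fst_le.trans (PPT.size_run_le _ ho))

theorem negligible_hybrid_zeroGame {B : BilinearGenerator} {F : PermFamily}
    (hB : BGN.SemanticallySecure B) (hF : F.Efficient) (A : CQAdversary) :
    Negligible fun lam => advantage ((hybrid B A lam (F lam) 0).map Data.toBit)
      ((zeroGame B A lam fun N => (randBits lam).map fun k => F lam k N).map Data.toBit) := by
  -- `N` is at most the size of what the first stage outputs, so `Q` bounds the number of cells.
  let Q : Polynomial ℕ := (A.start.clock + .C 1) * (A.start.clock + .C 1)
  have hQ : ∀ lam, Q.eval lam = (A.start.clock.eval lam + 1) * (A.start.clock.eval lam + 1) :=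
    fun lam => by simp [Q]
  obtain ⟨D, hD⟩ := exists_reduction (B := B) A Q hF
  refine ((hB D).poly_mul (fun _ => advantage_nonneg _ _) Q).mono fun lam => le_of_eq ?_
  rw [← hybrid_eq_zeroGame B A (F lam) (e := Q.eval lam), hD, hD,
    advantage_hybrids (by rw [hQ]; positivity)
      fun e => (hybrid B A lam (F lam) e).map Data.toBit]
  · rfl
  · intro o ho
    rw [hQ]
    exact Nat.mul_le_mul (length_start_le A ho) (length_start_le A ho)

/-! ## The simulator that is given the trapdoors -/

section

variable {I : Type} {lam : I → ℕ} {inp : I → Data}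

theorem Samples.zeroTable {B : BilinearGenerator} {N : I → ℕ}
    (h0 : Finds lam inp fun i => .num (lam i)) (hN : Finds lam inp fun i => .num (N i))
    (hb : PolyBounded lam N) : Samples lam inp fun i => _root_.zeroTable B (lam i) (N i) := by
  refine Samples.bind (Samples.publicKey h0) fun J i keys inp₁ hkeys hR hpk => ?_
  refine Samples.pair hpk (Samples.square (hR.finds hN) (hb.comp i) ?_)
  intro J' i' p q inp₂ _ _ hR' hp _
  exact Samples.cipher (pk := fun j => (keys (i' j)).1) (a := fun _ => 0)
    (fun j => BGN.valid_of_mem_keyGen (hkeys (i' j))) (hR'.finds hpk) (hp.const 0)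
    fun _ => zero_le_one

end

theorem finds_of_size_le (R : Polynomial ℕ) :
    Finds (I := {x : ℕ × Data // x.2.size ≤ R.eval x.1}) (fun i => i.1.1) (fun i => i.1.2)
      fun i => i.1.2 :=
  Finds.id ⟨R, fun i => i.2⟩

theorem SLPI.bind_qry {B : BilinearGenerator} {F π : PermFamily} {α : Type} {N : ℕ} (v : Fin N)
    (q₁ lam k : ℕ) (g : Data × (ℕ × (ℕ × ℕ)) → PMF α) :
    PMF.bind ((slpI B F π).trapdoorLeakage.qry (q₁, (lam, k)) v) g =
      (trapdoorLaw lam (F lam k N) v).bind fun y => g (y, (q₁, (lam, k))) := by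
  rw [← map_trapData_trapdoorGen (B := B) (π := π) v q₁]
  change ((trapdoorGen F v (q₁, lam, k)).map _).bind g = _
  refine (PMF.bind_map _ _ _).trans ?_
  exact (PMF.bind_map (trapdoorGen F v (q₁, lam, k)) (slpI B F π).trapData
    fun y => g (y, (q₁, (lam, k)))).symm

theorem SLPI.bind_bld {B : BilinearGenerator} {F π : PermFamily} {α : Type} (lam : ℕ) (Γ : VGraph)
    (g : Data × (ℕ × (ℕ × ℕ)) → PMF α) :
    PMF.bind ((slpI B F π).trapdoorLeakage.bld lam Γ) g = (randBits lam).bind fun k =>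
      (BGN.keyGen B lam).bind fun keys => g (.num Γ.N, (keys.2, (lam, k))) := by
  change PMF.bind ((keyGen B lam).map fun keys => (Data.num Γ.N, keys.2)) g = _
  rw [PMF.bind_map]
  exact bind_keyGen lam _

/-- The simulator repeats the latest leakage. The list of leakages grows by at most `N + lam + 4`
per query, a trapdoor and the pair around it, which keeps the simulator's inputs within the range
`R` where it is specified. -/
theorem SLPI.idealQueries_eq {B : BilinearGenerator} {F π : PermFamily} (A : CQAdversary)
    (S : CQSimulator) {lam R : ℕ}
    (hS : ∀ l leaks : Data, l.size + leaks.size ≤ R →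
      S.answer.run lam (.pair (.num 0) (.pair l leaks)) = PMF.pure (.pair l (.num 0)))
    (q₁ k : ℕ) {N : ℕ} (T : Data) (m : ℕ) :
    ∀ (st τs leaks : Data), leaks.size + m * (N + lam + 4) ≤ R →
      (slpI B F π).trapdoorLeakage.idealQueries A S lam (N := N) T m st τs (q₁, (lam, k)) leaks
        (.num 0) =
      countdown (fun _ => A.queryStep lam T (trapdoorLaw lam (F lam k N))) m (st, τs) := by
  induction m with
  | zero => intros; rfl
  | succ m ih =>
    intro st τs leaks hl
    rw [Nat.add_mul] at hl
    rw [countdown, CQAdversary.queryStep, PMF.bind_bind]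
    refine congrArg (PMF.bind _) (funext fun o => ?_)
    rw [PMF.bind_map]
    by_cases h : o.fst.toNat < N
    · rw [dif_pos h]
      refine (bind_qry _ q₁ lam k _).trans (PMF.bind_congr_support _ fun y hy => ?_)
      have hy' := size_trapdoorLaw_le hy
      refine (congrArg (fun μ => PMF.bind μ _) (hS y leaks (by omega))).trans ?_
      refine (PMF.pure_bind _ _).trans (ih _ _ _ ?_)
      simp only [Data.size]
      omega
    · rw [dif_neg h, trapdoorLaw, dif_neg h]
      refine Eq.trans ?_ (PMF.pure_bind _ _).symm
      exact ih _ _ _ (by omega)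

/-- A trapdoor depends on the leakage algorithm's secret key only through `k`. The BGN key drawn
there has no effect on the adversary's view and can be dropped; the simulator generates its own. -/
theorem SLPI.exists_simulator (B : BilinearGenerator) (F π : PermFamily) (A : CQAdversary) :
    ∃ S : CQSimulator, ∀ lam, (slpI B F π).trapdoorLeakage.ideal A S lam =
      (zeroGame B A lam fun N => (randBits lam).map fun k => F lam k N).map Data.toBit := by
  obtain ⟨S₁, h₁⟩ : ∃ M : PPT, ∀ lam N, N ≤ A.start.clock.eval lam + 1 →
      M.run lam (.pair (.num lam) (.num N)) =
        (zeroTable B lam N).map fun T => .pair T (.num 0) := by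
    let I := {x : ℕ × ℕ // x.2 ≤ A.start.clock.eval x.1 + 1}
    have hb : PolyBounded (I := I) (fun i => i.1.1) fun i => i.1.2 :=
      ((PolyBounded.eval A.start.clock).add (.const 1)).mono fun i => i.2
    have hin := Finds.id (I := I) (lam := fun i => i.1.1)
      (inp := fun i => .pair (.num i.1.1) (.num i.1.2))
      (polyBounded_size_pair (polyBounded_size_num .self) (polyBounded_size_num hb))
    obtain ⟨M, hM⟩ := PPT.exists_run_eq (Samples.map (out := fun _ T => T)
      (g := fun _ T => .pair T (.num 0)) ((Samples.zeroTable (B := B) hin.fst hin.snd hb).congr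
        fun i => PMF.map_id _) fun J i T inp' _ _ hT => hT.pair (hT.const 0))
    exact ⟨M, fun lam N h => hM ⟨(lam, N), h⟩⟩
  -- Since `N` is at most the clock plus `1`, a query lengthens the list by at most the expression
  -- in brackets; the last `1` is the empty list. The `3` added below accounts for the simulator's
  -- state `num 0` and two pairs.
  let R : Polynomial ℕ := A.queries * (A.start.clock + .X + .C 5) + .C 1
  obtain ⟨S₂, h₂⟩ : ∃ M : PPT, ∀ lam x, x.size ≤ (R + .C 3).eval lam →
      M.run lam x = PMF.pure (.pair x.snd.fst (.num 0)) := by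
    have hin := finds_of_size_le (R + .C 3)
    obtain ⟨M, hM⟩ := PPT.exists_run_eq (hin.snd.fst.pair (hin.const 0))
    exact ⟨M, fun lam x h => hM ⟨(lam, x), h⟩⟩
  refine ⟨⟨S₁, S₂⟩, fun lam => ?_⟩
  rw [zeroGame, PMF.map_bind]
  refine PMF.bind_congr_support _ fun o ho => ?_
  have hN := length_start_le A ho
  refine (bind_bld lam _ _).trans ?_
  simp only [PMF.map_bind, PMF.bind_map]
  rw [PMF.bind_comm (zeroTable B lam o.fst.length)]
  congr 1
  funext k
  -- The leakage algorithm's BGN key no longer occurs, so its draw is removed.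
  refine (congrArg (PMF.bind _) (funext fun keys => ?_)).trans (PMF.bind_const (BGN.keyGen B lam) _)
  refine (congrArg (fun μ => PMF.bind μ _) (h₁ lam _ hN)).trans ?_
  rw [PMF.bind_map]
  congr 1
  funext T
  simp only [Function.comp, CQAdversary.finish, PMF.map_bind]
  refine (congrArg (fun μ => PMF.bind μ _) (idealQueries_eq A ⟨S₁, S₂⟩ (R := R.eval lam) ?_ keys.2 k
    (N := o.fst.length) T _ _ _ _ ?_)).trans ?_
  · intro l leaks hl
    refine h₂ _ _ ?_
    simp only [Data.size, Polynomial.eval_add, Polynomial.eval_C] at hl ⊢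
    simp
    omega
  · have : A.queries.eval lam * (o.fst.length + lam + 4) ≤
        A.queries.eval lam * (A.start.clock.eval lam + lam + 5) :=
      Nat.mul_le_mul_left _ (by omega)
    simp only [R, Data.size, Polynomial.eval_add, Polynomial.eval_mul, Polynomial.eval_C,
      Polynomial.eval_X]
    simp
    omega
  · rfl

/-! ## The distinguisher for permutations -/

/-- The list of trapdoors after the answer to the pending request, if there is one.  A pending
request is recorded by its validity and the seed of its trapdoor. -/
def absorb (pending ans τs : Data) : Data :=
  if pending.isPair = true then
    if pending.fst.toNat ≠ 0 then .pair (.pair ans.fst pending.snd) τs else .pair (.num 0) τs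
  else τs

theorem size_absorb_le (pending ans τs : Data) :
    (absorb pending ans τs).size ≤ τs.size + (ans.fst.size + pending.size + 2) := by
  have h1 := pending.size_snd_le
  have h2 := pending.size_pos
  unfold absorb
  split_ifs <;> simp [Data.size] <;> omega

theorem Finds.absorb {I : Type} {lam : I → ℕ} {inp : I → Data} {p a t : I → Data}
    (hp : Finds lam inp p) (ha : Finds lam inp a) (ht : Finds lam inp t) :
    Finds lam inp fun i => _root_.absorb (p i) (a i) (t i) := by
  refine Finds.ite (p := fun i => (p i).isPair = true) hp.isPair
    (fun i => by cases (p i).isPair <;> simp) (Finds.ite (p := fun i => (p i).fst.toNat ≠ 0)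
      hp.fst.toNat (fun _ => Iff.rfl) ((ha.fst.pair hp.snd).pair ht) ((ht.const 0).pair ht)) ht

/-- State of the distinguisher. -/
def relayState (lam : ℕ) (T : Data) (N : ℕ) (st τs pending : Data) : Data :=
  .pair (.num lam) (.pair T (.pair (.num N) (.pair st (.pair τs pending))))

section

variable (A : CQAdversary) (R : Polynomial ℕ)

/-- The oracle answers only after the machine has stopped, so a trapdoor is completed one call
later. Until then the state records the seed and whether the request was a vertex; the next call
absorbs the oracle's answer. -/
theorem exists_relay : ∃ M : PPT, ∀ lam T N st τs pending ans,
    (Data.pair (relayState lam T N st τs pending) ans).size ≤ R.eval lam →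
    M.run lam (.pair (relayState lam T N st τs pending) ans) =
      (A.query.run lam (.pair st (.pair T (absorb pending ans τs)))).bind fun o =>
        (randBits lam).map fun s => .pair o.fst (relayState lam T N o.snd (absorb pending ans τs)
          (.pair (.num (decide (o.fst.toNat < N)).toNat) (.num s))) := by
  let I := {x : ℕ × Data × ℕ × Data × Data × Data × Data //
    (Data.pair (relayState x.1 x.2.1 x.2.2.1 x.2.2.2.1 x.2.2.2.2.1 x.2.2.2.2.2.1)
      x.2.2.2.2.2.2).size ≤ R.eval x.1}
  have hin := Finds.id (I := I) (lam := fun i => i.1.1)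
    (inp := fun i => Data.pair (relayState i.1.1 i.1.2.1 i.1.2.2.1 i.1.2.2.2.1 i.1.2.2.2.2.1
      i.1.2.2.2.2.2.1) i.1.2.2.2.2.2.2) ⟨R, fun i => i.2⟩
  have h0 := hin.fst.fst
  have hT := hin.fst.snd.fst
  have hN := hin.fst.snd.snd.fst
  have hst := hin.fst.snd.snd.snd.fst
  have hτ := Finds.absorb hin.fst.snd.snd.snd.snd.snd hin.snd hin.fst.snd.snd.snd.snd.fst
  have key := Samples.bind (out := fun _ o => o)
    (κ := fun i o => (randBits i.1.1).map fun s => .pair o.fst (relayState i.1.1 i.1.2.1 i.1.2.2.1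
      o.snd (absorb i.1.2.2.2.2.2.1 i.1.2.2.2.2.2.2 i.1.2.2.2.2.1)
      (.pair (.num (decide (o.fst.toNat < i.1.2.2.1)).toNat) (.num s))))
    ((Samples.run A.query (hst.pair (hT.pair hτ)) h0).congr fun i => PMF.map_id _) ?_
  · obtain ⟨M, hM⟩ := PPT.exists_run_eq key
    exact ⟨M, fun lam T N st τs pending ans h => hM ⟨(lam, T, N, st, τs, pending, ans), h⟩⟩
  · intro J i o inp₁ _ hR₁ ho
    refine Samples.map (Samples.randBits (hR₁.finds h0)) fun J' i' s inp₂ _ hR₂ hs => ?_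
    have ho' := hR₂.finds ho
    have hN' := hR₂.finds (hR₁.finds hN)
    have hpend := (ho'.fst.toNat.lt hN').pair hs
    have hst' := ho'.snd.pair ((hR₂.finds (hR₁.finds hτ)).pair hpend)
    exact ho'.fst.pair ((hR₂.finds (hR₁.finds h0)).pair ((hR₂.finds (hR₁.finds hT)).pair
      (hN'.pair hst')))

theorem exists_relayGuess : ∃ M : PPT, ∀ lam T N st τs pending ans,
    (Data.pair (relayState lam T N st τs pending) ans).size ≤ R.eval lam →
    M.run lam (.pair (relayState lam T N st τs pending) ans) =
      A.guess.run lam (.pair st (.pair T (absorb pending ans τs))) := by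
  let I := {x : ℕ × Data × ℕ × Data × Data × Data × Data //
    (Data.pair (relayState x.1 x.2.1 x.2.2.1 x.2.2.2.1 x.2.2.2.2.1 x.2.2.2.2.2.1)
      x.2.2.2.2.2.2).size ≤ R.eval x.1}
  have hin := Finds.id (I := I) (lam := fun i => i.1.1)
    (inp := fun i => Data.pair (relayState i.1.1 i.1.2.1 i.1.2.2.1 i.1.2.2.2.1 i.1.2.2.2.2.1
      i.1.2.2.2.2.2.1) i.1.2.2.2.2.2.2) ⟨R, fun i => i.2⟩
  have hτ := Finds.absorb hin.fst.snd.snd.snd.snd.snd hin.snd hin.fst.snd.snd.snd.snd.fst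
  obtain ⟨M, hM⟩ := PPT.exists_run_eq (Samples.run A.guess
    (hin.fst.snd.snd.snd.fst.pair (hin.fst.snd.fst.pair hτ)) hin.fst.fst)
  exact ⟨M, fun lam T N st τs pending ans h => hM ⟨(lam, T, N, st, τs, pending, ans), h⟩⟩

/-- The adjacency matrix is itself a sequence of length `N` and so names the domain size in unary.
-/
theorem exists_relayStart (B : BilinearGenerator) : ∃ M : PPT, ∀ lam,
    M.run lam (.num lam) = (A.start.run lam (.num lam)).bind fun o =>
      (zeroTable B lam o.fst.length).map fun T =>
        .pair o.fst (relayState lam T o.fst.length o.snd (.num 0) (.num 0)) := by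
  have h0 := Finds.id (I := ℕ) (lam := fun n => n) (inp := fun n => .num n)
    (polyBounded_size_num .self)
  have key := Samples.bind (out := fun _ o => o)
    (κ := fun lam o => (zeroTable B lam o.fst.length).map fun T =>
      .pair o.fst (relayState lam T o.fst.length o.snd (.num 0) (.num 0)))
    ((Samples.run A.start h0 h0).congr fun i => PMF.map_id _) ?_
  · exact PPT.exists_run_eq key
  · intro J i o inp₁ _ hR₁ ho
    have h0' := hR₁.finds h0
    have hN := ho.fst.length h0'
    have hb := ho.fst.polyBounded.mono fun j => (o j).fst.length_le_size
    refine Samples.map (out := fun _ T => T) ((Samples.zeroTable (B := B) h0' hN hb).congr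
      fun j => PMF.map_id _) fun J' i' T inp₂ _ hR₂ hT => ?_
    have ho' := hR₂.finds ho
    have h0'' := hR₂.finds h0'
    have hst := ho'.snd.pair ((h0''.const 0).pair (h0''.const 0))
    exact ho'.fst.pair (h0''.pair (hT.pair ((hR₂.finds hN).pair hst)))

theorem exists_size_zeroTable_le (B : BilinearGenerator) : ∃ p : Polynomial ℕ, ∀ lam,
    ∀ o ∈ (A.start.run lam (.num lam)).support,
    ∀ T ∈ (zeroTable B lam o.fst.length).support, T.size ≤ p.eval lam := by
  let I := {x : ℕ × Data // x.2 ∈ (A.start.run x.1 (.num x.1)).support}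
  have hb : PolyBounded (I := I) (fun i => i.1.1) fun i => i.1.2.fst.length :=
    (polyBounded_start A fun i => i.2).mono fun i =>
      (Data.length_le_size _).trans (Data.size_fst_le _)
  have hin := Finds.id (I := I) (lam := fun i => i.1.1)
    (inp := fun i => .pair (.num i.1.1) (.num i.1.2.fst.length))
    (polyBounded_size_pair (polyBounded_size_num .self) (polyBounded_size_num hb))
  obtain ⟨p, hp⟩ := (Samples.zeroTable (B := B) hin.fst hin.snd hb).exists_size_le
  exact ⟨p, fun lam o ho => hp ⟨(lam, o), ho⟩⟩

end

/-- For a vertex, the recorded seed and the oracle's value make up a trapdoor. For an invalid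
request the validity bit makes `absorb` ignore both, so the superfluous seed does no harm. -/
theorem absorb_trapdoorLaw {α : Type} (lam : ℕ) {N : ℕ} (σ : Equiv.Perm (Fin N)) (v : ℕ)
    (ans τs : Data) (G : Data → PMF α) :
    ((randBits lam).bind fun s => G (absorb (.pair (.num (decide (v < N)).toNat) (.num s))
      (.pair (if hv : v < N then .num (σ ⟨v, hv⟩ : ℕ) else .num 0) ans) τs)) =
      (trapdoorLaw lam σ v).bind fun y => G (.pair y τs) := by
  by_cases h : v < N
  · rw [trapdoorLaw, dif_pos h, dif_pos h, PMF.bind_map]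
    simp [h, absorb, Data.isPair, Data.fst, Data.snd, Data.toNat, Function.comp_def]
  · rw [trapdoorLaw, dif_neg h, dif_neg h, PMF.pure_bind]
    simp [h, absorb, Data.isPair, Data.fst, Data.toNat]

/-- The distinguisher lags one answer behind: its list together with the pending request corresponds
to the adversary's full list. The numeric hypotheses keep every input within `R`. A query lengthens
the oracle's answers by at most `C + 3` and, by `size_absorb_le`, the list by at most `C + lam + 8`.
-/
theorem ask_eq (A : CQAdversary) (D : PermDistinguisher) {lam R C Z : ℕ} {N : ℕ} (hN : N ≤ C)
    {T : Data}
    (hq : ∀ st τs pending ans,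
      (Data.pair (relayState lam T N st τs pending) ans).size ≤ R →
      D.query.run lam (.pair (relayState lam T N st τs pending) ans) =
        (A.query.run lam (.pair st (.pair T (absorb pending ans τs)))).bind fun o =>
          (randBits lam).map fun s => .pair o.fst (relayState lam T N o.snd
            (absorb pending ans τs)
            (.pair (.num (decide (o.fst.toNat < N)).toNat) (.num s))))
    (hg : ∀ st τs pending ans,
      (Data.pair (relayState lam T N st τs pending) ans).size ≤ R →
      D.guess.run lam (.pair (relayState lam T N st τs pending) ans) =
        A.guess.run lam (.pair st (.pair T (absorb pending ans τs))))
    (hR : (Z + Z) + (T.size + C + Z + lam + lam + 20) ≤ R)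
    (hZ : A.query.clock.eval lam + 1 ≤ Z) (σ : Equiv.Perm (Fin N)) (m : ℕ) :
    ∀ st τs pending ans : Data, st.size ≤ Z → pending.size ≤ lam + 4 → ans.fst.size ≤ C + 2 →
      ans.size + m * (C + 3) ≤ Z → τs.size + m * (C + lam + 8) ≤ Z →
      ((D.ask lam σ m (relayState lam T N st τs pending) ans).bind fun w =>
        D.guess.run lam (.pair w.1 w.2)) =
      (countdown (fun _ => A.queryStep lam T (trapdoorLaw lam σ)) m
        (st, absorb pending ans τs)).bind fun w => A.guess.run lam (.pair w.1 (.pair T w.2)) := by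
  have hsize : ∀ st τs pending ans : Data, st.size ≤ Z → pending.size ≤ lam + 4 →
      ans.size ≤ Z → τs.size ≤ Z →
      (Data.pair (relayState lam T N st τs pending) ans).size ≤ R := by
    intro st τs pending ans h1 h2 h3 h4
    have h5 := Nat.size_le_self lam
    have h6 := Nat.size_le_self N
    simp only [relayState, Data.size_pair, Data.size_num]
    omega
  induction m with
  | zero =>
    intro st τs pending ans h1 h2 h3 h4 h5
    rw [countdown, PMF.pure_bind]
    refine (PMF.pure_bind _ _).trans ?_
    exact hg _ _ _ _ (hsize st τs pending ans h1 h2 (by omega) (by omega))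
  | succ m ih =>
    intro st τs pending ans h1 h2 h3 h4 h5
    rw [Nat.add_mul] at h4 h5
    have habs := size_absorb_le pending ans τs
    rw [countdown, CQAdversary.queryStep, PMF.bind_bind, PMF.bind_bind]
    refine (PMF.bind_bind _ _ _).trans ?_
    rw [hq _ _ _ _ (hsize _ _ _ _ h1 h2 (by omega) (by omega)), PMF.bind_bind]
    refine PMF.bind_congr_support _ fun o ho => ?_
    have hos := (o.size_snd_le.trans (PPT.size_run_le _ ho)).trans hZ
    rw [PMF.bind_map, PMF.bind_map]
    refine Eq.trans (PMF.bind_congr_support _ fun s hs => ?_)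
      (absorb_trapdoorLaw lam σ o.fst.toNat ans (absorb pending ans τs) fun τs' =>
        (countdown (fun _ => A.queryStep lam T (trapdoorLaw lam σ)) m (o.snd, τs')).bind
          fun w => A.guess.run lam (.pair w.1 (.pair T w.2)))
    have hs' := Nat.size_le.2 (lt_of_mem_randBits hs)
    have hb := Data.size_num_toNat (decide (o.fst.toNat < N))
    have hy : (if hv : o.fst.toNat < N then Data.num (σ ⟨o.fst.toNat, hv⟩ : ℕ)
        else .num 0).size ≤ C + 1 := by
      split_ifs with hv
      · have h6 := Nat.size_le_self (σ ⟨o.fst.toNat, hv⟩)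
        have h7 := (σ ⟨o.fst.toNat, hv⟩).2
        simp only [Data.size]
        omega
      · simp [Data.size]
    refine ih _ _ _ _ hos ?_ ?_ ?_ ?_
    · simp only [Data.size] at hb ⊢
      omega
    · exact hy.trans (by omega)
    · have key : ∀ y : Data, y.size ≤ C + 1 → (Data.pair y ans).size + m * (C + 3) ≤ Z := by
        intro y h
        rw [Data.size_pair]
        omega
      exact key _ hy
    · omega

/-- The identity holds for every `pick` and hence covers both PRP experiments at once. The initial
pending request `num 0` is not a pair, so `absorb` starts from the empty list. -/
theorem exists_distinguisher (B : BilinearGenerator) (A : CQAdversary) :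
    ∃ D : PermDistinguisher, ∀ lam (pick : (N : ℕ) → PMF (Equiv.Perm (Fin N))),
      D.experiment lam pick = (zeroGame B A lam pick).map Data.toBit := by
  obtain ⟨t, ht⟩ := exists_size_zeroTable_le A B
  let C : Polynomial ℕ := A.start.clock + .C 1
  let Z : Polynomial ℕ := A.query.clock + C + A.queries * (C + .X + .C 8) + .C 1
  let R : Polynomial ℕ := (Z + Z) + (t + C + Z + .X + .X + .C 20)
  obtain ⟨M₁, h₁⟩ := exists_relayStart A B
  obtain ⟨M₂, h₂⟩ := exists_relay A R
  obtain ⟨M₃, h₃⟩ := exists_relayGuess A R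
  refine ⟨⟨M₁, M₂, M₃, A.queries⟩, fun lam pick => ?_⟩
  have hexp : PermDistinguisher.experiment ⟨M₁, M₂, M₃, A.queries⟩ lam pick =
      (M₁.run lam (.num lam)).bind fun o => (pick o.fst.length).bind fun σ =>
        ((PermDistinguisher.ask ⟨M₁, M₂, M₃, A.queries⟩ lam σ (A.queries.eval lam) o.snd
          (.num 0)).bind fun w => M₃.run lam (.pair w.1 w.2)).map Data.toBit := by
    simp only [PMF.map_bind]
    rfl
  rw [hexp, h₁, zeroGame, PMF.map_bind, PMF.bind_bind]
  refine PMF.bind_congr_support _ fun o ho => ?_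
  rw [PMF.bind_map, PMF.map_bind]
  refine PMF.bind_congr_support _ fun T hT => ?_
  rw [PMF.map_bind]
  refine congrArg (PMF.bind (pick o.fst.length)) (funext fun σ => congrArg (PMF.map _) ?_)
  have hstart := PPT.size_run_le _ ho
  have hmul : A.queries.eval lam * (A.start.clock.eval lam + 1 + 3) ≤
      A.queries.eval lam * (A.start.clock.eval lam + 1 + lam + 8) :=
    Nat.mul_le_mul_left _ (by omega)
  refine (ask_eq A ⟨M₁, M₂, M₃, A.queries⟩ (R := R.eval lam) (C := C.eval lam) (Z := Z.eval lam)
    (N := o.fst.length) (T := T) ?_ (fun _ _ _ _ => h₂ _ _ _ _ _ _ _)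
    (fun _ _ _ _ => h₃ _ _ _ _ _ _ _) ?_ ?_ σ (A.queries.eval lam) o.snd (.num 0) (.num 0)
    (.num 0) ?_ ?_ ?_ ?_ ?_).trans ?_
  · simpa [C] using length_start_le A ho
  · have := ht lam o ho T hT
    simp only [R, Polynomial.eval_add, Polynomial.eval_X, Polynomial.eval_C]
    omega
  · simp only [Z, C, Polynomial.eval_add, Polynomial.eval_C]
    omega
  · have := o.size_snd_le
    simp only [Z, C, Polynomial.eval_add, Polynomial.eval_C]
    omega
  · simp [Data.size]
  · simp [Data.size, Data.fst]
  · simp [Z, C, Data.size]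
    omega
  · simp [Z, C, Data.size]
    omega
  · rfl

/-! ## Sampling a permutation lazily -/

theorem PMF.eq_uniformOfFinset {α : Type} {s : Finset α} (hs : s.Nonempty) (μ : PMF α)
    (k : ENNReal) (h₁ : ∀ a ∈ s, μ a = k) (h₀ : ∀ a ∉ s, μ a = 0) :
    μ = PMF.uniformOfFinset s hs := by
  have hk : (s.card : ENNReal) * k = 1 := by
    rw [← μ.tsum_coe, tsum_eq_sum (s := s) (fun a ha => h₀ a ha), Finset.sum_congr rfl h₁,
      Finset.sum_const, nsmul_eq_mul]
  ext a
  by_cases ha : a ∈ s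
  · rw [PMF.uniformOfFinset_apply_of_mem hs ha, h₁ a ha]
    exact ENNReal.eq_inv_of_mul_eq_one_left (by rwa [mul_comm])
  · rw [PMF.uniformOfFinset_apply_of_notMem hs ha, h₀ a ha]

section

variable {N : ℕ}

/-- Permutations that map the list `past` to the list `ids`. -/
def extensions (past ids : List (Fin N)) : Finset (Equiv.Perm (Fin N)) :=
  Finset.univ.filter fun σ => past.map σ = ids

theorem mem_extensions {past ids : List (Fin N)} {σ : Equiv.Perm (Fin N)} :
    σ ∈ extensions past ids ↔ past.map σ = ids := by
  simp [extensions]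

theorem mem_extensions_append {past ids : List (Fin N)} {v y : Fin N} {σ : Equiv.Perm (Fin N)} :
    σ ∈ extensions (past ++ [v]) (ids ++ [y]) ↔ σ ∈ extensions past ids ∧ σ v = y := by
  rw [mem_extensions, mem_extensions, List.map_append, List.map_singleton]
  refine ⟨fun h => ?_, fun h => by rw [h.1, h.2]⟩
  obtain ⟨h1, h2⟩ := List.append_inj' h rfl
  exact ⟨h1, List.singleton_inj.1 h2⟩

/-- A transposition of two identifiers that have not been given out does not disturb the values
already fixed. -/
theorem swap_mul_mem_extensions {past ids : List (Fin N)} {y y' : Fin N}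
    {σ : Equiv.Perm (Fin N)} (hy : y ∉ ids) (hy' : y' ∉ ids) (hσ : σ ∈ extensions past ids) :
    Equiv.swap y y' * σ ∈ extensions past ids := by
  rw [mem_extensions] at hσ ⊢
  subst hσ
  refine List.map_congr_left fun w hw => ?_
  have hw' := List.mem_map_of_mem (f := σ) hw
  exact Equiv.swap_apply_of_ne_of_ne (fun h => hy (h ▸ hw')) fun h => hy' (h ▸ hw')

theorem apply_notMem_of_mem_extensions {past ids : List (Fin N)} {v : Fin N}
    {σ : Equiv.Perm (Fin N)} (hv : v ∉ past) (hσ : σ ∈ extensions past ids) : σ v ∉ ids := by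
  rw [mem_extensions] at hσ
  subst hσ
  simpa using hv

theorem extensions_append_nonempty {past ids : List (Fin N)} {v y : Fin N} (hv : v ∉ past)
    (hy : y ∉ ids) (h : (extensions past ids).Nonempty) :
    (extensions (past ++ [v]) (ids ++ [y])).Nonempty := by
  obtain ⟨σ, hσ⟩ := h
  refine ⟨Equiv.swap (σ v) y * σ, mem_extensions_append.2 ⟨swap_mul_mem_extensions
    (apply_notMem_of_mem_extensions hv hσ) hy hσ, ?_⟩⟩
  simp

theorem card_extensions_append_le {past ids : List (Fin N)} {v y y' : Fin N} (hy : y ∉ ids)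
    (hy' : y' ∉ ids) : (extensions (past ++ [v]) (ids ++ [y])).card ≤
      (extensions (past ++ [v]) (ids ++ [y'])).card := by
  refine Finset.card_le_card_of_injOn (fun σ => Equiv.swap y y' * σ) (fun σ hσ => ?_)
    fun σ _ σ' _ h => mul_left_cancel h
  obtain ⟨h1, h2⟩ := mem_extensions_append.1 (Finset.mem_coe.1 hσ)
  refine Finset.mem_coe.2 (mem_extensions_append.2 ⟨swap_mul_mem_extensions hy hy' h1, ?_⟩)
  simp [h2]

theorem card_extensions_append {past ids : List (Fin N)} {v y y' : Fin N} (hy : y ∉ ids)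
    (hy' : y' ∉ ids) : (extensions (past ++ [v]) (ids ++ [y])).card =
      (extensions (past ++ [v]) (ids ++ [y'])).card :=
  (card_extensions_append_le hy hy').antisymm (card_extensions_append_le hy' hy)

open Classical in
/-- Uniform permutation among those that map `past` to `ids`. -/
noncomputable def extensionLaw (past ids : List (Fin N)) : PMF (Equiv.Perm (Fin N)) :=
  if h : (extensions past ids).Nonempty then PMF.uniformOfFinset _ h else PMF.pure 1

theorem mem_support_extensionLaw {past ids : List (Fin N)} {σ : Equiv.Perm (Fin N)}
    (h : (extensions past ids).Nonempty) (hσ : σ ∈ (extensionLaw past ids).support) :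
    past.map σ = ids := by
  rw [extensionLaw, dif_pos h, PMF.mem_support_uniformOfFinset_iff] at hσ
  exact mem_extensions.1 hσ

theorem extensionLaw_nil :
    extensionLaw ([] : List (Fin N)) [] = PMF.uniformOfFintype (Equiv.Perm (Fin N)) := by
  have h : extensions ([] : List (Fin N)) [] = Finset.univ := by
    ext σ
    simp [mem_extensions]
  have h' : (extensions ([] : List (Fin N)) []).Nonempty := by rw [h]; exact Finset.univ_nonempty
  rw [extensionLaw, dif_pos h']
  symm
  refine PMF.eq_uniformOfFinset _ _ _ (fun σ _ => PMF.uniformOfFintype_apply σ) fun σ hσ => ?_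
  rw [h] at hσ
  exact absurd (Finset.mem_univ σ) hσ

/-- The case of a repeated query: the value is already forced, and recording it again changes
nothing. -/
theorem extensionLaw_append_of_apply_eq {past ids : List (Fin N)} {v y : Fin N}
    (h : ∀ σ ∈ extensions past ids, σ v = y) :
    extensionLaw (past ++ [v]) (ids ++ [y]) = extensionLaw past ids := by
  have h' : extensions (past ++ [v]) (ids ++ [y]) = extensions past ids := by
    ext σ
    rw [mem_extensions_append]
    exact ⟨fun h => h.1, fun hσ => ⟨hσ, h σ hσ⟩⟩
  unfold extensionLaw
  simp only [h']

/-- The image of a further point is uniform among the free identifiers. -/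
theorem extensionLaw_eq_bind {past ids : List (Fin N)} {v : Fin N} (hv : v ∉ past)
    (hne : (extensions past ids).Nonempty) {r : ℕ} {u : Fin (r + 1) → Fin N}
    (hu : Function.Injective u) (hr : ∀ y, y ∈ Set.range u ↔ y ∉ ids) :
    extensionLaw past ids = (PMF.uniformOfFintype (Fin (r + 1))).bind fun j =>
      extensionLaw (past ++ [v]) (ids ++ [u j]) := by
  have hfree : ∀ j, u j ∉ ids := fun j => (hr _).1 ⟨j, rfl⟩
  have hlaw : ∀ j, extensionLaw (past ++ [v]) (ids ++ [u j]) =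
      PMF.uniformOfFinset _ (extensions_append_nonempty hv (hfree j) hne) := fun j =>
    dif_pos (extensions_append_nonempty hv (hfree j) hne)
  rw [extensionLaw, dif_pos hne]
  symm
  -- The common mass is that of one choice of `j` times that of one permutation in its fibre. All
  -- fibres have the size of the one over `u 0`, and a given `σ` lies only in the fibre with `u j =
  -- σ v`.
  refine PMF.eq_uniformOfFinset hne _ ((Fintype.card (Fin (r + 1)) : ENNReal)⁻¹ *
    ((extensions (past ++ [v]) (ids ++ [u 0])).card : ENNReal)⁻¹) (fun σ hσ => ?_) fun σ hσ => ?_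
  · obtain ⟨j, hj⟩ := (hr (σ v)).2 (apply_notMem_of_mem_extensions hv hσ)
    rw [PMF.bind_apply, tsum_eq_single j]
    · rw [hlaw, PMF.uniformOfFintype_apply,
        PMF.uniformOfFinset_apply_of_mem _ (mem_extensions_append.2 ⟨hσ, hj.symm⟩),
        card_extensions_append (hfree j) (hfree 0)]
    · intro j' hj'
      rw [hlaw, PMF.uniformOfFinset_apply_of_notMem, mul_zero]
      intro h
      exact hj' (hu ((mem_extensions_append.1 h).2.symm.trans hj.symm))
  · rw [PMF.bind_apply, ENNReal.tsum_eq_zero]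
    intro j
    rw [hlaw, PMF.uniformOfFinset_apply_of_notMem, mul_zero]
    exact fun h => hσ (mem_extensions_append.1 h).1

end

/-! ## The simulator that is given the repetitions -/

theorem indep_pure {α : Type} {n : ℕ} (f : Fin n → α) :
    (indep n fun i => PMF.pure (f i)) = PMF.pure f := by
  induction n with
  | zero => exact congrArg PMF.pure (Subsingleton.elim _ _)
  | succ n ih =>
    rw [indep_succ, PMF.pure_bind, ih, PMF.pure_map]
    exact congrArg PMF.pure (Fin.cons_self_tail f)

theorem Finds.tabulate {I : Type} {lam : I → ℕ} {inp : I → Data} {n : I → ℕ}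
    {f : I → ℕ → Data} (hn : Finds lam inp fun i => .num (n i)) (hb : PolyBounded lam n)
    (hf : ∀ (J : Type) (i : J → I) (k : J → ℕ) (inp' : J → Data), (∀ j, k j < n (i j)) →
      Refines lam inp i inp' → Finds (fun j => lam (i j)) inp' (fun j => .num (k j)) →
      Finds (fun j => lam (i j)) inp' fun j => f (i j) (k j)) :
    Finds lam inp fun i => Data.ofList (List.ofFn fun a : Fin (n i) => f i a) := by
  have h := Samples.tabulate (κ := fun i k => PMF.pure (f i k)) hn hb hf
  simpa only [indep_pure, PMF.pure_map] using h

theorem Data.length_ofList (l : List Data) : (Data.ofList l).length = l.length := by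
  induction l with
  | nil => rfl
  | cons a l ih => simp [Data.ofList, Data.length, ih]

theorem Data.nth_ofList (l : List Data) (i : ℕ) (h : i < l.length) :
    (Data.ofList l).nth i = l[i] := by
  induction l generalizing i with
  | nil => simp at h
  | cons a l ih =>
    cases i with
    | zero => rfl
    | succ i => exact ih i (by simpa using h)

theorem Data.nth_ofList_ofFn {n : ℕ} (f : Fin n → Data) (i : ℕ) (h : i < n) :
    (Data.ofList (List.ofFn f)).nth i = f ⟨i, h⟩ := by
  rw [Data.nth_ofList _ _ (by simpa using h), List.getElem_ofFn]

theorem Data.size_ofList_le {l : List Data} {b : ℕ} (h : ∀ x ∈ l, x.size ≤ b) :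
    (Data.ofList l).size ≤ l.length * (b + 1) + 1 := by
  induction l with
  | nil => simp [Data.ofList, Data.size]
  | cons a l ih =>
    have h1 := h a (by simp)
    have h2 := ih fun x hx => h x (by simp [hx])
    rw [List.length_cons, Nat.add_mul]
    simp only [Data.ofList, Data.size]
    omega

/-- Sequence `U` of length `n` without entry number `j`. -/
def Data.remove (U : Data) (n j : ℕ) : Data :=
  .ofList (.ofFn fun i : Fin (n - 1) => if (i : ℕ) < j then U.nth i else U.nth (i + 1))

/-- State of the simulator: the identifiers given out, the most recent first, and those left. -/
def lazyState (lam : ℕ) (I U : Data) : Data :=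
  .pair (.num lam) (.pair I U)

/-- Answer and new state, when the identifier has been found. -/
def lazyReply (lam : ℕ) (I U id : Data) (s : ℕ) : Data :=
  .pair (.pair id (.num s)) (lazyState lam (.pair id I) U)

/-- The first occurrence of a new vertex has as its number the count of earlier valid queries, so
comparison with the length of the leakage list detects repetitions. Identifiers are stored anew at
every query, most recent first, which explains the reversed index. The draw `j` is made in both
cases and ignored for a repetition. -/
theorem exists_lazyAnswer (R : Polynomial ℕ) : ∃ M : PPT, ∀ lam I U l leaks,
    (Data.pair (lazyState lam I U) (.pair l leaks)).size ≤ R.eval lam →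
    M.run lam (.pair (lazyState lam I U) (.pair l leaks)) =
      (randBelow U.length).bind fun j => (randBits lam).map fun s =>
        if l.toNat < leaks.length then lazyReply lam I U (I.nth (leaks.length - 1 - l.toNat)) s
        else lazyReply lam I (U.remove U.length j) (U.nth j) s := by
  let X := {x : ℕ × Data × Data × Data × Data //
    (Data.pair (lazyState x.1 x.2.1 x.2.2.1) (.pair x.2.2.2.1 x.2.2.2.2)).size ≤ R.eval x.1}
  have hin := Finds.id (I := X) (lam := fun i => i.1.1)
    (inp := fun i => Data.pair (lazyState i.1.1 i.1.2.1 i.1.2.2.1) (.pair i.1.2.2.2.1 i.1.2.2.2.2))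
    ⟨R, fun i => i.2⟩
  have h0 := hin.fst.fst
  have hI := hin.fst.snd.fst
  have hU := hin.fst.snd.snd
  have hl := hin.snd.fst
  have hleaks := hin.snd.snd
  have hc := hleaks.length h0
  have hn := hU.length h0
  have hcb := hleaks.polyBounded.mono fun i => Data.length_le_size _
  have hnb := hU.polyBounded.mono fun i => Data.length_le_size _
  have hidx := (hc.sub (h0.const 1)).sub hl.toNat
  have hold := hI.nth hidx (hcb.mono fun i => (Nat.sub_le _ _).trans (Nat.sub_le _ _))
  have key := Samples.bind (out := fun _ => Data.num)
    (κ := fun i j => (randBits i.1.1).map fun s =>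
      if i.1.2.2.2.1.toNat < i.1.2.2.2.2.length then
        lazyReply i.1.1 i.1.2.1 i.1.2.2.1
          (i.1.2.1.nth (i.1.2.2.2.2.length - 1 - i.1.2.2.2.1.toNat)) s
      else lazyReply i.1.1 i.1.2.1 (i.1.2.2.1.remove i.1.2.2.1.length j) (i.1.2.2.1.nth j) s)
    (Samples.rand hn) ?_
  · obtain ⟨M, hM⟩ := PPT.exists_run_eq key
    exact ⟨M, fun lam I U l leaks h => hM ⟨(lam, I, U, l, leaks), h⟩⟩
  · intro J i j inp₁ hj' hR₁ hj
    have h0' := hR₁.finds h0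
    have hn' := hR₁.finds hn
    have hU' := hR₁.finds hU
    have hjb : PolyBounded (fun a => (i a).1.1) j :=
      (hnb.comp i).mono fun a => Prog.size_randBelow (hj' a)
    have hrem : Finds (fun a => (i a).1.1) inp₁ fun a =>
        ((i a).1.2.2.1).remove (i a).1.2.2.1.length (j a) := by
      refine Finds.tabulate (f := fun a k => if k < j a then (i a).1.2.2.1.nth k
        else (i a).1.2.2.1.nth (k + 1)) (hn'.sub (h0'.const 1))
        ((hnb.comp i).mono fun a => Nat.sub_le _ _) fun J' i' k inp₂ hk hR₂ hk' => ?_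
      have hkb : PolyBounded (fun a => (i (i' a)).1.1) k :=
        (hnb.comp fun a => i (i' a)).mono fun a => (hk a).le.trans (Nat.sub_le _ _)
      have hU'' := hR₂.finds hU'
      exact Finds.ite (p := fun a => k a < j (i' a)) (hk'.lt (hR₂.finds hj))
        (fun a => by simp) (hU''.nth hk' hkb)
        (hU''.nth (hk'.add (hk'.const 1)) (hkb.add (.const 1)))
    have hnew := hU'.nth hj hjb
    refine Samples.map (Samples.randBits h0') fun J' i' s inp₂ _ hR₂ hs => ?_
    have h0'' := hR₂.finds h0'
    have hI'' := hR₂.finds (hR₁.finds hI)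
    have hold'' := hR₂.finds (hR₁.finds hold)
    have hnew'' := hR₂.finds hnew
    have hlt := (hR₂.finds (hR₁.finds hl.toNat)).lt (hR₂.finds (hR₁.finds hc))
    refine Finds.ite (p := fun a =>
      (i (i' a)).1.2.2.2.1.toNat < (i (i' a)).1.2.2.2.2.length) hlt
      (fun a => by
        simp only [ne_eq, Bool.toNat_eq_zero, Bool.not_eq_false]
        exact decide_eq_true_iff)
      ((hold''.pair hs).pair (h0''.pair ((hold''.pair hI'').pair (hR₂.finds hU'))))
      ((hnew''.pair hs).pair (h0''.pair ((hnew''.pair hI'').pair (hR₂.finds hrem))))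

section

variable {N : ℕ}

/-- A list of identifiers as data, in reverse order. -/
def idsData (ids : List (Fin N)) : Data :=
  .ofList (ids.reverse.map fun y : Fin N => Data.num y)

/-- The free identifiers as data. -/
def freeData {r : ℕ} (u : Fin r → Fin N) : Data :=
  .ofList (.ofFn fun j => Data.num (u j))

theorem idsData_append (ids : List (Fin N)) (y : Fin N) :
    idsData (ids ++ [y]) = .pair (.num y) (idsData ids) := by
  simp [idsData, Data.ofList]

theorem nth_idsData (ids : List (Fin N)) {i : ℕ} (h : i < ids.length) :
    (idsData ids).nth (ids.length - 1 - i) = .num ids[i] := by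
  rw [idsData, Data.nth_ofList _ _ (by simp; omega), List.getElem_map, List.getElem_reverse]
  congr 3
  omega

theorem remove_freeData {r : ℕ} (u : Fin (r + 1) → Fin N) (j : Fin (r + 1)) :
    (freeData u).remove (r + 1) j = freeData fun i => u (j.succAbove i) := by
  unfold Data.remove freeData
  congr 2
  funext i
  have hi : (i : ℕ) < r := i.2
  rw [Data.nth_ofList_ofFn _ _ (by omega), Data.nth_ofList_ofFn _ _ (by omega)]
  by_cases h : (i : ℕ) < j
  · rw [if_pos h]
    change _ = Data.num (u (j.succAbove ⟨i, hi⟩))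
    rw [Fin.succAbove_of_castSucc_lt _ _ (by simpa [Fin.lt_def] using h)]
    rfl
  · rw [if_neg h]
    change _ = Data.num (u (j.succAbove ⟨i, hi⟩))
    rw [Fin.succAbove_of_le_castSucc _ _ (by simpa [Fin.le_def] using h)]
    rfl

theorem size_num_fin_le (y : Fin N) : (Data.num y).size ≤ N + 1 := by
  have h1 := Nat.size_le_self y
  have h2 := y.2
  rw [Data.size_num]
  omega

theorem size_idsData_le (ids : List (Fin N)) : (idsData ids).size ≤ ids.length * (N + 2) + 1 := by
  have := Data.size_ofList_le (l := ids.reverse.map fun y : Fin N => Data.num y) (b := N + 1) (by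
    intro x hx
    obtain ⟨y, -, rfl⟩ := List.mem_map.1 hx
    exact size_num_fin_le y)
  simpa [idsData] using this

theorem size_freeData_le {r : ℕ} (u : Fin r → Fin N) :
    (freeData u).size ≤ r * (N + 2) + 1 := by
  have := Data.size_ofList_le (l := List.ofFn fun j => Data.num (u j)) (b := N + 1) (by
    intro x hx
    obtain ⟨j, rfl⟩ := (List.mem_ofFn' _ _).1 hx
    exact size_num_fin_le _)
  simpa [freeData] using this

theorem length_freeData {r : ℕ} (u : Fin r → Fin N) : (freeData u).length = r := by
  rw [freeData, Data.length_ofList, List.length_ofFn]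

end

theorem trapdoorLaw_fin (lam : ℕ) {N : ℕ} (σ : Equiv.Perm (Fin N)) (v : Fin N) :
    trapdoorLaw lam σ v = (randBits lam).map fun s => .pair (.num (σ v)) (.num s) :=
  dif_pos v.2

/-- Deferred decisions: given the answers so far, the permutation is uniform among those consistent
with them. The function `u` enumerates the free identifiers. A leakage number and its pair add at
most `q + 2` to the list. -/
theorem repetition_idealQueries_eq (A : CQAdversary) (S : CQSimulator) {lam R K q N : ℕ}
    (hS : ∀ I U l leaks, (Data.pair (lazyState lam I U) (.pair l leaks)).size ≤ R →
      S.answer.run lam (.pair (lazyState lam I U) (.pair l leaks)) =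
        (randBelow U.length).bind fun j => (randBits lam).map fun s =>
          if l.toNat < leaks.length then lazyReply lam I U (I.nth (leaks.length - 1 - l.toNat)) s
          else lazyReply lam I (U.remove U.length j) (U.nth j) s)
    (hR : lam + q * (N + 2) + N * (N + 2) + q + K + 10 ≤ R) (T : Data) (m : ℕ) :
    ∀ (st τs : Data) (past ids : List (Fin N)) (r : ℕ) (u : Fin r → Fin N) (leaks : Data),
      (extensions past ids).Nonempty → Function.Injective u →
      (∀ y, y ∈ Set.range u ↔ y ∉ ids) → leaks.length = past.length → past.length + m ≤ q →
      leaks.size + m * (q + 2) ≤ K →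
      repetitionLeakage.idealQueries A S lam (N := N) T m st τs past leaks
        (lazyState lam (idsData ids) (freeData u)) =
      (extensionLaw past ids).bind fun σ =>
        countdown (fun _ => A.queryStep lam T (trapdoorLaw lam σ)) m (st, τs) := by
  induction m with
  | zero =>
    intros
    exact (PMF.bind_const _ _).symm
  | succ m ih =>
    intro st τs past ids r u leaks hne hu hr hlen hq hK
    rw [Nat.add_mul] at hK
    simp only [countdown, CQAdversary.queryStep, PMF.bind_bind]
    -- The adversary's next request is chosen without knowledge of `σ`, so it may be drawn first.
    rw [PMF.bind_comm]
    refine congrArg (PMF.bind _) (funext fun o => ?_)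
    simp only [PMF.bind_map]
    by_cases h : o.fst.toNat < N
    swap
    · rw [dif_neg h]
      simp only [trapdoorLaw, dif_neg h, PMF.pure_bind]
      exact ih _ _ _ _ _ _ _ hne hu hr hlen (by omega) (by omega)
    rw [dif_pos h]
    set v : Fin N := ⟨o.fst.toNat, h⟩ with hv
    have hov : o.fst.toNat = (v : ℕ) := rfl
    simp only [hov, trapdoorLaw_fin, PMF.bind_map]
    obtain ⟨σ₀, hσ₀⟩ := id hne
    have hids : ids.length = past.length := by
      rw [← mem_extensions.1 hσ₀, List.length_map]
    have hidx : past.idxOf v ≤ past.length := List.idxOf_le_length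
    have hrN : r ≤ N := by simpa using Fintype.card_le_of_injective u hu
    have hsize : (Data.pair (lazyState lam (idsData ids) (freeData u))
        (.pair (.num (past.idxOf v)) leaks)).size ≤ R := by
      have h1 := size_idsData_le ids
      have h2 := size_freeData_le u
      have h3 : ids.length * (N + 2) ≤ q * (N + 2) := Nat.mul_le_mul_right _ (by omega)
      have h4 : r * (N + 2) ≤ N * (N + 2) := Nat.mul_le_mul_right _ hrN
      have h5 := Nat.size_le_self (past.idxOf v)
      have h6 := Nat.size_le_self lam
      simp only [lazyState, Data.size_pair, Data.size_num]
      omega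
    have hleaks : (Data.pair (.num (past.idxOf v)) leaks).size + m * (q + 2) ≤ K := by
      have h5 := Nat.size_le_self (past.idxOf v)
      simp only [Data.size_pair, Data.size_num]
      omega
    have hlen' : (Data.pair (.num (past.idxOf v)) leaks).length = (past ++ [v]).length := by
      simp [Data.length, hlen]
    have hq' : (past ++ [v]).length + m ≤ q := by
      simp
      omega
    refine (PMF.pure_bind _ _).trans ?_
    refine (congrArg (fun μ => PMF.bind μ _) (hS _ _ _ _ hsize)).trans ?_
    rw [PMF.bind_bind, Data.toNat_num, hlen]
    by_cases hmem : v ∈ past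
    · have hlt : past.idxOf v < past.length := List.idxOf_lt_length_of_mem hmem
      set y : Fin N := ids[past.idxOf v]'(by omega) with hy
      have hval : ∀ σ ∈ extensions past ids, σ v = y := by
        intro σ hσ
        have := mem_extensions.1 hσ
        simp only [hy, ← this, List.getElem_map, List.getElem_idxOf]
      -- For a repeated vertex the reply does not depend on `j`, which is averaged out.
      refine (congrArg (PMF.bind _) (funext fun j => ?_)).trans (PMF.bind_const _
        ((randBits lam).bind fun s => (extensionLaw past ids).bind fun σ => countdown (fun _ => A.queryStep lam T
          (trapdoorLaw lam σ)) m (o.snd, .pair (.pair (.num y) (.num s)) τs))) |>.trans ?_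
      · rw [PMF.bind_map]
        refine congrArg (PMF.bind _) (funext fun s => ?_)
        simp only [Function.comp, if_pos hlt]
        rw [← hids, nth_idsData ids (by omega), ← extensionLaw_append_of_apply_eq hval,
          lazyReply, ← idsData_append]
        refine ih _ _ _ _ _ u _ ?_ hu ?_ hlen' hq' hleaks
        · exact ⟨σ₀, mem_extensions_append.2 ⟨hσ₀, hval σ₀ hσ₀⟩⟩
        · intro z
          rw [hr, List.mem_append, List.mem_singleton, not_or]
          refine ⟨fun h => ⟨h, ?_⟩, fun h => h.1⟩
          rintro rfl
          exact h (List.getElem_mem _)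
      · rw [PMF.bind_comm]
        refine PMF.bind_congr_support _ fun σ hσ => ?_
        rw [hval σ (mem_extensions.2 (mem_support_extensionLaw hne hσ))]
        rfl
    -- A new vertex has a free image under `σ₀`, so at least one identifier is left.
    · obtain ⟨r, rfl⟩ : ∃ r', r = r' + 1 := by
        obtain ⟨j, -⟩ := (hr (σ₀ v)).2 (apply_notMem_of_mem_extensions hmem hσ₀)
        exact ⟨r - 1, by have := j.2; omega⟩
      have hidx' : ¬ past.idxOf v < past.length := by
        rw [List.idxOf_eq_length hmem]
        exact lt_irrefl _
      have hfree : ∀ j, u j ∉ ids := fun j => (hr _).1 ⟨j, rfl⟩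
      -- On both sides the next identifier is now a uniform choice of `j`, made before the rest of
      -- `σ`.
      rw [extensionLaw_eq_bind hmem hne hu hr, length_freeData, randBelow, PMF.bind_map,
        PMF.bind_bind]
      refine congrArg (PMF.bind _) (funext fun j => ?_)
      have hne' := extensions_append_nonempty hmem (hfree j) hne
      rw [Function.comp_apply, PMF.bind_map]
      have hnth : (freeData u).nth j = .num (u j) := Data.nth_ofList_ofFn _ _ j.2
      simp only [Function.comp_def, if_neg hidx', hnth, remove_freeData]
      rw [PMF.bind_comm]
      refine congrArg (PMF.bind _) (funext fun s => ?_)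
      refine Eq.trans ?_ (PMF.bind_congr_support (extensionLaw (past ++ [v]) (ids ++ [u j]))
        (f := fun σ => countdown (fun _ => A.queryStep lam T (trapdoorLaw lam σ)) m
          (o.snd, .pair (.pair (.num (u j)) (.num s)) τs)) fun σ hσ => ?_)
      · rw [lazyReply, ← idsData_append]
        refine ih _ _ _ _ _ (fun i => u (j.succAbove i)) _ hne' ?_ ?_ hlen' hq' hleaks
        · exact hu.comp Fin.succAbove_right_injective
        · intro z
          rw [List.mem_append, List.mem_singleton, not_or, ← hr]
          constructor
          · rintro ⟨i, rfl⟩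
            exact ⟨⟨_, rfl⟩, fun h => Fin.succAbove_ne j i (hu h)⟩
          · rintro ⟨⟨i, rfl⟩, h⟩
            obtain ⟨i', rfl⟩ := Fin.exists_succAbove_eq (fun h' => h (congrArg u h'))
            exact ⟨i', rfl⟩
      · have := mem_extensions_append.1 (mem_extensions.2 (mem_support_extensionLaw hne' hσ))
        rw [this.2]

theorem exists_lazyStart (B : BilinearGenerator) (p : Polynomial ℕ) : ∃ M : PPT, ∀ lam N,
    N ≤ p.eval lam → M.run lam (.pair (.num lam) (.num N)) =
      (zeroTable B lam N).map fun T =>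
        .pair T (lazyState lam (idsData ([] : List (Fin N))) (freeData (id : Fin N → Fin N))) := by
  let I := {x : ℕ × ℕ // x.2 ≤ p.eval x.1}
  have hb : PolyBounded (I := I) (fun i => i.1.1) fun i => i.1.2 :=
    (PolyBounded.eval p).mono fun i => i.2
  have hin := Finds.id (I := I) (lam := fun i => i.1.1)
    (inp := fun i => .pair (.num i.1.1) (.num i.1.2))
    (polyBounded_size_pair (polyBounded_size_num .self) (polyBounded_size_num hb))
  have h0 := hin.fst
  have hfree : Finds (I := I) (fun i => i.1.1) (fun i => .pair (.num i.1.1) (.num i.1.2))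
      fun i => freeData (id : Fin i.1.2 → Fin i.1.2) :=
    Finds.tabulate (f := fun _ k => .num k) hin.snd hb fun _ _ _ _ _ _ hk => hk
  have key : Samples (I := I) (fun i => i.1.1) (fun i => .pair (.num i.1.1) (.num i.1.2))
      fun i => (zeroTable B i.1.1 i.1.2).map fun T =>
        .pair T (lazyState i.1.1 (.num 0) (freeData (id : Fin i.1.2 → Fin i.1.2))) :=
    Samples.map (out := fun _ T => T) ((Samples.zeroTable hin.fst hin.snd hb).congr
      fun i => PMF.map_id _) fun J i T inp' _ hR hT =>
        hT.pair ((hR.finds h0).pair ((hT.const 0).pair (hR.finds hfree)))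
  obtain ⟨M, hM⟩ := PPT.exists_run_eq key
  exact ⟨M, fun lam N h => hM ⟨(lam, N), h⟩⟩

theorem exists_repetition_simulator (B : BilinearGenerator) (A : CQAdversary) :
    ∃ S : CQSimulator, ∀ lam, repetitionLeakage.ideal A S lam =
      (zeroGame B A lam fun N => PMF.uniformOfFintype (Equiv.Perm (Fin N))).map Data.toBit := by
  let C : Polynomial ℕ := A.start.clock + .C 1
  -- `K` bounds the leakage list; `R` adds the identifiers given out, at most one per query, and
  -- those left, at most `N`.
  let K : Polynomial ℕ := A.queries * (A.queries + .C 2) + .C 1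
  let R : Polynomial ℕ := .X + A.queries * (C + .C 2) + C * (C + .C 2) + A.queries + K + .C 10
  obtain ⟨S₁, h₁⟩ := exists_lazyStart B C
  obtain ⟨S₂, h₂⟩ := exists_lazyAnswer R
  refine ⟨⟨S₁, S₂⟩, fun lam => ?_⟩
  rw [zeroGame, PMF.map_bind]
  refine PMF.bind_congr_support _ fun o ho => ?_
  have hN : o.fst.length ≤ C.eval lam := by simpa [C] using length_start_le A ho
  refine (PMF.pure_bind _ _).trans ?_
  refine (congrArg (fun μ => PMF.bind μ _) (h₁ lam _ hN)).trans ?_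
  rw [PMF.bind_map, PMF.map_bind]
  congr 1
  funext T
  simp only [Function.comp, CQAdversary.finish, PMF.map_bind]
  refine (congrArg (fun μ => PMF.bind μ _) (repetition_idealQueries_eq A ⟨S₁, S₂⟩
    (R := R.eval lam) (K := K.eval lam) (q := A.queries.eval lam) (N := o.fst.length)
    (fun _ _ _ _ => h₂ _ _ _ _ _) ?_ T (A.queries.eval lam) o.snd (.num 0) [] [] _ id (.num 0)
    ⟨1, mem_extensions.2 rfl⟩ Function.injective_id (by simp) rfl (by simp) ?_)).trans ?_
  · have h3 : A.queries.eval lam * (o.fst.length + 2) ≤ A.queries.eval lam * (C.eval lam + 2) :=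
      Nat.mul_le_mul_left _ (by omega)
    have h4 : o.fst.length * (o.fst.length + 2) ≤ C.eval lam * (C.eval lam + 2) :=
      Nat.mul_le_mul hN (by omega)
    simp only [R, Polynomial.eval_add, Polynomial.eval_mul, Polynomial.eval_C, Polynomial.eval_X]
    omega
  · simp [K, Data.size]
    omega
  · rw [extensionLaw_nil, PMF.bind_bind]
    rfl

/-! ## Security -/

theorem theorem1 (B : BilinearGenerator) (F π : PermFamily)
    (hB : BGN.SemanticallySecure B) (hF : F.IsPRP) :
    (slpI B F π).CQA2Secure (slpI B F π).trapdoorLeakage ∧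
      (slpI B F π).CQA2Secure repetitionLeakage := by
  refine ⟨fun A => ?_, fun A => ?_⟩
  · obtain ⟨S, hS⟩ := SLPI.exists_simulator B F π A
    refine ⟨S, (negligible_hybrid_zeroGame hB hF.1 A).mono fun lam => le_of_eq ?_⟩
    rw [SLPI.real_eq, hS]
  · obtain ⟨S, hS⟩ := exists_repetition_simulator B A
    obtain ⟨D, hD⟩ := exists_distinguisher B A
    -- Two hops, through `zeroGame` with `F_k`: BGN security accounts for the ciphertexts, the PRP
    -- for the permutation.
    refine ⟨S, ((negligible_hybrid_zeroGame hB hF.1 A).add (hF.2 D)).mono fun lam => ?_⟩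
    rw [SLPI.real_eq, hS, hD, hD]
    exact advantage_triangle _ _ _
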